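/- Conventions. A partial field is a set $P$ with distinguished elements $0,1$, a commutative multiplication for which $P\setminus\{0\}$ is an abelian group with identity $1$ and $0\cdot p=0$ for all $p$, and a partially defined addition satisfying: $p+0=p$; every $p$ has a unique additive inverse $-p$; addition is commutative (if $p+q$ is defined, so is $q+p$, and they are equal); for $p\neq 0$, $p(q+r)$ is defined if and only if $pq+pr$ is, and then they are equal; and the associative law. Here an association of a finite multiset $S$ of elements of $P$ is a binary tree whose leaves are labelled by the elements of $S$ (with multiplicity) and in which each inner node is labelled by the sum of the labels of its two children, all these sums being defined; a pre-association is the same except that the sum at the root need not be defined. The associative law says: if $S$ has an association with root label $r$, then in every pre-association of $S$ the sum of the labels of the two children of the root is defined and equals $r$. A sum $p_1+\dots+p_n$ is defined, with value $r$, if for some finite multiset $Z=\{z_1,-z_1,\dots,z_k,-z_k\}$ the multiset $\{p_1,\dots,p_n\}\cup Z$ has an association with root label $r$. In particular every field is a partial field. A matrix over $P$ is a $P$-matrix if the determinant $\sum_\sigma \operatorname{sgn}(\sigma)\prod_i a_{i\sigma(i)}$ of each of its square submatrices is defined. A (finite) matroid $M$ with ground set $E$ is representable over $P$ (or $P$-representable)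 if for some $r$ there is an $r\times E$ $P$-matrix $A$ of rank $r$ (i.e. with a nonzero $r \times r$ subdeterminant) such that the bases of $M$ are exactly the sets $B\subseteq E$ with $|B|=r$ for which the submatrix of $A$ with column set $B$ has nonzero determinant. For a commutative ring $R\neq 0$ and a set $S$ of units of $R$, $\mathbb{P}(R,S)$ is the partial field with underlying set $\langle S\cup\{-1\}\rangle\cup\{0\}$ (where $\langle\cdot\rangle$ denotes the generated subgroup of the unit group of $R$), whose multiplication and addition are the restrictions of those of $R$; $p+q$ is defined if and only if the sum in $R$ lies in this set. For partial fields $P_1,P_2$, the direct product $P_1\otimes P_2$ is the partial field on $\{(p_1,p_2)\in P_1\times P_2 : p_1\neq 0 \Leftrightarrow p_2\neq 0\}$ with componentwise operations, where $(p_1,p_2)+(q_1,q_2)$ is defined if and only if $p_1+q_1$ and $p_2+q_2$ are both defined and are either both zero or both nonzero. Theorem (Whittle). Let $M$ be a matroid, let $\zeta\in\mathbb{C}$ be a primitive sixth root of unity, and let $\mathbb{Y}=\mathbb{P}(\mathbb{C},\{2,\zeta\})$. The following are equivalent: (i) $M$ is representable over $\mathrm{GF}(3)\otimes\mathrm{GF}(7)$;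 (ii) $M$ is $\mathbb{Y}$-representable; (iii) $M$ is representable over $\mathrm{GF}(3)$, over $\mathrm{GF}(p^2)$ for all primes $p>2$, and over $\mathrm{GF}(p)$ for all primes $p\equiv 1 \pmod 3$. -/

import Mathlib

universe u v w

/-- `HasAssociation padd S r`: the multiset `S` has an association whose root is labelled `r`, with
respect to the partial operation `padd`. That is, there is a binary tree whose leaves are labelled
by the elements of `S` (with multiplicity) and in which every inner node is labelled by the
(defined) sum of the labels of its two children; `r` is the label of the root. -/
inductive HasAssociation {P : Type u} (padd : P → P → Part P) : Multiset P → P → Prop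
  | leaf (p : P) : HasAssociation padd {p} p
  | node (S T : Multiset P) (u w r : P) : HasAssociation padd S u → HasAssociation padd T w →
      r ∈ padd u w → HasAssociation padd (S + T) r

/-- A partial field. The nonzero elements form an abelian group under multiplication and `0` is
absorbing (`CommGroupWithZero`); `r ∈ padd p q` says that `p + q` is defined and equal to `r`.
The field `assoc_law` is the associative law: if `S` has an association with root `r`, and two
trees with root labels `u`, `w` and leaf multisets `S₁`, `S₂` form a pre-association of
`S = S₁ + S₂`, then `u + w` is defined and equal to `r`. -/
class PartialField (P : Type u) extends CommGroupWithZero P where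
  /-- the partial addition -/
  padd : P → P → Part P
  /-- the additive inverse -/
  pneg : P → P
  padd_zero : ∀ p : P, p ∈ padd p 0
  padd_pneg : ∀ p : P, 0 ∈ padd p (pneg p)
  eq_pneg : ∀ p q : P, 0 ∈ padd p q → q = pneg p
  padd_comm : ∀ p q r : P, r ∈ padd p q → r ∈ padd q p
  /-- distributivity: `p (q + r)` is defined if and only if `p q + p r` is -/
  dom_mul : ∀ p q r : P, p ≠ 0 → ((padd q r).Dom ↔ (padd (p * q) (p * r)).Dom)
  /-- distributivity: if defined, the two sides agree -/
  mul_padd : ∀ p q r s : P, s ∈ padd q r → p * s ∈ padd (p * q) (p * r)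
  assoc_law : ∀ (S : Multiset P) (r : P), HasAssociation padd S r →
    ∀ (S₁ S₂ : Multiset P) (u w : P), S₁ + S₂ = S →
      HasAssociation padd S₁ u → HasAssociation padd S₂ w → r ∈ padd u w

namespace PartialField

section Matrices

variable {P : Type u} [PartialField P]

/-- `IsSum S r`: the sum of the elements of `S` is defined and equal to `r`, i.e. after adding
finitely many pairs `z, -z` to `S` there is an association with root `r`. -/
def IsSum (S : Multiset P) (r : P) : Prop :=
  ∃ Z : Multiset P, HasAssociation padd (S + (Z + Z.map pneg)) r

/-- The terms `sign(σ) a_{1σ(1)} ⋯ a_{nσ(n)}` of the formal determinant. -/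
def detTerms {n : Type*} [Fintype n] [DecidableEq n] (A : Matrix n n P) : Multiset P :=
  (Finset.univ : Finset (Equiv.Perm n)).val.map fun σ =>
    if Equiv.Perm.sign σ = 1 then ∏ i, A i (σ i) else pneg (∏ i, A i (σ i))

/-- `HasDet A d`: the determinant of `A` is defined and equal to `d`. -/
def HasDet {n : Type*} [Fintype n] [DecidableEq n] (A : Matrix n n P) (d : P) : Prop :=
  IsSum (detTerms A) d

/-- `A` is a `P`-matrix: the determinant of every square submatrix is defined. -/
def IsPMatrix {X Y : Type*} (A : Matrix X Y P) : Prop :=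
  ∀ (k : ℕ) (f : Fin k ↪ X) (g : Fin k ↪ Y), ∃ d : P, HasDet (A.submatrix f g) d

end Matrices

/-- `Represents A M`: the `r × E` matrix `A` is a `P`-matrix (of rank `r`), and `M = M[A]`, i.e. the
bases of `M` are the sets `B` of `r` columns such that `det A[r, B]` is nonzero. (The rank condition
says that there is such a `B`, and follows since `M` has a basis.) -/
def Represents {P : Type u} [PartialField P] {α : Type v} {r : ℕ} {M : Matroid α}
    (A : Matrix (Fin r) M.E P) : Prop :=
  IsPMatrix A ∧
    ∀ B : Set α, M.IsBase B ↔
      ∃ g : Fin r ↪ M.E, Set.range (fun i => (g i : α)) = B ∧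
        ∃ d : P, HasDet (A.submatrix id g) d ∧ d ≠ 0

/-- The matroid `M` is representable over the partial field `P`. -/
def Representable (P : Type u) [PartialField P] {α : Type v} (M : Matroid α) : Prop :=
  ∃ (r : ℕ) (A : Matrix (Fin r) M.E P), Represents A

section Field

theorem HasAssociation_sum {R : Type u} [AddCommMonoid R] {P : Type v} (i : P → R)
    {padd : P → P → Part P} (hadd : ∀ p q r, r ∈ padd p q → i r = i p + i q)
    {S : Multiset P} {r : P} (h : HasAssociation padd S r) : i r = (S.map i).sum := by
  induction h with
  | leaf p => simp
  | node S T u w r _ _ hr ihS ihT => rw [hadd _ _ _ hr, ihS, ihT, Multiset.map_add, Multiset.sum_add]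

theorem HasAssociation_map {P : Type u} {Q : Type v} (i : P → Q)
    {padd : P → P → Part P} {qadd : Q → Q → Part Q}
    (hadd : ∀ p q r, r ∈ padd p q → i r ∈ qadd (i p) (i q))
    {S : Multiset P} {r : P} (h : HasAssociation padd S r) :
    HasAssociation qadd (S.map i) (i r) := by
  induction h with
  | leaf p => simpa using HasAssociation.leaf (padd := qadd) (i p)
  | node S T u w r _ _ hr ihS ihT =>
    rw [Multiset.map_add]
    exact HasAssociation.node _ _ _ _ _ ihS ihT (hadd _ _ _ hr)

/-- Every field is a partial field, in which all sums are defined. -/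
instance ofField (F : Type u) [Field F] : PartialField F where
  toCommGroupWithZero := inferInstance
  padd p q := Part.some (p + q)
  pneg p := -p
  padd_zero p := by simp
  padd_pneg p := by simp
  eq_pneg p q h := by
    rw [Part.mem_some_iff] at h
    exact eq_neg_of_add_eq_zero_right h.symm
  padd_comm p q r h := by rwa [add_comm]
  dom_mul p q r _ := by simp
  mul_padd p q r s h := by
    rw [Part.mem_some_iff] at h ⊢
    rw [h, mul_add]
  assoc_law S r hS S₁ S₂ u w h h₁ h₂ := by
    have key {S : Multiset F} {r : F} (h : HasAssociation (fun p q : F => Part.some (p + q)) S r) :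
        r = S.sum := by
      simpa using HasAssociation_sum id (fun p q r hr => by simpa using hr) h
    rw [Part.mem_some_iff, key hS, key h₁, key h₂, ← h, Multiset.sum_add]

end Field

/-- The underlying set `⟨S ∪ {-1}⟩ ∪ {0}` of `P(R, S)`, for a set `S` of units of a commutative
ring `R`. -/
def OfRing (R : Type u) [CommRing R] (S : Set Rˣ) : Type u :=
  {x : R // x = 0 ∨ ∃ g ∈ Subgroup.closure (S ∪ {-1}), (g : R) = x}

namespace OfRing

variable {R : Type u} [CommRing R] {S : Set Rˣ}

theorem mul_closed {x y : R} (hx : x = 0 ∨ ∃ g ∈ Subgroup.closure (S ∪ {-1}), (g : R) = x)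
    (hy : y = 0 ∨ ∃ g ∈ Subgroup.closure (S ∪ {-1}), (g : R) = y) :
    x * y = 0 ∨ ∃ g ∈ Subgroup.closure (S ∪ {-1}), (g : R) = x * y := by
  rcases hx with rfl | ⟨g, hg, rfl⟩
  · simp
  rcases hy with rfl | ⟨h, hh, rfl⟩
  · simp
  exact Or.inr ⟨g * h, mul_mem hg hh, by simp⟩

theorem inv_closed {x : R} (hx : x = 0 ∨ ∃ g ∈ Subgroup.closure (S ∪ {-1}), (g : R) = x) :
    Ring.inverse x = 0 ∨ ∃ g ∈ Subgroup.closure (S ∪ {-1}), (g : R) = Ring.inverse x := by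
  rcases hx with rfl | ⟨g, hg, rfl⟩
  · simp
  exact Or.inr ⟨g⁻¹, inv_mem hg, by simp⟩

theorem neg_closed {x : R} (hx : x = 0 ∨ ∃ g ∈ Subgroup.closure (S ∪ {-1}), (g : R) = x) :
    -x = 0 ∨ ∃ g ∈ Subgroup.closure (S ∪ {-1}), (g : R) = -x := by
  rcases hx with rfl | ⟨g, hg, rfl⟩
  · simp
  exact Or.inr ⟨-1 * g, mul_mem (Subgroup.subset_closure (by simp)) hg, by simp⟩

noncomputable instance [Nontrivial R] : CommGroupWithZero (OfRing R S) where
  zero := ⟨0, Or.inl rfl⟩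
  one := ⟨1, Or.inr ⟨1, one_mem _, rfl⟩⟩
  mul x y := ⟨x.1 * y.1, mul_closed x.2 y.2⟩
  inv x := ⟨Ring.inverse x.1, inv_closed x.2⟩
  mul_assoc x y z := Subtype.ext (mul_assoc x.1 y.1 z.1)
  one_mul x := Subtype.ext (one_mul x.1)
  mul_one x := Subtype.ext (mul_one x.1)
  mul_comm x y := Subtype.ext (mul_comm x.1 y.1)
  zero_mul x := Subtype.ext (zero_mul x.1)
  mul_zero x := Subtype.ext (mul_zero x.1)
  exists_pair_ne := ⟨⟨0, Or.inl rfl⟩, ⟨1, Or.inr ⟨1, one_mem _, rfl⟩⟩,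
    fun h => zero_ne_one (congrArg Subtype.val h)⟩
  inv_zero := Subtype.ext (Ring.inverse_zero R)
  mul_inv_cancel := by
    rintro ⟨x, hx⟩ hne
    rcases hx with rfl | ⟨g, hg, rfl⟩
    · exact absurd rfl hne
    · exact Subtype.ext (Ring.mul_inverse_cancel _ g.isUnit)

/-- The partial field `P(R, S)`: multiplication and addition are the restrictions of those of `R`,
and `p + q` is defined if and only if it lies in `⟨S ∪ {-1}⟩ ∪ {0}`. -/
noncomputable instance [Nontrivial R] : PartialField (OfRing R S) where
  toCommGroupWithZero := inferInstance
  padd p q := ⟨p.1 + q.1 = 0 ∨ ∃ g ∈ Subgroup.closure (S ∪ {-1}), (g : R) = p.1 + q.1,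
    fun h => ⟨p.1 + q.1, h⟩⟩
  pneg p := ⟨-p.1, neg_closed p.2⟩
  padd_zero p := by
    have h : p.1 + (0 : OfRing R S).1 = p.1 := add_zero p.1
    exact ⟨by rw [h]; exact p.2, Subtype.ext h⟩
  padd_pneg p := ⟨Or.inl (add_neg_cancel p.1), Subtype.ext (add_neg_cancel p.1)⟩
  eq_pneg p q := by
    rintro ⟨_, h⟩
    exact Subtype.ext (eq_neg_of_add_eq_zero_right (congrArg Subtype.val h))
  padd_comm p q r := by
    rintro ⟨hd, rfl⟩
    exact ⟨by rw [add_comm]; exact hd, Subtype.ext (add_comm _ _)⟩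
  dom_mul p q r hp := by
    have e : (p * q).1 + (p * r).1 = p.1 * (q.1 + r.1) := (mul_add p.1 q.1 r.1).symm
    change (_ ∨ _) ↔ (_ ∨ _)
    rw [e]
    refine ⟨fun h => mul_closed p.2 h, fun h => ?_⟩
    have h' := mul_closed (p⁻¹).2 h
    have e' : (p⁻¹).1 * (p.1 * (q.1 + r.1)) = q.1 + r.1 := by
      rw [← mul_assoc]
      have : (p⁻¹).1 * p.1 = 1 := congrArg (fun x : OfRing R S => x.1) (inv_mul_cancel₀ hp)
      rw [this, one_mul]
    rwa [e'] at h'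
  mul_padd p q r s := by
    rintro ⟨hd, rfl⟩
    have e : (p * q).1 + (p * r).1 = p.1 * (q.1 + r.1) := (mul_add p.1 q.1 r.1).symm
    exact ⟨by rw [e]; exact mul_closed p.2 hd, Subtype.ext e⟩
  assoc_law T r hT T₁ T₂ u w h h₁ h₂ := by
    have key := fun (T : Multiset (OfRing R S)) (r : OfRing R S) hT =>
      HasAssociation_sum (S := T) (r := r)
        (padd := fun p q => ⟨p.1 + q.1 = 0 ∨ ∃ g ∈ Subgroup.closure (S ∪ {-1}),
          (g : R) = p.1 + q.1, fun h => ⟨p.1 + q.1, h⟩⟩) (fun x : OfRing R S => x.1)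
        (by rintro p q r ⟨_, rfl⟩; rfl) hT
    have e : u.1 + w.1 = r.1 := by
      rw [key _ _ hT, key _ _ h₁, key _ _ h₂, ← h, Multiset.map_add, Multiset.sum_add]
    exact ⟨by rw [e]; exact r.2, Subtype.ext e⟩

end OfRing

/-- The underlying set of the direct product `P₁ ⊗ P₂`. -/
def DirectProduct (P₁ : Type u) (P₂ : Type v) [PartialField P₁] [PartialField P₂] : Type (max u v) :=
  {p : P₁ × P₂ // p.1 ≠ 0 ↔ p.2 ≠ 0}

namespace DirectProduct

variable {P₁ : Type u} {P₂ : Type v} [PartialField P₁] [PartialField P₂]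

theorem ext' {p q : DirectProduct P₁ P₂} (h₁ : p.1.1 = q.1.1) (h₂ : p.1.2 = q.1.2) : p = q :=
  Subtype.ext (Prod.ext h₁ h₂)

instance : CommGroupWithZero (DirectProduct P₁ P₂) where
  zero := ⟨(0, 0), by simp⟩
  one := ⟨(1, 1), by simp⟩
  mul x y := ⟨(x.1.1 * y.1.1, x.1.2 * y.1.2), by
    have hx := x.2
    have hy := y.2
    simp only [ne_eq, mul_eq_zero, not_or] at *
    rw [hx, hy]⟩
  inv x := ⟨(x.1.1⁻¹, x.1.2⁻¹), by simpa using x.2⟩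
  mul_assoc x y z := ext' (mul_assoc _ _ _) (mul_assoc _ _ _)
  one_mul x := ext' (one_mul _) (one_mul _)
  mul_one x := ext' (mul_one _) (mul_one _)
  mul_comm x y := ext' (mul_comm _ _) (mul_comm _ _)
  zero_mul x := ext' (zero_mul _) (zero_mul _)
  mul_zero x := ext' (mul_zero _) (mul_zero _)
  exists_pair_ne := ⟨⟨(0, 0), by simp⟩, ⟨(1, 1), by simp⟩,
    fun h => zero_ne_one (congrArg (fun x => x.1.1) h)⟩
  inv_zero := ext' inv_zero inv_zero
  mul_inv_cancel x hx := by
    have h1 : x.1.1 ≠ 0 := fun h => hx (ext' h (by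
      by_contra h2
      exact x.2.mpr h2 h))
    exact ext' (mul_inv_cancel₀ h1) (mul_inv_cancel₀ (x.2.mp h1))

theorem pneg_ne_zero {P : Type u} [PartialField P] (p : P) : pneg p ≠ 0 ↔ p ≠ 0 := by
  have h0 : (0 : P) = pneg 0 := eq_pneg 0 0 (padd_zero 0)
  constructor
  · rintro h rfl
    exact h h0.symm
  · intro h hp
    have h1 := padd_pneg p
    rw [hp] at h1
    exact h (Part.mem_unique (padd_zero p) h1)

/-- Addition in `P₁ ⊗ P₂` is componentwise, and it is defined if and only if both component sums
are defined and the pair of these sums lies in `P₁ ⊗ P₂`. -/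
def add (p q : DirectProduct P₁ P₂) : Part (DirectProduct P₁ P₂) :=
  ⟨∃ (h₁ : (padd p.1.1 q.1.1).Dom) (h₂ : (padd p.1.2 q.1.2).Dom),
    (padd p.1.1 q.1.1).get h₁ ≠ 0 ↔ (padd p.1.2 q.1.2).get h₂ ≠ 0,
   fun h => ⟨((padd p.1.1 q.1.1).get h.1, (padd p.1.2 q.1.2).get h.2.1), h.2.2⟩⟩

theorem mem_add {p q r : DirectProduct P₁ P₂} :
    r ∈ add p q ↔ r.1.1 ∈ padd p.1.1 q.1.1 ∧ r.1.2 ∈ padd p.1.2 q.1.2 := by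
  constructor
  · rintro ⟨h, rfl⟩
    exact ⟨⟨h.1, rfl⟩, ⟨h.2.1, rfl⟩⟩
  · rintro ⟨⟨h₁, e₁⟩, ⟨h₂, e₂⟩⟩
    exact ⟨⟨h₁, h₂, by rw [e₁, e₂]; exact r.2⟩, ext' e₁ e₂⟩

instance : PartialField (DirectProduct P₁ P₂) where
  toCommGroupWithZero := inferInstance
  padd := add
  pneg p := ⟨(pneg p.1.1, pneg p.1.2), by
    simpa only [pneg_ne_zero] using p.2⟩
  padd_zero p := mem_add.2 ⟨padd_zero _, padd_zero _⟩
  padd_pneg p := mem_add.2 ⟨padd_pneg _, padd_pneg _⟩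
  eq_pneg p q h := ext' (eq_pneg _ _ (mem_add.1 h).1) (eq_pneg _ _ (mem_add.1 h).2)
  padd_comm p q r h := mem_add.2
    ⟨padd_comm _ _ _ (mem_add.1 h).1, padd_comm _ _ _ (mem_add.1 h).2⟩
  dom_mul p q r hp := by
    have key : ∀ p q r s : DirectProduct P₁ P₂, s ∈ add q r → p * s ∈ add (p * q) (p * r) :=
      fun p q r s h => mem_add.2 ⟨mul_padd _ _ _ _ (mem_add.1 h).1, mul_padd _ _ _ _ (mem_add.1 h).2⟩
    constructor
    · intro h
      exact Part.dom_iff_mem.2 ⟨_, key p q r _ ⟨h, rfl⟩⟩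
    · intro h
      have := key p⁻¹ (p * q) (p * r) _ ⟨h, rfl⟩
      rw [inv_mul_cancel_left₀ hp, inv_mul_cancel_left₀ hp] at this
      exact Part.dom_iff_mem.2 ⟨_, this⟩
  mul_padd p q r s h :=
    mem_add.2 ⟨mul_padd _ _ _ _ (mem_add.1 h).1, mul_padd _ _ _ _ (mem_add.1 h).2⟩
  assoc_law S r hS S₁ S₂ u w h h₁ h₂ := by
    have m₁ := fun (S : Multiset (DirectProduct P₁ P₂)) (r : DirectProduct P₁ P₂) hS =>
      HasAssociation_map (S := S) (r := r) (padd := add) (qadd := padd) (fun x => x.1.1)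
        (fun p q r h => (mem_add.1 h).1) hS
    have m₂ := fun (S : Multiset (DirectProduct P₁ P₂)) (r : DirectProduct P₁ P₂) hS =>
      HasAssociation_map (S := S) (r := r) (padd := add) (qadd := padd) (fun x => x.1.2)
        (fun p q r h => (mem_add.1 h).2) hS
    refine mem_add.2 ⟨?_, ?_⟩
    · exact assoc_law _ _ (m₁ _ _ hS) _ _ _ _ (by rw [← h, Multiset.map_add]) (m₁ _ _ h₁) (m₁ _ _ h₂)
    · exact assoc_law _ _ (m₂ _ _ hS) _ _ _ _ (by rw [← h, Multiset.map_add]) (m₂ _ _ h₁) (m₂ _ _ h₂)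

end DirectProduct

end PartialField

/-- `7` is prime, so that `ZMod 7` is a field. -/
instance fact_prime_seven : Fact (Nat.Prime 7) := ⟨by norm_num⟩

set_option linter.unusedSectionVars false

/-! A representation over GF(3) ⊗ GF(7), or one over GF(3) together with one over GF(7), amounts to
a matrix over the ring `ZMod 3 × ZMod 7` all of whose minors are zero or units. The core is to lift
such a matrix, keeping this property, to ℤ[1/2, ζ] along ζ ↦ (2, 3); the units of ℤ[1/2, ζ] are the
2^k ζ^j, which are the nonzero elements of 𝕐. Conversely, a root of z² = z - 1 in a field with 2 ≠ 0
gives a homomorphism from 𝕐, and all fields in (iii) have such a root.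

The lift theorem `exists_lift` rests on cross ratios. A 2×2 minor ad - bc with unit entries is zero
or a unit if and only if p = bc/(ad) is fundamental, meaning that 1 - p is zero or a unit. The
fundamental elements 1, -1, 2, 1/2, ζ, 1 - ζ of ℤ[1/2, ζ] correspond bijectively to those of `ZMod 3
× ZMod 7`. There, p, q, pq are all fundamental only if one of them is 1, and p, -p only if p = ±1
(`isLifting_seven`).

Injectivity on fundamental elements makes lifts unique up to scaling (`exists_scaling`). By
induction, the matrix without row x and the matrix without row y have lifts; these are rescaled to
agree on the common rows and then glued (`exists_lift_of_removable`). Pivoting reduces the minors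
that use both x and y to 2×2 minors in these rows, and the cross ratio of such a minor is controlled
along a chordless path between its columns (`IsPartialLift.two_of_isInducedPath`). Suitable x and y
are obtained from leaves of a breadth-first tree, after transposing or pivoting if need be, unless
the matrix is tiny (`hasRemovable_cases`).

Determinants over 𝕐 are partial sums, so one further fact is needed: a multiset in 𝕐 whose complex
sum lies in 𝕐 has that sum in the partial field, with the help of cancelling pairs
(`SixthTwo.isSum_of_sum_eq`). -/

namespace UnitLift

/-! ### Matrices whose minors are zero or units -/

section Basic

variable {R K : Type*} [CommRing R] [CommRing K]

/-- `x` is zero or a unit. -/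
def ZeroOrUnit (x : R) : Prop := x = 0 ∨ IsUnit x

theorem ZeroOrUnit.zero : ZeroOrUnit (0 : R) := Or.inl rfl

theorem ZeroOrUnit.isUnit {x : R} (h : ZeroOrUnit x) (hx : x ≠ 0) : IsUnit x := h.resolve_left hx

theorem ZeroOrUnit.mul {x y : R} (hx : ZeroOrUnit x) (hy : ZeroOrUnit y) : ZeroOrUnit (x * y) := by
  rcases hx with rfl | hx
  · simp [ZeroOrUnit]
  rcases hy with rfl | hy
  · simp [ZeroOrUnit]
  exact Or.inr (hx.mul hy)

theorem ZeroOrUnit.of_mul_left {u x : R} (hu : IsUnit u) (h : ZeroOrUnit (u * x)) :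
    ZeroOrUnit x := by
  rcases h with h | h
  · exact Or.inl (hu.mul_right_eq_zero.1 h)
  · exact Or.inr (isUnit_of_mul_isUnit_right h)

theorem zeroOrUnit_neg {x : R} : ZeroOrUnit (-x) ↔ ZeroOrUnit x := by
  simp [ZeroOrUnit, IsUnit.neg_iff]

theorem ZeroOrUnit.map {x : R} (h : ZeroOrUnit x) (φ : R →+* K) : ZeroOrUnit (φ x) := by
  rcases h with rfl | h
  · simp [ZeroOrUnit]
  · exact Or.inr (h.map φ)

theorem ZeroOrUnit.map_eq_zero [Nontrivial K] {x : R} (h : ZeroOrUnit x) (φ : R →+* K) :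
    φ x = 0 ↔ x = 0 := by
  refine ⟨fun h0 => ?_, fun h0 => by rw [h0, map_zero]⟩
  by_contra hx
  exact ((h.isUnit hx).map φ).ne_zero h0

/-- Every minor of `A` is zero or a unit. -/
def HasUnitMinors {m n : Type*} (A : Matrix m n R) : Prop :=
  ∀ (k : ℕ) (f : Fin k → m) (g : Fin k → n), ZeroOrUnit (A.submatrix f g).det

variable {m n p q : Type*} {A : Matrix m n R}

namespace HasUnitMinors

/-- Selections of rows and columns need not be injective, as a repetition only makes the determinant
zero; hence they can simply be composed. -/
theorem submatrix (h : HasUnitMinors A) (f : p → m) (g : q → n) :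
    HasUnitMinors (A.submatrix f g) := fun k f' g' => h k (f ∘ f') (g ∘ g')

theorem transpose (h : HasUnitMinors A) : HasUnitMinors A.transpose := fun k f g => by
  rw [← Matrix.transpose_submatrix, Matrix.det_transpose]
  exact h k g f

theorem entry (h : HasUnitMinors A) (i : m) (j : n) : ZeroOrUnit (A i j) := by
  simpa using h 1 (fun _ => i) (fun _ => j)

theorem two (h : HasUnitMinors A) (i i' : m) (j j' : n) :
    ZeroOrUnit (A i j * A i' j' - A i j' * A i' j) := by
  have := h 2 ![i, i'] ![j, j']
  rw [Matrix.det_fin_two] at this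
  simpa using this

theorem det (h : HasUnitMinors A) {ι : Type*} [Fintype ι] [DecidableEq ι] (f : ι → m) (g : ι → n) :
    ZeroOrUnit (A.submatrix f g).det := by
  have e := Fintype.equivFin ι
  have := h _ (f ∘ e.symm) (g ∘ e.symm)
  rwa [← Matrix.submatrix_submatrix, Matrix.det_submatrix_equiv_self] at this

theorem scale (h : HasUnitMinors A) (d : m → Rˣ) (e : n → Rˣ) :
    HasUnitMinors (Matrix.of fun i j => (d i : R) * A i j * (e j : R)) := fun k f g => by
  have : (Matrix.of fun i j => (d i : R) * A i j * (e j : R)).submatrix f g =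
      Matrix.of fun i j => (e (g j) : R) * (Matrix.of fun i j => (d (f i) : R) * A.submatrix f g i j) i j := by
    ext i j
    simp [mul_comm, mul_left_comm]
  rw [this, Matrix.det_mul_row, Matrix.det_mul_column]
  refine ZeroOrUnit.mul (Or.inr ?_) (ZeroOrUnit.mul (Or.inr ?_) (h k f g))
  · exact ⟨∏ i, e (g i), by simp⟩
  · exact ⟨∏ i, d (f i), by simp⟩

/-- Expansion along a selected unit column leaves at most one term, which is ± a smaller minor;
without such a column the minor is one of `A`. -/
theorem fromCols_one [DecidableEq m] (h : HasUnitMinors A) :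
    HasUnitMinors (Matrix.fromCols (1 : Matrix m m R) A) := by
  intro k
  induction k with
  | zero => intro f g; simp [ZeroOrUnit]
  | succ k ih =>
    intro f g
    by_cases hf : Function.Injective f
    swap
    · obtain ⟨i, j, hij, hne⟩ := Function.not_injective_iff.1 hf
      exact Or.inl (Matrix.det_zero_of_row_eq hne (by ext; simp [Matrix.submatrix, hij]))
    by_cases hg : ∃ j i, g j = Sum.inl i
    · obtain ⟨j, i, hj⟩ := hg
      rw [Matrix.det_succ_column _ j]
      by_cases hi : ∃ l, f l = i
      · obtain ⟨l, rfl⟩ := hi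
        rw [Finset.sum_eq_single l]
        · refine ZeroOrUnit.mul (ZeroOrUnit.mul (Or.inr ?_) (Or.inr ?_)) (ih _ _)
          · exact (isUnit_one.neg).pow _
          · simp [hj]
        · intro b _ hb
          have : f b ≠ f l := fun e => hb (hf e)
          simp [hj, this]
        · simp
      · left
        refine Finset.sum_eq_zero fun l _ => ?_
        have : f l ≠ i := fun e => hi ⟨l, e⟩
        simp [hj, this]
    · have : ∀ j, ∃ i, g j = Sum.inr i := fun j => by
        rcases hgj : g j with i | i
        · exact absurd ⟨j, i, hgj⟩ hg
        · exact ⟨i, rfl⟩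
      choose g' hg' using this
      obtain rfl : g = Sum.inr ∘ g' := funext hg'
      exact h _ f g'

/-- In the presence of an identity submatrix every minor extends to a maximal minor of the same
value: the unselected rows are covered by their unit columns, which makes the matrix block
triangular. -/
theorem of_maximal [Fintype m] [DecidableEq m] (g : m → n) (hg : A.submatrix id g = 1)
    (h : ∀ h : m → n, ZeroOrUnit (A.submatrix id h).det) : HasUnitMinors A := by
  classical
  intro k f c
  by_cases hf : Function.Injective f
  swap
  · obtain ⟨i, j, hij, hne⟩ := Function.not_injective_iff.1 hf
    exact Or.inl (Matrix.det_zero_of_row_eq hne (by ext; simp [Matrix.submatrix, hij]))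
  -- Column `c` at the rows selected by `f`, the unit column at every other row.
  have key := h (Function.extend f c g)
  have h1 : ∀ i j, j ∉ Set.range f → A i (Function.extend f c g j) = if i = j then 1 else 0 := by
    intro i j hj
    rw [Function.extend_apply' _ _ _ hj]
    have := congrFun (congrFun hg i) j
    simpa [Matrix.one_apply] using this
  rw [Matrix.twoBlockTriangular_det' _ (fun i => i ∈ Set.range f)] at key
  · have e2 : ((A.submatrix id (Function.extend f c g)).toSquareBlockProp
        fun i => i ∉ Set.range f) = 1 := by
      ext i j
      simp only [Matrix.toSquareBlockProp, Matrix.toBlock_apply, Matrix.submatrix_apply, id,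
        Matrix.one_apply]
      rw [h1 _ _ j.2]
      simp [Subtype.ext_iff]
    rw [e2, Matrix.det_one, mul_one] at key
    have e3 : A.submatrix f c = ((A.submatrix id (Function.extend f c g)).toSquareBlockProp
        fun i => i ∈ Set.range f).submatrix (Equiv.ofInjective f hf) (Equiv.ofInjective f hf) := by
      ext i j
      simp [Matrix.toSquareBlockProp, hf.extend_apply]
    rw [e3, Matrix.det_submatrix_equiv_self]
    convert key
  · intro i hi j hj
    simp only [Matrix.submatrix_apply, id]
    rw [h1 _ _ hj, if_neg]
    rintro rfl
    exact hj hi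

end HasUnitMinors

end Basic

/-! ### Pivoting -/

section Pivot

variable {R K : Type*} [CommRing R] [CommRing K] {m n p q : Type*}
  [DecidableEq m] [DecidableEq n] [DecidableEq p] [DecidableEq q]

/-- The matrix obtained from `A` by pivoting on the entry `(r, c)`. The row index `r` and the column
index `c` are kept, although the elements they stand for are exchanged. -/
noncomputable def pivot (A : Matrix m n R) (r : m) (c : n) : Matrix m n R := Matrix.of fun i j =>
  if i = r then (if j = c then Ring.inverse (A r c) else Ring.inverse (A r c) * A r j)
  else if j = c then -(Ring.inverse (A r c) * A i c)
  else A i j - Ring.inverse (A r c) * A i c * A r j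

variable (A : Matrix m n R) {r : m} {c : n}

theorem pivot_self : pivot A r c r c = Ring.inverse (A r c) := by simp [pivot]

theorem pivot_row {j : n} (hj : j ≠ c) : pivot A r c r j = Ring.inverse (A r c) * A r j := by
  simp [pivot, hj]

theorem pivot_col {i : m} (hi : i ≠ r) : pivot A r c i c = -(Ring.inverse (A r c) * A i c) := by
  simp [pivot, hi]

theorem pivot_of_ne {i : m} {j : n} (hi : i ≠ r) (hj : j ≠ c) :
    pivot A r c i j = A i j - Ring.inverse (A r c) * A i c * A r j := by
  simp [pivot, hi, hj]

variable {A}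

theorem pivot_pivot (h : IsUnit (A r c)) : pivot (pivot A r c) r c = A := by
  obtain ⟨a, ha⟩ := h
  have h1 : Ring.inverse (pivot A r c r c) = A r c := by
    rw [pivot_self, ← ha, Ring.inverse_unit, Ring.inverse_unit, inv_inv]
  have h2 : A r c * Ring.inverse (A r c) = 1 := by rw [← ha, Ring.inverse_unit, Units.mul_inv]
  ext i j
  by_cases hi : i = r <;> by_cases hj : j = c
  · subst hi hj; rw [pivot_self, h1]
  · subst hi; rw [pivot_row _ hj, h1, pivot_row _ hj, ← mul_assoc, h2, one_mul]
  · subst hj; rw [pivot_col _ hi, h1, pivot_col _ hi, mul_neg, neg_neg, ← mul_assoc, h2, one_mul]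
  · rw [pivot_of_ne _ hi hj, h1, pivot_of_ne _ hi hj, pivot_col _ hi, pivot_row _ hj]
    linear_combination (Ring.inverse (A r c) * A i c * A r j) * h2

theorem pivot_map (φ : R →+* K) (h : IsUnit (A r c)) :
    (pivot A r c).map φ = pivot (A.map φ) r c := by
  have h1 : φ (Ring.inverse (A r c)) = Ring.inverse (φ (A r c)) := by
    obtain ⟨a, ha⟩ := h
    rw [← ha, Ring.inverse_unit]
    exact (Ring.inverse_unit (Units.map (φ : R →* K) a)).symm
  ext i j
  simp only [pivot, Matrix.map_apply, Matrix.of_apply]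
  split_ifs <;> simp [h1]

theorem pivot_submatrix {f : p → m} {g : q → n} (hf : Function.Injective f)
    (hg : Function.Injective g) (r : p) (c : q) :
    (pivot A (f r) (g c)).submatrix f g = pivot (A.submatrix f g) r c := by
  ext i j
  simp [pivot, hf.eq_iff, hg.eq_iff]

/-- A pivot is a row operation on `[I | A]` with an invertible matrix `E`, followed by exchanging
the columns `r` and `c`. Maximal minors change by the unit `det E`, and they control all minors by
`of_maximal`. -/
theorem HasUnitMinors.pivot [Fintype m] (hA : HasUnitMinors A) (h : IsUnit (A r c)) :
    HasUnitMinors (pivot A r c) := by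
  let E : Matrix m m R := (1 : Matrix m m R).updateCol r
    (fun i => if i = r then Ring.inverse (A r c) else -(Ring.inverse (A r c) * A i c))
  have hinv : Ring.inverse (A r c) * A r c = 1 := Ring.inverse_mul_cancel _ h
  have hE : IsUnit E.det := by
    have : E.det = Ring.inverse (A r c) := by
      rw [← Matrix.cramer_apply]
      simp
    rw [this]
    exact h.ringInverse
  have mulE : ∀ (v : m → R) (i : m), (E.mulVec v) i =
      if i = r then Ring.inverse (A r c) * v r else v i - Ring.inverse (A r c) * A i c * v r := by
    intro v i
    simp only [Matrix.mulVec, dotProduct]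
    rw [← Finset.add_sum_erase _ _ (Finset.mem_univ r)]
    have e1 : ∀ x ∈ Finset.univ.erase r, E i x * v x = if i = x then v x else 0 := by
      intro x hx
      have : x ≠ r := Finset.ne_of_mem_erase hx
      simp [E, this, Matrix.one_apply]
    rw [Finset.sum_congr rfl e1, Finset.sum_ite_eq]
    by_cases hi : i = r
    · simp [hi, E]
    · simp [hi, E]
      ring
  let N := E * Matrix.fromCols (1 : Matrix m m R) A
  have hN : ∀ i j, N i j = E.mulVec (fun l => Matrix.fromCols (1 : Matrix m m R) A l j) i := fun i j => rfl
  have key : HasUnitMinors N := by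
    -- After the row operation the column `c` of `A` is the unit column of `r`.
    refine HasUnitMinors.of_maximal (fun i => if i = r then Sum.inr c else Sum.inl i) ?_ ?_
    · ext i j
      rw [Matrix.submatrix_apply, hN, mulE]
      by_cases hj : j = r
      · subst hj
        by_cases hi : i = j
        · simp [hi, hinv, Matrix.one_apply]
        · simp only [id, hi, if_false, if_true, Matrix.fromCols_apply_inr, Matrix.one_apply_ne hi]
          linear_combination (-A i c) * hinv
      · by_cases hi : i = r
        · subst hi
          have : i ≠ j := fun e => hj e.symm
          simp [hj, this]
        · have : r ≠ j := fun e => hj e.symm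
          simp [hi, hj, this, Matrix.one_apply]
    · intro g
      have : N.submatrix id g = E * (Matrix.fromCols 1 A).submatrix id g := rfl
      rw [this, Matrix.det_mul]
      exact ZeroOrUnit.mul (Or.inr hE) (hA.fromCols_one.det _ _)
  have : UnitLift.pivot A r c = N.submatrix id (fun j => if j = c then Sum.inl r else Sum.inr j) := by
    ext i j
    rw [Matrix.submatrix_apply, hN, mulE]
    by_cases hi : i = r <;> by_cases hj : j = c
    · subst hi hj; simp [pivot_self]
    · subst hi; simp [pivot_row _ hj, hj]
    · subst hj; simp [pivot_col _ hi, hi]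
    · simp [pivot_of_ne _ hi hj, hi, hj]
  rw [this]
  exact key.submatrix _ _

/-- A minor of `A` that uses the row and the column of the pivot is, up to a unit, a smaller minor of
the matrix obtained by pivoting. -/
theorem det_submatrix_eq_pivot {k : ℕ} {f : Fin (k + 1) → m} {g : Fin (k + 1) → n}
    (hf : Function.Injective f) (hg : Function.Injective g) (i j : Fin (k + 1))
    (h : IsUnit (A (f i) (g j))) :
    (A.submatrix f g).det = (-1) ^ (i + j : ℕ) * A (f i) (g j) *
      ((pivot A (f i) (g j)).submatrix (f ∘ i.succAbove) (g ∘ j.succAbove)).det := by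
  have hinv : Ring.inverse (A (f i) (g j)) * A (f i) (g j) = 1 := Ring.inverse_mul_cancel _ h
  -- Multiples of row `i` are subtracted so that column `j` keeps only its pivot entry.
  let B : Matrix (Fin (k + 1)) (Fin (k + 1)) R := Matrix.of fun s t =>
    A (f s) (g t) - (if s = i then 0 else Ring.inverse (A (f i) (g j)) * A (f s) (g j)) * A (f i) (g t)
  have hB : (A.submatrix f g).det = B.det := by
    refine Matrix.det_eq_of_forall_row_eq_smul_add_const
      (fun s => if s = i then 0 else Ring.inverse (A (f i) (g j)) * A (f s) (g j)) i (by simp) ?_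
    intro s t
    simp [B]
  rw [hB, Matrix.det_succ_column _ j, Finset.sum_eq_single i]
  · congr 1
    · simp [B]
    · congr 1
      ext s t
      have hs : f (i.succAbove s) ≠ f i := fun e => Fin.succAbove_ne _ _ (hf e)
      have ht : g (j.succAbove t) ≠ g j := fun e => Fin.succAbove_ne _ _ (hg e)
      simp [B, pivot_of_ne _ hs ht, Fin.succAbove_ne]
  · intro b _ hb
    have : B b j = 0 := by
      simp only [B, Matrix.of_apply, hb, if_false]
      linear_combination (-A (f b) (g j)) * hinv
    rw [this]; simp
  · simp

end Pivot

/-! ### Chordless paths in the bipartite graph of a matrix -/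

section Path

variable {R : Type*} [CommRing R] {m n : Type*}

/-- `r` and `c` describe a chordless path `c 0, r 0, c 1, …, r (l - 1), c l` from the column `u` to
the column `v`, with rows in `s`, in the bipartite graph of the nonzero entries of `A`. -/
structure IsInducedPath (A : Matrix m n R) (s : Set m) (u v : n) (l : ℕ) (r : ℕ → m) (c : ℕ → n) :
    Prop where
  left : c 0 = u
  right : c l = v
  mem : ∀ i < l, r i ∈ s
  ne_fst : ∀ i < l, A (r i) (c i) ≠ 0
  ne_snd : ∀ i < l, A (r i) (c (i + 1)) ≠ 0
  eq_zero : ∀ i < l, ∀ j ≤ l, j ≠ i → j ≠ i + 1 → A (r i) (c j) = 0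

/-- The row `i` of `A` has nonzero entries both inside and outside of `S`. -/
def Crosses (A : Matrix m n R) (i : m) (S : Set n) : Prop :=
  (∃ j ∈ S, A i j ≠ 0) ∧ ∃ j ∉ S, A i j ≠ 0

/-- Columns are joined when some row of `s` is nonzero at both. The component of `u` is crossed by
no row of `s`, so it contains `v`; a shortest path has no chords. -/
theorem exists_isInducedPath [Nonempty m] (A : Matrix m n R) (s : Set m) (u v : n)
    (h : ∀ S : Set n, (∀ i ∈ s, ¬Crosses A i S) → u ∈ S → v ∈ S) :
    ∃ l r c, IsInducedPath A s u v l r c := by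
  classical
  let H : SimpleGraph n :=
    { Adj := fun a b => a ≠ b ∧ ∃ r ∈ s, A r a ≠ 0 ∧ A r b ≠ 0
      symm := ⟨fun a b ⟨h, r, hr, h1, h2⟩ => ⟨h.symm, r, hr, h2, h1⟩⟩
      loopless := ⟨fun a h => h.1 rfl⟩ }
  have short : ∀ r ∈ s, ∀ a b, A r a ≠ 0 → A r b ≠ 0 → ∃ q : H.Walk a b, q.length ≤ 1 := by
    intro r hr a b ha hb
    by_cases hab : a = b
    · subst hab; exact ⟨SimpleGraph.Walk.nil, by simp⟩
    · have : H.Adj a b := ⟨hab, r, hr, ha, hb⟩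
      exact ⟨this.toWalk, by simp⟩
  have hreach : H.Reachable u v := by
    refine h {w | H.Reachable u w} ?_ (SimpleGraph.Reachable.refl u)
    rintro i hi ⟨⟨j, hj, hij⟩, ⟨k, hk, hik⟩⟩
    obtain ⟨q, -⟩ := short i hi j k hij hik
    exact hk (SimpleGraph.Reachable.trans hj ⟨q⟩)
  obtain ⟨p, hp⟩ := hreach.exists_walk_length_eq_dist
  have hmin : ∀ q : H.Walk u v, p.length ≤ q.length := fun q => hp ▸ SimpleGraph.dist_le q
  have hadj : ∀ i, ∃ r, i < p.length → r ∈ s ∧ A r (p.getVert i) ≠ 0 ∧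
      A r (p.getVert (i + 1)) ≠ 0 := by
    intro i
    by_cases hi : i < p.length
    · obtain ⟨-, r, hr, h1, h2⟩ := p.adj_getVert_succ hi
      exact ⟨r, fun _ => ⟨hr, h1, h2⟩⟩
    · exact ⟨Classical.arbitrary m, fun h => absurd h hi⟩
  choose r hr using hadj
  refine ⟨p.length, r, p.getVert, by simp, by simp, fun i hi => (hr i hi).1,
    fun i hi => (hr i hi).2.1, fun i hi => (hr i hi).2.2, ?_⟩
  intro i hi j hj h1 h2
  by_contra hne
  obtain ⟨hs, ha, hb⟩ := hr i hi
  -- A further nonzero entry of row `r i` would be a shortcut past at least one column.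
  rcases lt_or_gt_of_ne h1 with hlt | hgt
  · obtain ⟨q, hq⟩ := short _ hs _ _ hne hb
    have := hmin (((p.take j).append q).append (p.drop (i + 1)))
    simp only [SimpleGraph.Walk.length_append, SimpleGraph.Walk.take_length,
      SimpleGraph.Walk.drop_length] at this
    omega
  · obtain ⟨q, hq⟩ := short _ hs _ _ ha hne
    have := hmin (((p.take i).append q).append (p.drop j))
    simp only [SimpleGraph.Walk.length_append, SimpleGraph.Walk.take_length,
      SimpleGraph.Walk.drop_length] at this
    omega

namespace IsInducedPath

variable {A : Matrix m n R} {s : Set m} {u v : n} {l : ℕ} {r : ℕ → m} {c : ℕ → n}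

theorem row_ne (h : IsInducedPath A s u v l r c) {i j : ℕ} (hij : i < j) (hj : j < l) :
    r i ≠ r j := fun e => h.ne_snd j hj
  (e ▸ h.eq_zero i (by omega) (j + 1) (by omega) (by omega) (by omega))

theorem col_ne_of_lt (h : IsInducedPath A s u v l r c) {i j : ℕ} (hij : i < j) (hj : j < l) :
    c i ≠ c j := fun e => h.ne_fst j hj
  (e ▸ h.eq_zero j hj i (by omega) (by omega) (by omega))

/-- For `l = 1` the two ends of the path may coincide, whence the bound on `l`. -/
theorem col_ne (h : IsInducedPath A s u v l r c) (hl : 2 ≤ l) {i j : ℕ} (hij : i < j)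
    (hj : j ≤ l) : c i ≠ c j := by
  rcases hj.lt_or_eq with hj | rfl
  · exact h.col_ne_of_lt hij hj
  · intro e
    by_cases hi : i + 1 = j
    · subst hi
      have := h.eq_zero (i - 1) (by omega) (i + 1) le_rfl (by omega) (by omega)
      rw [← e] at this
      refine h.ne_snd (i - 1) (by omega) ?_
      rwa [Nat.sub_add_cancel (by omega)]
    · exact h.ne_fst i (by omega) (e ▸ h.eq_zero i (by omega) j le_rfl (by omega) (by omega))

variable [DecidableEq m] [DecidableEq n]

/-- A path with two rows becomes a path with one row by a pivot. -/
theorem pivot_two (hA : ∀ i ∈ s, ∀ j, ZeroOrUnit (A i j)) (h : IsInducedPath A s u v 2 r c) :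
    pivot A (r 0) (c 1) (r 1) u ≠ 0 ∧ pivot A (r 0) (c 1) (r 1) v ≠ 0 := by
  have hr : r 1 ≠ r 0 := (h.row_ne zero_lt_one (by norm_num)).symm
  have h0 : u ≠ c 1 := h.left ▸ h.col_ne le_rfl zero_lt_one (by norm_num)
  have h2 : v ≠ c 1 := h.right ▸ (h.col_ne le_rfl one_lt_two (by norm_num)).symm
  have z0 : A (r 0) v = 0 := h.right ▸ h.eq_zero 0 (by norm_num) 2 le_rfl (by norm_num) (by norm_num)
  have z1 : A (r 1) u = 0 := h.left ▸ h.eq_zero 1 (by norm_num) 0 (by norm_num) (by norm_num) (by norm_num)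
  have n0 : A (r 0) u ≠ 0 := h.left ▸ h.ne_fst 0 (by norm_num)
  have u0 : IsUnit (A (r 0) (c 1)) :=
    (hA _ (h.mem 0 (by norm_num)) _).isUnit (h.ne_snd 0 (by norm_num))
  have u1 : IsUnit (A (r 1) (c 1)) :=
    (hA _ (h.mem 1 (by norm_num)) _).isUnit (h.ne_fst 1 (by norm_num))
  have n1 : A (r 1) v ≠ 0 := h.right ▸ h.ne_snd 1 (by norm_num)
  rw [pivot_of_ne _ hr h0, pivot_of_ne _ hr h2, z0, z1]
  refine ⟨?_, by simpa using n1⟩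
  rw [zero_sub, neg_ne_zero, mul_assoc, Ne, (u0.ringInverse).mul_right_eq_zero,
    u1.mul_right_eq_zero]
  exact n0

/-- A path with at least three rows is shortened by a pivot on its second row, which changes no other
row at the ends of the path. -/
theorem pivot_shorten (hA : ∀ i ∈ s, ∀ j, ZeroOrUnit (A i j))
    (h : IsInducedPath A s u v (l + 3) r c) :
    (∃ r' c', IsInducedPath (pivot A (r 1) (c 1)) s u v (l + 2) r' c') ∧
      ∀ i ≠ r 1, pivot A (r 1) (c 1) i u = A i u ∧ pivot A (r 1) (c 1) i v = A i v := by
  have hr : ∀ i, i ≠ 1 → i < l + 3 → r i ≠ r 1 := fun i h1 h2 => by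
    rcases lt_or_gt_of_ne h1 with h1 | h1
    · exact h.row_ne h1 (by omega)
    · exact (h.row_ne h1 h2).symm
  have hc : ∀ i, i ≠ 1 → i ≤ l + 3 → c i ≠ c 1 := fun i h1 h2 => by
    rcases lt_or_gt_of_ne h1 with h1 | h1
    · exact h.col_ne (by omega) h1 (by omega)
    · exact (h.col_ne (by omega) h1 h2).symm
  have u1 : IsUnit (A (r 1) (c 1)) :=
    (hA _ (h.mem 1 (by omega)) _).isUnit (h.ne_fst 1 (by omega))
  have u0 : IsUnit (A (r 0) (c 1)) :=
    (hA _ (h.mem 0 (by omega)) _).isUnit (h.ne_snd 0 (by omega))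
  have hrow : ∀ j, j ≠ 1 → j ≠ 2 → j ≤ l + 3 → ∀ i ≠ r 1,
      pivot A (r 1) (c 1) i (c j) = A i (c j) := by
    intro j h1 h2 h3 i hi
    rw [pivot_of_ne _ hi (hc j h1 h3), h.eq_zero 1 (by omega) j h3 h1 h2]
    simp
  have hcol : ∀ i, 2 ≤ i → i < l + 3 → ∀ j ≠ c 1, pivot A (r 1) (c 1) (r i) j = A (r i) j := by
    intro i h1 h2 j hj
    rw [pivot_of_ne _ (hr i (by omega) h2) hj, h.eq_zero i h2 1 (by omega) (by omega) (by omega)]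
    simp
  -- The new path skips `c 1` and `r 1`: it runs `c 0, r 0, c 2, r 2, …`.
  refine ⟨⟨fun i => if i = 0 then r 0 else r (i + 1), fun i => if i = 0 then c 0 else c (i + 1),
    ?_⟩, fun i hi => ⟨?_, ?_⟩⟩
  · refine ⟨by simpa using h.left, by simpa using h.right, ?_, ?_, ?_, ?_⟩
    · intro i hi
      split_ifs
      · exact h.mem 0 (by omega)
      · exact h.mem _ (by omega)
    · intro i hi
      split_ifs with hi0
      · rw [hrow 0 (by omega) (by omega) (by omega) _ (hr 0 (by omega) (by omega))]
        exact h.ne_fst 0 (by omega)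
      · rw [hcol _ (by omega) (by omega) _ (hc _ (by omega) (by omega))]
        exact h.ne_fst _ (by omega)
    · intro i hi
      rw [if_neg (Nat.succ_ne_zero i)]
      split_ifs with hi0
      -- The pivot creates the entry at `(r 0, c 2)`: it was zero and becomes minus a product of
      -- nonzero terms.
      · subst hi0
        rw [pivot_of_ne _ (hr 0 (by omega) (by omega)) (hc _ (by omega) (by omega)),
          h.eq_zero 0 (by omega) _ (by omega) (by omega) (by omega), zero_sub, neg_ne_zero, mul_assoc,
          Ne, (u1.ringInverse).mul_right_eq_zero, u0.mul_right_eq_zero]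
        exact h.ne_snd 1 (by omega)
      · rw [hcol _ (by omega) (by omega) _ (hc _ (by omega) (by omega))]
        exact h.ne_snd _ (by omega)
    · intro i hi j hj h1 h2
      by_cases hi0 : i = 0
      · subst hi0
        rw [if_pos rfl, if_neg h1, hrow _ (by omega) (by omega) (by omega) _
          (hr 0 (by omega) (by omega))]
        exact h.eq_zero 0 (by omega) _ (by omega) (by omega) (by omega)
      · rw [if_neg hi0]
        split_ifs with hj0
        · rw [hcol _ (by omega) (by omega) _ (hc _ (by omega) (by omega))]
          exact h.eq_zero _ (by omega) _ (by omega) (by omega) (by omega)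
        · rw [hcol _ (by omega) (by omega) _ (hc _ (by omega) (by omega))]
          exact h.eq_zero _ (by omega) _ (by omega) (by omega) (by omega)
  · rw [← h.left]
    exact hrow 0 (by omega) (by omega) (by omega) _ hi
  · rw [← h.right]
    exact hrow (l + 3) (by omega) (by omega) (by omega) _ hi

end IsInducedPath

end Path

/-! ### Cross ratios and fundamental elements -/

section Fundamental

variable {R K : Type*} [CommRing R] [CommRing K]

/-- `p` is a unit such that `1 - p` is zero or a unit. -/
def Fundamental (p : Rˣ) : Prop := ZeroOrUnit (1 - (p : R))

/-- Factor the unit `a d` out of the 2×2 determinant: what remains is one minus the cross ratio. -/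
theorem fundamental_iff {a b c d : Rˣ} :
    Fundamental (b * c * a⁻¹ * d⁻¹) ↔ ZeroOrUnit ((a * d - b * c : R)) := by
  have e : (a * d - b * c : R) = ((a * d : Rˣ) : R) * (1 - (b * c * a⁻¹ * d⁻¹ : Rˣ)) := by
    have h1 : (a : R) * (a⁻¹ : Rˣ) = 1 := a.mul_inv
    have h2 : (d : R) * (d⁻¹ : Rˣ) = 1 := d.mul_inv
    push_cast
    linear_combination (b * c : R) * h1 + (a * (a⁻¹ : Rˣ) * b * c : R) * h2
  rw [e]
  exact ⟨fun h => ZeroOrUnit.mul (Or.inr (Units.isUnit _)) h,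
    fun h => ZeroOrUnit.of_mul_left (Units.isUnit _) h⟩

theorem Fundamental.inv {p : Rˣ} (h : Fundamental p) : Fundamental p⁻¹ := by
  have := (fundamental_iff (a := p) (b := 1) (c := 1) (d := 1)).2 (by
    have := zeroOrUnit_neg.2 h
    simpa using this)
  simpa using this

theorem Fundamental.map {p : Rˣ} (h : Fundamental p) (φ : R →+* K) :
    Fundamental (Units.map (φ : R →* K) p) := by
  simpa [Fundamental] using ZeroOrUnit.map h φ

end Fundamental

/-! ### Uniqueness of lifts up to scaling -/

section Unique

variable {R K : Type*} [CommRing R] [CommRing K] [Nontrivial K] {m n : Type*}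
  {φ : R →+* K} {L₁ L₂ : Matrix m n R}

/-- `φ` is injective on the fundamental elements of `R`. -/
def InjOnFundamental (φ : R →+* K) : Prop :=
  ∀ p q : Rˣ, Fundamental p → Fundamental q →
    Units.map (φ : R →* K) p = Units.map (φ : R →* K) q → p = q

theorem eq_zero_iff_of_map_eq (h₁ : HasUnitMinors L₁) (h₂ : HasUnitMinors L₂)
    (h : L₁.map φ = L₂.map φ) (i : m) (j : n) : L₁ i j = 0 ↔ L₂ i j = 0 := by
  rw [← (h₁.entry i j).map_eq_zero φ, ← (h₂.entry i j).map_eq_zero φ]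
  exact Eq.congr_left (congrFun (congrFun h i) j)

/-- If a single row `i` of `s` joins `u` and `v`, the cross ratios of the rows `i`, `x` in the two
lifts are fundamental with equal image under `φ`, hence equal; this fixes the ratio of the entries
of row `x`. Longer paths are shortened by pivots within `s`, where the lifts agree. -/
theorem ratio_eq_of_isInducedPath [Fintype m] [DecidableEq m] [DecidableEq n]
    (hφ : InjOnFundamental φ) {s : Set m} {x : m} (hx : x ∉ s) {u v : n} (l : ℕ) :
    ∀ (L₁ L₂ : Matrix m n R), HasUnitMinors L₁ → HasUnitMinors L₂ → L₁.map φ = L₂.map φ →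
      (∀ i ∈ s, ∀ j, L₁ i j = L₂ i j) → L₁ x u ≠ 0 → L₁ x v ≠ 0 → ∀ r c,
      IsInducedPath L₁ s u v l r c → L₂ x u * L₁ x v = L₂ x v * L₁ x u := by
  have one : ∀ (u v : n) (L₁ L₂ : Matrix m n R), HasUnitMinors L₁ → HasUnitMinors L₂ →
      L₁.map φ = L₂.map φ → (∀ i ∈ s, ∀ j, L₁ i j = L₂ i j) → L₁ x u ≠ 0 → L₁ x v ≠ 0 →
      ∀ i ∈ s, L₁ i u ≠ 0 → L₁ i v ≠ 0 → L₂ x u * L₁ x v = L₂ x v * L₁ x u := by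
    intro u v L₁ L₂ h₁ h₂ h he hu hv i hi hiu hiv
    obtain ⟨a, ha⟩ := (h₁.entry i u).isUnit hiu
    obtain ⟨b, hb⟩ := (h₁.entry i v).isUnit hiv
    obtain ⟨p₁, hp₁⟩ := (h₁.entry x u).isUnit hu
    obtain ⟨q₁, hq₁⟩ := (h₁.entry x v).isUnit hv
    obtain ⟨p₂, hp₂⟩ := (h₂.entry x u).isUnit (fun e => hu ((eq_zero_iff_of_map_eq h₁ h₂ h _ _).2 e))
    obtain ⟨q₂, hq₂⟩ := (h₂.entry x v).isUnit (fun e => hv ((eq_zero_iff_of_map_eq h₁ h₂ h _ _).2 e))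
    have f₁ : Fundamental (b * p₁ * a⁻¹ * q₁⁻¹) := fundamental_iff.2 (by
      rw [ha, hb, hp₁, hq₁]; exact h₁.two i x u v)
    have f₂ : Fundamental (b * p₂ * a⁻¹ * q₂⁻¹) := fundamental_iff.2 (by
      rw [ha, hb, hp₂, hq₂, he i hi, he i hi]; exact h₂.two i x u v)
    have e1 : Units.map (φ : R →* K) p₁ = Units.map (φ : R →* K) p₂ := by
      ext
      simpa [hp₁, hp₂] using congrFun (congrFun h x) u
    have e2 : Units.map (φ : R →* K) q₁ = Units.map (φ : R →* K) q₂ := by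
      ext
      simpa [hq₁, hq₂] using congrFun (congrFun h x) v
    have key := hφ _ _ f₁ f₂ (by simp only [map_mul, map_inv, e1, e2])
    rw [← hp₁, ← hp₂, ← hq₁, ← hq₂, ← Units.val_mul, ← Units.val_mul]
    congr 1
    have key2 : p₁ * q₁⁻¹ = p₂ * q₂⁻¹ := by
      have e : ∀ p q : Rˣ, b * p * a⁻¹ * q⁻¹ = (b * a⁻¹) * (p * q⁻¹) := fun p q => by
        rw [mul_right_comm b p, mul_assoc]
      rw [e, e] at key
      exact mul_left_cancel key
    rw [mul_inv_eq_iff_eq_mul, mul_right_comm, eq_mul_inv_iff_mul_eq] at key2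
    rw [← key2, mul_comm]
  have step : ∀ (L₁ L₂ : Matrix m n R) (i : m) (j : n), HasUnitMinors L₁ → HasUnitMinors L₂ →
      L₁.map φ = L₂.map φ → (∀ i ∈ s, ∀ j, L₁ i j = L₂ i j) → i ∈ s → L₁ i j ≠ 0 →
      HasUnitMinors (pivot L₁ i j) ∧ HasUnitMinors (pivot L₂ i j) ∧
        (pivot L₁ i j).map φ = (pivot L₂ i j).map φ ∧
        ∀ i' ∈ s, ∀ j', pivot L₁ i j i' j' = pivot L₂ i j i' j' := by
    intro L₁ L₂ i j h₁ h₂ h he hi hij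
    have u₁ := (h₁.entry i j).isUnit hij
    have u₂ : IsUnit (L₂ i j) := he i hi j ▸ u₁
    refine ⟨h₁.pivot u₁, h₂.pivot u₂, ?_, ?_⟩
    · rw [pivot_map φ u₁, pivot_map φ u₂, h]
    · intro i' hi' j'
      simp only [pivot, Matrix.of_apply]
      simp only [he i hi, he i' hi']
  induction l with
  | zero =>
    intro L₁ L₂ _ _ _ _ _ _ r c hp
    rw [← hp.left, hp.right, mul_comm]
  | succ l ih =>
    intro L₁ L₂ h₁ h₂ h he hu hv r c hp
    match l, ih, hp with
    | 0, _, hp =>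
      refine one u v L₁ L₂ h₁ h₂ h he hu hv (r 0) (hp.mem 0 one_pos) ?_ ?_
      · exact hp.left ▸ hp.ne_fst 0 one_pos
      · exact hp.right ▸ hp.ne_snd 0 one_pos
    | 1, _, hp =>
      -- If row `x` vanishes at the middle column, the pivot leaves it unchanged at `u` and `v`.
      -- Otherwise the ratio factors through the middle column.
      by_cases hc : L₁ x (c 1) = 0
      · have hxr : x ≠ r 0 := fun e => hx (e ▸ hp.mem 0 two_pos)
        have h0 : u ≠ c 1 := fun e => hu (e ▸ hc)
        have h2 : v ≠ c 1 := fun e => hv (e ▸ hc)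
        have hc2 := (eq_zero_iff_of_map_eq h₁ h₂ h _ _).1 hc
        obtain ⟨k₁, k₂, k₃, k₄⟩ :=
          step L₁ L₂ (r 0) (c 1) h₁ h₂ h he (hp.mem 0 two_pos) (hp.ne_snd 0 two_pos)
        have e : ∀ L : Matrix m n R, L x (c 1) = 0 → ∀ j ≠ c 1, pivot L (r 0) (c 1) x j = L x j := by
          intro L hL j hj
          rw [pivot_of_ne _ hxr hj, hL]
          simp
        have := one u v _ _ k₁ k₂ k₃ k₄ (by rwa [e _ hc _ h0]) (by rwa [e _ hc _ h2]) (r 1)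
          (hp.mem 1 one_lt_two) (hp.pivot_two fun i _ j => h₁.entry i j).1
          (hp.pivot_two fun i _ j => h₁.entry i j).2
        rwa [e _ hc _ h0, e _ hc _ h2, e _ hc2 _ h0, e _ hc2 _ h2] at this
      · have a1 := one u (c 1) L₁ L₂ h₁ h₂ h he hu hc (r 0) (hp.mem 0 two_pos)
          (hp.left ▸ hp.ne_fst 0 two_pos) (hp.ne_snd 0 two_pos)
        have a2 := one (c 1) v L₁ L₂ h₁ h₂ h he hc hv (r 1) (hp.mem 1 one_lt_two)
          (hp.ne_fst 1 one_lt_two) (hp.right ▸ hp.ne_snd 1 one_lt_two)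
        have uc := (h₁.entry x (c 1)).isUnit hc
        refine uc.mul_left_cancel ?_
        linear_combination L₁ x v * a1 + L₁ x u * a2
    | l + 2, ih, hp =>
      have hxr : x ≠ r 1 := fun e => hx (e ▸ hp.mem 1 (by omega))
      obtain ⟨k₁, k₂, k₃, k₄⟩ :=
        step L₁ L₂ (r 1) (c 1) h₁ h₂ h he (hp.mem 1 (by omega)) (hp.ne_fst 1 (by omega))
      obtain ⟨⟨r', c', hp'⟩, hend⟩ := hp.pivot_shorten fun i _ j => h₁.entry i j
      have z1 : L₁ (r 1) u = 0 :=
        hp.left ▸ hp.eq_zero 1 (by omega) 0 (by omega) (by omega) (by omega)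
      have z2 : L₁ (r 1) v = 0 :=
        hp.right ▸ hp.eq_zero 1 (by omega) (l + 3) (by omega) (by omega) (by omega)
      have h0 : u ≠ c 1 := fun e => hp.ne_fst 1 (by omega) (e ▸ z1)
      have h2 : v ≠ c 1 := fun e => hp.ne_fst 1 (by omega) (e ▸ z2)
      have e0 : pivot L₂ (r 1) (c 1) x u = L₂ x u := by
        rw [pivot_of_ne _ hxr h0, ← he _ (hp.mem 1 (by omega)) u, z1]; simp
      have e2 : pivot L₂ (r 1) (c 1) x v = L₂ x v := by
        rw [pivot_of_ne _ hxr h2, ← he _ (hp.mem 1 (by omega)) v, z2]; simp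
      have := ih _ _ k₁ k₂ k₃ k₄ (by rwa [(hend x hxr).1]) (by rwa [(hend x hxr).2]) r' c' hp'
      rwa [(hend x hxr).1, (hend x hxr).2, e0, e2] at this

/-- Two lifts of a matrix with unit minors differ by a scaling of rows and columns. -/
theorem exists_scaling [Fintype m] (hφ : InjOnFundamental φ) (h₁ : HasUnitMinors L₁)
    (h₂ : HasUnitMinors L₂) (h : L₁.map φ = L₂.map φ) :
    ∃ (d : m → Rˣ) (e : n → Rˣ), (∀ i, Units.map (φ : R →* K) (d i) = 1) ∧
      (∀ j, Units.map (φ : R →* K) (e j) = 1) ∧ ∀ i j, L₂ i j = d i * L₁ i j * e j := by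
  classical
  -- The lifts are matched one row at a time; adding a row may rescale all columns and the earlier
  -- rows.
  suffices H : ∀ s : Finset m, ∃ (d : m → Rˣ) (e : n → Rˣ), (∀ i, Units.map (φ : R →* K) (d i) = 1) ∧
      (∀ j, Units.map (φ : R →* K) (e j) = 1) ∧ ∀ i ∈ s, ∀ j, L₂ i j = d i * L₁ i j * e j by
    simpa using H Finset.univ
  intro s
  induction s using Finset.induction_on with
  | empty => exact ⟨1, 1, by simp, by simp, by simp⟩
  | insert x s hx ih =>
  obtain ⟨d, e, hd, he, hs⟩ := ih
  have hm : Nonempty m := ⟨x⟩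
  have val_eq : ∀ a : Rˣ, Units.map (φ : R →* K) a = 1 → φ (a : R) = 1 := fun a ha => by
    simpa using congrArg Units.val ha
  let L : Matrix m n R := Matrix.of fun i j => (d i : R) * L₁ i j * (e j : R)
  have hL : HasUnitMinors L := h₁.scale d e
  have hmap : L.map φ = L₂.map φ := by
    rw [← h]
    ext i j
    simp [L, val_eq _ (hd i), val_eq _ (he j)]
  have hsL : ∀ i ∈ (s : Set m), ∀ j, L i j = L₂ i j := fun i hi j => (hs i hi j).symm
  have hρ : ∀ u, ∃ ρ : Rˣ, Units.map (φ : R →* K) ρ = 1 ∧ L₂ x u = ρ * L x u := by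
    intro u
    by_cases hu : L x u = 0
    · exact ⟨1, by simp, by rw [hu, (eq_zero_iff_of_map_eq hL h₂ hmap _ _).1 hu, mul_zero]⟩
    · obtain ⟨a, ha⟩ := (hL.entry x u).isUnit hu
      obtain ⟨b, hb⟩ := (h₂.entry x u).isUnit
        (fun e => hu ((eq_zero_iff_of_map_eq hL h₂ hmap _ _).2 e))
      refine ⟨b * a⁻¹, ?_, by rw [← ha, ← hb]; simp⟩
      rw [map_mul, map_inv, mul_inv_eq_one]
      ext
      simpa [ha, hb] using (congrFun (congrFun hmap x) u).symm
  choose ρ hρ1 hρ2 using hρ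
  -- Connectedness of columns through the rows of `s`.
  let Reach : n → n → Prop := fun j u => ∀ S : Set n, (∀ i ∈ (s : Set m), ¬Crosses L i S) → j ∈ S → u ∈ S
  have hReach : ∀ i ∈ (s : Set m), ∀ j j', L i j ≠ 0 → L i j' ≠ 0 → Reach j = Reach j' := by
    have aux : ∀ i ∈ (s : Set m), ∀ j j', L i j ≠ 0 → L i j' ≠ 0 → ∀ u, Reach j u → Reach j' u := by
      intro i hi j j' hj hj' u hu S hS hj'S
      refine hu S hS ?_
      by_contra hjS
      exact hS i hi ⟨⟨j', hj'S, hj'⟩, ⟨j, hjS, hj⟩⟩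
    intro i hi j j' hj hj'
    ext u
    exact ⟨aux i hi j j' hj hj' u, aux i hi j' j hj' hj u⟩
  -- One factor per connected class, read off at a chosen column where row `x` is nonzero. It is a
  -- function of the class itself, so that connected columns receive the same factor.
  let F : (n → Prop) → Rˣ := fun P => if h : ∃ u, L x u ≠ 0 ∧ P u then ρ h.choose else 1
  have hF : ∀ P, Units.map (φ : R →* K) (F P) = 1 := by
    intro P
    simp only [F]
    split_ifs
    · exact hρ1 _
    · exact map_one _
  have hx2 : ∀ u, L₂ x u = F (Reach u) * L x u := by
    intro u
    by_cases hu : L x u = 0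
    · rw [hu, (eq_zero_iff_of_map_eq hL h₂ hmap _ _).1 hu, mul_zero]
    · have hex : ∃ w, L x w ≠ 0 ∧ Reach u w := ⟨u, hu, fun S _ h => h⟩
      obtain ⟨hw, hr⟩ := hex.choose_spec
      have hFe : F (Reach u) = ρ hex.choose := dif_pos hex
      rw [hFe]
      obtain ⟨l, r, c, hp⟩ := exists_isInducedPath L (s : Set m) u hex.choose hr
      have := ratio_eq_of_isInducedPath hφ (s := (s : Set m)) (by simpa using hx) l L L₂ hL h₂ hmap hsL hu hw
        r c hp
      refine ((hL.entry x _).isUnit hw).mul_left_cancel ?_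
      rw [mul_comm, this, hρ2]
      ring
  -- Columns are multiplied by the factor of their class. An earlier row has its support in one
  -- class, and division by the factor of that class undoes the change there.
  refine ⟨fun i => (if i = x then 1 else if h : ∃ j, L i j ≠ 0 then (F (Reach h.choose))⁻¹ else 1) * d i,
    fun j => F (Reach j) * e j, ?_, ?_, ?_⟩
  · intro i
    rw [map_mul, hd, mul_one]
    split_ifs
    · simp
    · rw [map_inv, hF, inv_one]
    · simp
  · intro j
    rw [map_mul, hF, he, one_mul]
  · intro i hi j
    beta_reduce
    rcases Finset.mem_insert.1 hi with rfl | hi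
    · rw [if_pos rfl, hx2]
      simp [L]
      ring
    · have hix : i ≠ x := fun e => hx (e ▸ hi)
      rw [if_neg hix]
      by_cases hj : L i j = 0
      · have hj2 : L₁ i j = 0 := by
          have : ((d i * e j : Rˣ) : R) * L₁ i j = 0 := by rw [← hj]; simp [L]; ring
          exact (Units.mul_right_eq_zero _).1 this
        rw [← hsL i hi j, hj, hj2]
        simp
      · have hex : ∃ j, L i j ≠ 0 := ⟨j, hj⟩
        rw [dif_pos hex, hReach i hi _ _ hex.choose_spec hj, ← hsL i hi j]
        have : ((F (Reach j))⁻¹ : Rˣ) * (F (Reach j) : R) = 1 := Units.inv_mul _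
        simp only [L, Matrix.of_apply, Units.val_mul]
        linear_combination (-(d i : R) * L₁ i j * (e j : R)) * this

end Unique

/-! ### Conditions on the homomorphism -/

section Lifting

variable {R K : Type*} [CommRing R] [CommRing K]

/-- The conditions on a ring homomorphism `φ : R → K` under which matrices with unit minors can be
lifted along `φ`. -/
structure IsLifting (φ : R →+* K) : Prop where
  inj : InjOnFundamental φ
  exists_unit : ∀ a : Kˣ, ∃ b : Rˣ, Units.map (φ : R →* K) b = a
  exists_fundamental : ∀ p : Kˣ, Fundamental p → ∃ q : Rˣ, Fundamental q ∧ Units.map (φ : R →* K) q = p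
  mul : ∀ p q : Kˣ, Fundamental p → Fundamental q → Fundamental (p * q) → p = 1 ∨ q = 1 ∨ p * q = 1
  neg : ∀ p : Kˣ, Fundamental p → Fundamental (-p) → p = 1 ∨ p = -1
  two : ZeroOrUnit (2 : R)

variable {φ : R →+* K}

theorem fundamental_one : Fundamental (1 : Rˣ) := Or.inl (by simp)

/-- The image under `φ` can be fundamental only in the degenerate cases where one of the three
elements maps to 1. By injectivity these degeneracies already hold in `R`. -/
theorem IsLifting.fundamental_mul (hφ : IsLifting φ) {p q : Rˣ} (hp : Fundamental p)
    (hq : Fundamental q) (h : Fundamental (Units.map (φ : R →* K) (p * q))) :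
    Fundamental (p * q) := by
  rw [map_mul] at h
  rcases hφ.mul _ _ (hp.map φ) (hq.map φ) h with h | h | h
  · rw [hφ.inj p 1 hp fundamental_one (by rw [h, map_one]), one_mul]
    exact hq
  · rw [hφ.inj q 1 hq fundamental_one (by rw [h, map_one]), mul_one]
    exact hp
  · rw [hφ.inj p q⁻¹ hp hq.inv (by rw [map_inv]; exact eq_inv_of_mul_eq_one_left h), inv_mul_cancel]
    exact fundamental_one

/-- The image of `p` must be ±1, hence `p = ±1` by injectivity. That -1 is fundamental means that 2
is zero or a unit. -/
theorem IsLifting.fundamental_of_neg (hφ : IsLifting φ) {p : Rˣ} (hp : Fundamental (-p))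
    (h : Fundamental (Units.map (φ : R →* K) p)) : Fundamental p := by
  have hm : ∀ p : Rˣ, Units.map (φ : R →* K) (-p) = -Units.map (φ : R →* K) p := fun p => by
    ext; simp
  have h1 : Fundamental (-1 : Rˣ) := by
    have : (1 - ((-1 : Rˣ) : R)) = 2 := by push_cast; ring
    rw [Fundamental, this]
    exact hφ.two
  rcases hφ.neg _ h (hm p ▸ hp.map φ) with h | h
  · have := hφ.inj (-p) (-1) hp h1 (by rw [hm, hm, h, map_one])
    rw [neg_inj.1 this]
    exact fundamental_one
  · have := hφ.inj (-p) 1 hp fundamental_one (by rw [hm, h, map_one, neg_neg])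
    rw [neg_eq_iff_eq_neg.1 this]
    exact h1

end Lifting

/-! ### Crossed column sets and removable pairs of rows -/

section Crossing

variable {R : Type*} [CommRing R] [Nontrivial R] {m n : Type*} {A : Matrix m n R}
  {S : Set n}

theorem crosses_iff {i : m} :
    Crosses A i S ↔ ¬(∀ j ∈ S, A i j = 0) ∧ ¬(∀ j ∈ Sᶜ, A i j = 0) := by
  simp [Crosses]

theorem crosses_compl {i : m} : Crosses A i Sᶜ ↔ Crosses A i S := by
  rw [crosses_iff, crosses_iff, compl_compl, and_comm]

/-- A condition on two rows `x` and `y` under which lifts of `A` without `x` and of `A` without `y`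
can be glued: either no set of columns crossed by both is uncrossed by the other rows, or `A` is a
direct sum with `x` and `y` in different summands. -/
def Removable (A : Matrix m n R) (x y : m) : Prop :=
  (∀ S : Set n, (∀ i, i ≠ x → i ≠ y → ¬Crosses A i S) → Crosses A x S → ¬Crosses A y S) ∨
    ∃ S : Set n, (∀ i, ¬Crosses A i S) ∧ (∀ j ∈ Sᶜ, A x j = 0) ∧ ∀ j ∈ S, A y j = 0

theorem Removable.congr {K : Type*} [CommRing K] {B : Matrix m n K}
    (h : ∀ i j, A i j = 0 ↔ B i j = 0) {x y : m} (hA : Removable A x y) : Removable B x y := by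
  simpa only [Removable, Crosses, ne_eq, h] using hA

variable [DecidableEq m] [DecidableEq n] {r : m} {c : n}

/-- If `c ∈ S`, row `i` is zero at the pivot column and does not change. If `c ∉ S`, the uncrossing
row `r` vanishes on `S`, so its multiples have no effect there. -/
theorem vanishes_pivot (h : IsUnit (A r c)) (hr : ¬Crosses A r S) {i : m}
    (hi : ∀ j ∈ S, A i j = 0) : ∀ j ∈ S, pivot A r c i j = 0 := by
  intro j hj
  by_cases hc : c ∈ S
  · have hic := hi c hc
    have hir : i ≠ r := by
      rintro rfl
      exact h.ne_zero hic
    by_cases hjc : j = c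
    · rw [hjc, pivot_col _ hir, hic]; simp
    · rw [pivot_of_ne _ hir hjc, hi j hj, hic]; simp
  · have hjc : j ≠ c := fun e => hc (e ▸ hj)
    have hrj : A r j = 0 := by
      by_contra hne
      exact hr ⟨⟨j, hj, hne⟩, ⟨c, hc, h.ne_zero⟩⟩
    by_cases hir : i = r
    · rw [hir, pivot_row _ hjc, hrj, mul_zero]
    · rw [pivot_of_ne _ hir hjc, hrj, hi j hj]; simp

theorem Crosses.of_pivot (h : IsUnit (A r c)) (hr : ¬Crosses A r S) {i : m}
    (hi : Crosses (pivot A r c) i S) : Crosses A i S := by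
  rw [crosses_iff] at hi ⊢
  exact ⟨fun h0 => hi.1 (vanishes_pivot h hr h0),
    fun h0 => hi.2 (vanishes_pivot h (crosses_compl.not.2 hr) h0)⟩

theorem isUnit_pivot_self (h : IsUnit (A r c)) : IsUnit (pivot A r c r c) := by
  rw [pivot_self]
  exact h.ringInverse

theorem crosses_pivot_row (h : IsUnit (A r c)) : Crosses (pivot A r c) r S ↔ Crosses A r S := by
  have : ∀ j, pivot A r c r j = 0 ↔ A r j = 0 := by
    intro j
    by_cases hj : j = c
    · subst hj
      exact iff_of_false (isUnit_pivot_self h).ne_zero h.ne_zero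
    · rw [pivot_row _ hj, h.ringInverse.mul_right_eq_zero]
  simp only [Crosses, ne_eq, this]

theorem crosses_pivot (h : IsUnit (A r c)) (hr : ¬Crosses A r S) {i : m} :
    Crosses (pivot A r c) i S ↔ Crosses A i S := by
  refine ⟨Crosses.of_pivot h hr, fun hi => ?_⟩
  rw [← pivot_pivot h] at hi
  exact Crosses.of_pivot (isUnit_pivot_self h) ((crosses_pivot_row h).not.2 hr) hi

theorem Removable.pivot {x y : m} (hA : Removable A x y) (h : IsUnit (A r c)) (hx : r ≠ x)
    (hy : r ≠ y) : Removable (pivot A r c) x y := by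
  rcases hA with hA | ⟨S, hS, h1, h2⟩
  · left
    intro S hS hxS hyS
    have hr : ¬Crosses A r S := (crosses_pivot_row h).not.1 (hS r hx hy)
    refine hA S (fun i hix hiy => ?_) (hxS.of_pivot h hr) (hyS.of_pivot h hr)
    exact (crosses_pivot h hr).not.1 (hS i hix hiy)
  · right
    refine ⟨S, fun i => (crosses_pivot h (hS r)).not.2 (hS i), ?_, vanishes_pivot h (hS r) h2⟩
    exact vanishes_pivot h (crosses_compl.not.2 (hS r)) h1

end Crossing

/-! ### Gluing two lifts -/

section Glue

variable {R K : Type*} [CommRing R] [CommRing K] [Nontrivial R] [Nontrivial K] {m n : Type*}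
  {φ : R →+* K}

/-- The rows of `L` other than `x`. -/
abbrev rowsOff (L : Matrix m n R) (x : m) : Matrix {i // i ≠ x} n R := L.submatrix (↑) id

/-- `L` lifts a matrix with unit minors, and the minors of `L` that avoid one of the rows `x` and `y`
are zero or units. -/
structure IsPartialLift (φ : R →+* K) (L : Matrix m n R) (x y : m) : Prop where
  ne : x ≠ y
  off_left : HasUnitMinors (rowsOff L x)
  off_right : HasUnitMinors (rowsOff L y)
  map : HasUnitMinors (L.map φ)

namespace IsPartialLift

variable {L : Matrix m n R} {x y : m}

theorem symm (h : IsPartialLift φ L x y) : IsPartialLift φ L y x :=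
  ⟨h.ne.symm, h.off_right, h.off_left, h.map⟩

theorem entry (h : IsPartialLift φ L x y) (i : m) (j : n) : ZeroOrUnit (L i j) := by
  by_cases hi : i = x
  · exact h.off_right.entry ⟨i, hi ▸ h.ne⟩ j
  · exact h.off_left.entry ⟨i, hi⟩ j

theorem pivot [Fintype m] [DecidableEq m] [DecidableEq n] (h : IsPartialLift φ L x y) {r : m} {c : n}
    (hx : r ≠ x) (hy : r ≠ y) (hu : IsUnit (L r c)) : IsPartialLift φ (pivot L r c) x y := by
  have off : ∀ (z : m) (hz : r ≠ z), rowsOff (UnitLift.pivot L r c) z =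
      UnitLift.pivot (rowsOff L z) ⟨r, hz⟩ c := fun z hz =>
    pivot_submatrix Subtype.val_injective Function.injective_id (⟨r, hz⟩ : {i // i ≠ z}) c
  refine ⟨h.ne, ?_, ?_, ?_⟩
  · rw [off x hx]
    exact h.off_left.pivot hu
  · rw [off y hy]
    exact h.off_right.pivot hu
  · rw [pivot_map φ hu]
    exact h.map.pivot (hu.map φ)

theorem map_fundamental (h : IsPartialLift φ L x y) {i i' : m} {j j' : n} {a b c d : Rˣ}
    (ha : (a : R) = L i j) (hb : (b : R) = L i j') (hc : (c : R) = L i' j) (hd : (d : R) = L i' j') :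
    Fundamental (Units.map (φ : R →* K) (b * c * a⁻¹ * d⁻¹)) := by
  simp only [map_mul, map_inv]
  rw [fundamental_iff]
  simpa [ha, hb, hc, hd] using h.map.two i i' j j'

variable {u v : n}

/-- The cross ratio of `x` and `y` is the product of those of `x`, `i` and of `i`, `y`. Each factor
comes from a minor avoiding `y` or `x`, so it is fundamental, and `IsLifting.fundamental_mul`
applies. -/
theorem two_of_row (hφ : IsLifting φ) (h : IsPartialLift φ L x y) (hxu : L x u ≠ 0)
    (hxv : L x v ≠ 0) (hyu : L y u ≠ 0) (hyv : L y v ≠ 0) {i : m} (hix : i ≠ x) (hiy : i ≠ y)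
    (hiu : L i u ≠ 0) (hiv : L i v ≠ 0) : ZeroOrUnit (L x u * L y v - L x v * L y u) := by
  obtain ⟨a, ha⟩ := (h.entry x u).isUnit hxu
  obtain ⟨b, hb⟩ := (h.entry x v).isUnit hxv
  obtain ⟨c, hc⟩ := (h.entry y u).isUnit hyu
  obtain ⟨d, hd⟩ := (h.entry y v).isUnit hyv
  obtain ⟨e, he⟩ := (h.entry i u).isUnit hiu
  obtain ⟨f, hf⟩ := (h.entry i v).isUnit hiv
  have f1 : Fundamental (b * e * a⁻¹ * f⁻¹) := fundamental_iff.2 (by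
    rw [ha, hb, he, hf]; exact h.off_right.two ⟨x, h.ne⟩ ⟨i, hiy⟩ u v)
  have f2 : Fundamental (f * c * e⁻¹ * d⁻¹) := fundamental_iff.2 (by
    rw [hc, hd, he, hf]; exact h.off_left.two ⟨i, hix⟩ ⟨y, h.ne.symm⟩ u v)
  have e1 : b * e * a⁻¹ * f⁻¹ * (f * c * e⁻¹ * d⁻¹) = b * c * a⁻¹ * d⁻¹ := by
    exact Additive.ofMul.injective (by simp only [ofMul_mul, ofMul_inv]; abel)
  have := hφ.fundamental_mul f1 f2 (e1 ▸ h.map_fundamental ha hb hc hd)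
  rwa [e1, fundamental_iff, ha, hb, hc, hd] at this

/-- Two rows `x` and `y`, where `y` vanishes at the inner column `c` of a path with two rows from `u`
to `v`, and the pivot on `(i, c)` does not make the entry `(x, u)` zero. -/
theorem two_of_pivot_ne [Fintype m] [DecidableEq m] [DecidableEq n] (hφ : IsLifting φ)
    (h : IsPartialLift φ L x y) (hxu : L x u ≠ 0) (hxv : L x v ≠ 0) (hyu : L y u ≠ 0)
    (hyv : L y v ≠ 0) {i i' : m} {c : n} (hix : i ≠ x) (hiy : i ≠ y) (hix' : i' ≠ x) (hiy' : i' ≠ y)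
    (hiu : L i u ≠ 0) (hic : L i c ≠ 0) (hiv : L i v = 0) (hiu' : L i' u = 0) (hic' : L i' c ≠ 0)
    (hiv' : L i' v ≠ 0) (hyc : L y c = 0) (hne : L x u - Ring.inverse (L i c) * L x c * L i u ≠ 0) :
    ZeroOrUnit (L x u * L y v - L x v * L y u) := by
  have hu := (h.entry i c).isUnit hic
  have huc : u ≠ c := fun e => hic' (e ▸ hiu')
  have hvc : v ≠ c := fun e => hic (e ▸ hiv)
  have hii : i' ≠ i := fun e => hiu (e ▸ hiu')
  have hp := h.pivot hix hiy hu
  have exu := pivot_of_ne L hix.symm huc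
  have exv := pivot_of_ne L hix.symm hvc
  have eyu := pivot_of_ne L hiy.symm huc
  have eyv := pivot_of_ne L hiy.symm hvc
  have eiu := pivot_of_ne L hii huc
  have eiv := pivot_of_ne L hii hvc
  rw [hiv, mul_zero, sub_zero] at exv eyv eiv
  rw [hyc, mul_zero, zero_mul, sub_zero] at eyu
  rw [hiu', zero_sub] at eiu
  have hne' : UnitLift.pivot L i c i' u ≠ 0 := by
    rw [eiu, neg_ne_zero, mul_assoc, Ne, hu.ringInverse.mul_right_eq_zero,
      ((h.entry i' c).isUnit hic').mul_right_eq_zero]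
    exact hiu
  have key := two_of_row hφ hp (by rwa [exu]) (by rwa [exv]) (by rwa [eyu]) (by rwa [eyv]) hix' hiy'
    hne' (by rwa [eiv])
  rw [exu, exv, eyu, eyv] at key
  have hx' := hp.entry x u
  rw [exu] at hx'
  obtain ⟨a, ha⟩ := (h.entry x u).isUnit hxu
  obtain ⟨a', ha'⟩ := hx'.isUnit hne
  obtain ⟨b, hb⟩ := (h.entry x v).isUnit hxv
  obtain ⟨p, hp⟩ := (h.entry y u).isUnit hyu
  obtain ⟨q, hq⟩ := (h.entry y v).isUnit hyv
  have f1 : Fundamental (b * p * a'⁻¹ * q⁻¹) := fundamental_iff.2 (by rwa [ha', hb, hp, hq])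
  -- The ratio of the new to the old entry at `(x, u)`: their difference is a product of
  -- zero-or-unit terms. It corrects the cross ratio found after the pivot.
  have f2 : Fundamental (a' * 1 * a⁻¹ * 1⁻¹) := fundamental_iff.2 (by
    rw [ha, ha']
    have : L x u * ((1 : Rˣ) : R) - (L x u - Ring.inverse (L i c) * L x c * L i u) * ((1 : Rˣ) : R) =
        Ring.inverse (L i c) * L x c * L i u := by push_cast; ring
    rw [this]
    exact (ZeroOrUnit.mul (Or.inr hu.ringInverse) (h.entry _ _)).mul (h.entry _ _))
  have e1 : b * p * a'⁻¹ * q⁻¹ * (a' * 1 * a⁻¹ * 1⁻¹) = b * p * a⁻¹ * q⁻¹ := by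
    exact Additive.ofMul.injective (by simp only [ofMul_mul, ofMul_inv, ofMul_one]; abel)
  have := hφ.fundamental_mul f1 f2 (e1 ▸ h.map_fundamental ha hb hp hq)
  rwa [e1, fundamental_iff, ha, hb, hp, hq] at this

/-- If the pivots on `(i, c)` and `(i', c)` make the entries of row `x` at `u` and `v` zero,
respectively, then these entries are determined by `L x c`. The 3×3 minor of the rows `i`, `i'`,
`y`, which avoids `x`, then shows that the permanent of the rows `x`, `y` at `u`, `v` is zero or a
unit. So minus the cross ratio is fundamental, which is where `IsLifting.neg` enters. -/
theorem two_of_eq_zero [Fintype m] [DecidableEq m] [DecidableEq n] (hφ : IsLifting φ)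
    (h : IsPartialLift φ L x y) (hxu : L x u ≠ 0) (hxv : L x v ≠ 0) (hyu : L y u ≠ 0)
    (hyv : L y v ≠ 0) {i i' : m} {c : n} (hix : i ≠ x) (hiy : i ≠ y) (hix' : i' ≠ x) (hiy' : i' ≠ y)
    (hiu : L i u ≠ 0) (hic : L i c ≠ 0) (hiv : L i v = 0) (hiu' : L i' u = 0) (hic' : L i' c ≠ 0)
    (hiv' : L i' v ≠ 0) (hyc : L y c = 0) : ZeroOrUnit (L x u * L y v - L x v * L y u) := by
  by_cases h0 : L x u - Ring.inverse (L i c) * L x c * L i u = 0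
  swap
  · exact two_of_pivot_ne hφ h hxu hxv hyu hyv hix hiy hix' hiy' hiu hic hiv hiu' hic' hiv' hyc h0
  by_cases h1 : L x v - Ring.inverse (L i' c) * L x c * L i' v = 0
  swap
  · have := two_of_pivot_ne hφ h hxv hxu hyv hyu hix' hiy' hix hiy hiv' hic' hiu' hiv hic hiu hyc h1
    rw [← zeroOrUnit_neg]
    convert this using 1
    ring
  have e0 : L i c * L x u = L x c * L i u := by
    linear_combination L i c * h0 + (L x c * L i u) *
      (Ring.mul_inverse_cancel _ ((h.entry i c).isUnit hic))
  have e1 : L i' c * L x v = L x c * L i' v := by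
    linear_combination L i' c * h1 + (L x c * L i' v) *
      (Ring.mul_inverse_cancel _ ((h.entry i' c).isUnit hic'))
  have hdet := h.off_left 3 ![⟨i, hix⟩, ⟨i', hix'⟩, ⟨y, h.ne.symm⟩] ![u, c, v]
  rw [Matrix.det_fin_three] at hdet
  simp [hiv, hiu', hyc] at hdet
  obtain ⟨a, ha⟩ := (h.entry x u).isUnit hxu
  obtain ⟨b, hb⟩ := (h.entry x v).isUnit hxv
  obtain ⟨p, hp⟩ := (h.entry y u).isUnit hyu
  obtain ⟨q, hq⟩ := (h.entry y v).isUnit hyv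
  have hsum : ZeroOrUnit (L x u * L y v + L x v * L y u) := by
    refine ZeroOrUnit.of_mul_left
      (((h.entry i c).isUnit hic).mul ((h.entry i' c).isUnit hic')) ?_
    have : L i c * L i' c * (L x u * L y v + L x v * L y u) =
        L x c * (L i u * L i' c * L y v + L i c * L i' v * L y u) := by
      linear_combination (L i' c * L y v) * e0 + (L i c * L y u) * e1
    rw [this]
    exact (h.entry _ _).mul hdet
  have f1 : Fundamental (-(b * p * a⁻¹ * q⁻¹)) := by
    have : -(b * p * a⁻¹ * q⁻¹) = (-b) * p * a⁻¹ * q⁻¹ := by simp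
    rw [this, fundamental_iff, Units.val_neg, ha, hb, hp, hq]
    convert hsum using 1
    ring
  have := hφ.fundamental_of_neg f1 (h.map_fundamental ha hb hp hq)
  rwa [fundamental_iff, ha, hb, hp, hq] at this

/-- Pivots on rows other than `x` and `y` shorten the path to at most two rows without changing the
2×2 minor; the short cases are treated by hand. -/
theorem two_of_isInducedPath [Fintype m] [DecidableEq m] [DecidableEq n] (hφ : IsLifting φ) (l : ℕ) :
    ∀ L : Matrix m n R, IsPartialLift φ L x y → L x u ≠ 0 → L x v ≠ 0 → L y u ≠ 0 → L y v ≠ 0 →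
      ∀ r c, IsInducedPath L {x, y}ᶜ u v l r c →
        ZeroOrUnit (L x u * L y v - L x v * L y u) := by
  have mem : ∀ i, i ∈ ({x, y} : Set m)ᶜ → i ≠ x ∧ i ≠ y := fun i hi => by simpa using hi
  induction l with
  | zero =>
    intro L _ _ _ _ _ r c hp
    left
    rw [← hp.left, hp.right]
    ring
  | succ l ih =>
    intro L h hxu hxv hyu hyv r c hp
    match l, ih, hp with
    | 0, _, hp =>
      obtain ⟨h1, h2⟩ := mem _ (hp.mem 0 one_pos)
      exact two_of_row hφ h hxu hxv hyu hyv h1 h2 (hp.left ▸ hp.ne_fst 0 one_pos)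
        (hp.right ▸ hp.ne_snd 0 one_pos)
    | 1, _, hp =>
      obtain ⟨m1, m2⟩ := mem _ (hp.mem 0 two_pos)
      obtain ⟨m3, m4⟩ := mem _ (hp.mem 1 one_lt_two)
      have n1 := hp.left ▸ hp.ne_fst 0 two_pos
      have n2 := hp.ne_snd 0 two_pos
      have n3 := hp.ne_fst 1 one_lt_two
      have n4 := hp.right ▸ hp.ne_snd 1 one_lt_two
      have z1 := hp.right ▸ hp.eq_zero 0 two_pos 2 le_rfl (by norm_num) (by norm_num)
      have z2 := hp.left ▸ hp.eq_zero 1 one_lt_two 0 (by norm_num) (by norm_num) (by norm_num)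
      by_cases hyc : L y (c 1) = 0
      · exact two_of_eq_zero hφ h hxu hxv hyu hyv m1 m2 m3 m4 n1 n2 z1 z2 n3 n4 hyc
      by_cases hxc : L x (c 1) = 0
      · have := two_of_eq_zero hφ h.symm hyu hyv hxu hxv m2 m1 m4 m3 n1 n2 z1 z2 n3 n4 hxc
        rw [← zeroOrUnit_neg]
        convert this using 1
        ring
      -- With both rows nonzero at the middle column, the cross ratio splits there into two factors,
      -- each joined by a single row.
      have g1 := two_of_row hφ h hxu hxc hyu hyc m1 m2 n1 n2
      have g2 := two_of_row hφ h hxc hxv hyc hyv m3 m4 n3 n4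
      obtain ⟨a, ha⟩ := (h.entry x u).isUnit hxu
      obtain ⟨b, hb⟩ := (h.entry x v).isUnit hxv
      obtain ⟨p, hp⟩ := (h.entry y u).isUnit hyu
      obtain ⟨q, hq⟩ := (h.entry y v).isUnit hyv
      obtain ⟨s, hs⟩ := (h.entry x (c 1)).isUnit hxc
      obtain ⟨t, ht⟩ := (h.entry y (c 1)).isUnit hyc
      rw [← ha, ← hp, ← hs, ← ht, ← fundamental_iff] at g1
      rw [← hb, ← hq, ← hs, ← ht, ← fundamental_iff] at g2
      have e1 : s * p * a⁻¹ * t⁻¹ * (b * t * s⁻¹ * q⁻¹) = b * p * a⁻¹ * q⁻¹ := by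
        exact Additive.ofMul.injective (by simp only [ofMul_mul, ofMul_inv]; abel)
      have := hφ.fundamental_mul g1 g2 (e1 ▸ h.map_fundamental ha hb hp hq)
      rwa [e1, fundamental_iff, ha, hb, hp, hq] at this
    | l + 2, ih, hp =>
      obtain ⟨m1, m2⟩ := mem _ (hp.mem 1 (by omega))
      have h' := h.pivot m1 m2 ((h.entry _ _).isUnit (hp.ne_fst 1 (by omega)))
      obtain ⟨⟨r', c', hp'⟩, hend⟩ := hp.pivot_shorten fun i _ j => h.entry i j
      have := ih _ h' (by rwa [(hend x m1.symm).1]) (by rwa [(hend x m1.symm).2])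
        (by rwa [(hend y m2.symm).1]) (by rwa [(hend y m2.symm).2]) r' c' hp'
      rwa [(hend x m1.symm).1, (hend x m1.symm).2, (hend y m2.symm).1, (hend y m2.symm).2] at this

/-- A zero entry leaves a product of entries. Otherwise both rows meet `u` and `v`, so no uncrossed
set separates these columns and a path exists; in the direct sum case this cannot occur. -/
theorem two [Fintype m] [DecidableEq m] [DecidableEq n] (hφ : IsLifting φ)
    (h : IsPartialLift φ L x y) (hQ : Removable L x y) (u v : n) :
    ZeroOrUnit (L x u * L y v - L x v * L y u) := by
  by_cases hxu : L x u = 0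
  · rw [hxu, zero_mul, zero_sub, zeroOrUnit_neg]
    exact (h.entry _ _).mul (h.entry _ _)
  by_cases hyv : L y v = 0
  · rw [hyv, mul_zero, zero_sub, zeroOrUnit_neg]
    exact (h.entry _ _).mul (h.entry _ _)
  by_cases hxv : L x v = 0
  · rw [hxv, zero_mul, sub_zero]
    exact (h.entry _ _).mul (h.entry _ _)
  by_cases hyu : L y u = 0
  · rw [hyu, mul_zero, sub_zero]
    exact (h.entry _ _).mul (h.entry _ _)
  rcases hQ with hQ | ⟨S, -, h1, h2⟩
  · have : Nonempty m := ⟨x⟩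
    obtain ⟨l, r, c, hp⟩ := exists_isInducedPath L {x, y}ᶜ u v (by
      intro S hS hu
      by_contra hv
      exact hQ S (fun i hix hiy => hS i (by simp [hix, hiy])) ⟨⟨u, hu, hxu⟩, ⟨v, hv, hxv⟩⟩
        ⟨⟨u, hu, hyu⟩, ⟨v, hv, hyv⟩⟩)
    exact two_of_isInducedPath hφ l L h hxu hxv hyu hyv r c hp
  · exfalso
    by_cases hu : u ∈ S
    · exact hyu (h2 u hu)
    · exact hxu (h1 u hu)

/-- A minor that uses `x`, `y` and a third row is reduced by a pivot in the third row. Partial lifts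
and removability survive such pivots, so only the 2×2 minors in the rows `x`, `y` remain. -/
theorem hasUnitMinors [Fintype m] [DecidableEq m] [DecidableEq n] (hφ : IsLifting φ)
    (h : IsPartialLift φ L x y) (hQ : Removable L x y) : HasUnitMinors L := by
  intro k
  induction k generalizing L with
  | zero => intro f g; simp [ZeroOrUnit]
  | succ k ih =>
    intro f g
    by_cases hf : Function.Injective f
    swap
    · obtain ⟨i, j, hij, hne⟩ := Function.not_injective_iff.1 hf
      exact Or.inl (Matrix.det_zero_of_row_eq hne (by ext; simp [Matrix.submatrix, hij]))
    by_cases hg : Function.Injective g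
    swap
    · obtain ⟨i, j, hij, hne⟩ := Function.not_injective_iff.1 hg
      exact Or.inl (Matrix.det_zero_of_column_eq hne (by simp [hij]))
    by_cases hx : ∀ i, f i ≠ x
    · exact h.off_left (k + 1) (fun i => ⟨f i, hx i⟩) g
    by_cases hy : ∀ i, f i ≠ y
    · exact h.off_right (k + 1) (fun i => ⟨f i, hy i⟩) g
    by_cases ht : ∃ t, f t ≠ x ∧ f t ≠ y
    · obtain ⟨t, htx, hty⟩ := ht
      by_cases h0 : ∀ j, L (f t) (g j) = 0
      · exact Or.inl (Matrix.det_eq_zero_of_row_eq_zero t h0)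
      push Not at h0
      obtain ⟨j, hj⟩ := h0
      have hu := (h.entry _ _).isUnit hj
      rw [det_submatrix_eq_pivot hf hg t j hu]
      refine ZeroOrUnit.mul (ZeroOrUnit.mul (Or.inr (isUnit_one.neg.pow _)) (Or.inr hu)) ?_
      exact ih (h.pivot htx hty hu) (hQ.pivot hu htx hty) _ _
    · push Not at hx hy ht
      obtain ⟨i, hi⟩ := hx
      obtain ⟨j, hj⟩ := hy
      have hij : i ≠ j := fun e => h.ne (by rw [← hi, ← hj, e])
      have huniv : ∀ t, t = i ∨ t = j := by
        intro t
        by_cases htx : f t = x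
        · exact Or.inl (hf (by rw [htx, hi]))
        · exact Or.inr (hf (by rw [ht t htx, hj]))
      have hk : k = 1 := by
        have : (Finset.univ : Finset (Fin (k + 1))) = {i, j} := by
          ext t; simpa using huniv t
        have := congrArg Finset.card this
        rw [Finset.card_pair hij] at this
        simpa using this
      subst hk
      rw [Matrix.det_fin_two]
      have h2 := h.two hφ hQ
      simp only [Matrix.submatrix_apply]
      fin_cases i <;> fin_cases j
      · exact absurd rfl hij
      · simp only [Fin.zero_eta, Fin.mk_one] at hi hj
        rw [hi, hj]
        exact h2 _ _
      · simp only [Fin.zero_eta, Fin.mk_one] at hi hj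
        rw [hi, hj, ← zeroOrUnit_neg]
        convert h2 (g 0) (g 1) using 1
        ring
      · exact absurd rfl hij

end IsPartialLift

/-- Lifts of `A` without the row `x` and of `A` without the row `y` can be glued. -/
theorem exists_lift_of_removable [Fintype m] [Finite n] (hφ : IsLifting φ) {A : Matrix m n K}
    (hA : HasUnitMinors A) {x y : m} (hxy : x ≠ y) (hQ : Removable A x y)
    (hx : ∃ L, HasUnitMinors L ∧ L.map φ = rowsOff A x)
    (hy : ∃ L, HasUnitMinors L ∧ L.map φ = rowsOff A y) :
    ∃ L, HasUnitMinors L ∧ L.map φ = A := by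
  classical
  obtain ⟨L₁, h₁, e₁⟩ := hx
  obtain ⟨L₂, h₂, e₂⟩ := hy
  -- Both lifts restrict to lifts of the common rows, where uniqueness up to scaling applies.
  obtain ⟨d, e, hd, he, hde⟩ := exists_scaling (φ := φ)
    (L₁ := L₁.submatrix (fun i : {i // i ≠ x ∧ i ≠ y} => ⟨i, i.2.1⟩) id)
    (L₂ := L₂.submatrix (fun i : {i // i ≠ x ∧ i ≠ y} => ⟨i, i.2.2⟩) id) hφ.inj
    (h₁.submatrix _ _) (h₂.submatrix _ _) (by
      rw [← Matrix.submatrix_map, ← Matrix.submatrix_map, e₁, e₂]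
      rfl)
  have val_eq : ∀ a : Rˣ, Units.map (φ : R →* K) a = 1 → φ (a : R) = 1 := fun a ha => by
    simpa using congrArg Units.val ha
  -- No condition restricts the scaling of row `y`, so the default is 1.
  let d' : m → Rˣ := fun i => if hi : i ≠ x ∧ i ≠ y then d ⟨i, hi⟩ else 1
  have hd' : ∀ i, φ (d' i : R) = 1 := fun i => by
    simp only [d']
    split_ifs
    · exact val_eq _ (hd _)
    · simp
  -- Row `x` is taken from `L₂`, all others from the rescaled `L₁`.
  let L : Matrix m n R := Matrix.of fun i j =>
    if hi : i = x then L₂ ⟨i, hi ▸ hxy⟩ j else (d' i : R) * L₁ ⟨i, hi⟩ j * (e j : R)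
  have hL1 : rowsOff L x = Matrix.of fun (i : {i // i ≠ x}) j => (d' i : R) * L₁ i j * (e j : R) := by
    ext i j
    simp [L, i.2]
  have hL2 : rowsOff L y = L₂ := by
    ext i j
    by_cases hi : i = x
    · have e : (⟨x, hxy⟩ : {i // i ≠ y}) = i := Subtype.ext hi.symm
      simp [L, hi, e]
    · have := hde ⟨i, hi, i.2⟩ j
      simp only [Matrix.submatrix_apply, id] at this
      simp [L, hi, d', i.2, this]
  have hmap : L.map φ = A := by
    ext i j
    by_cases hi : i = x
    · have := congrFun (congrFun e₂ ⟨i, hi ▸ hxy⟩) j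
      simpa [L, hi] using this
    · have := congrFun (congrFun e₁ ⟨i, hi⟩) j
      simpa [L, hi, hd', val_eq _ (he j)] using this
  have hpart : IsPartialLift φ L x y :=
    ⟨hxy, by rw [hL1]; exact h₁.scale (fun i => d' i) e, by rw [hL2]; exact h₂, by rw [hmap]; exact hA⟩
  refine ⟨L, hpart.hasUnitMinors hφ (hQ.congr fun i j => ?_), hmap⟩
  rw [← (hpart.entry i j).map_eq_zero φ, ← hmap]
  rfl

end Glue

/-! ### Leaves of a breadth-first tree -/

section Leaves

variable {V : Type*} [Finite V] (G : SimpleGraph V) (w : V)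

/-- The parent of `v` is the penultimate vertex of a shortest walk from `w`. -/
theorem exists_parent : ∃ f : V → V, ∀ v, G.Reachable w v → v ≠ w →
    G.Adj (f v) v ∧ G.Reachable w (f v) ∧ G.dist w v = G.dist w (f v) + 1 := by
  have : ∀ v, ∃ u, G.Reachable w v → v ≠ w →
      G.Adj u v ∧ G.Reachable w u ∧ G.dist w v = G.dist w u + 1 := by
    intro v
    by_cases hv : G.Reachable w v ∧ v ≠ w
    · obtain ⟨p, hp⟩ := hv.1.exists_walk_length_eq_dist
      have hnil : ¬p.Nil := fun h => hv.2 h.eq.symm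
      refine ⟨p.penultimate, fun _ _ => ?_⟩
      have hadj := p.adj_penultimate hnil
      have hr : G.Reachable w p.penultimate := ⟨p.dropLast⟩
      refine ⟨hadj, hr, le_antisymm ?_ ?_⟩
      · obtain ⟨q, hq⟩ := hr.exists_walk_length_eq_dist
        have := SimpleGraph.dist_le (q.append hadj.toWalk)
        simpa [hq] using this
      · have h1 := SimpleGraph.dist_le p.dropLast
        have h2 : p.dropLast.length + 1 = p.length := by
          exact SimpleGraph.Walk.length_dropLast_add_one hnil
        omega
    · exact ⟨w, fun h1 h2 => absurd ⟨h1, h2⟩ hv⟩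
  choose f hf using this
  exact ⟨f, hf⟩

/-- Three neighbours of `w` lead to three distinct vertices of the component of `w`, any set of which
can be removed without disconnecting the rest of the component. -/
theorem exists_leaves (a : Fin 3 → V) (ha : Function.Injective a) (hadj : ∀ i, G.Adj w (a i)) :
    ∃ b : Fin 3 → V, Function.Injective b ∧ (∀ i, b i ≠ w) ∧ (∀ i, G.Reachable w (b i)) ∧
      ∀ X ⊆ Set.range b, ∀ T : Set V, w ∈ T → (∀ u v, u ∈ T → G.Adj u v → v ∉ X → v ∈ T) →
        ∀ v, G.Reachable w v → v ∉ X → v ∈ T := by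
  obtain ⟨f, hf⟩ := exists_parent G w
  -- The ancestor of `v` at distance one from `w`.
  let top : V → V := fun v => f^[G.dist w v - 1] v
  -- In each of the three branches a farthest vertex is chosen; it has no child, since a child would
  -- be farther away in the same branch.
  have hex : ∀ i, ∃ b, (G.Reachable w b ∧ b ≠ w ∧ top b = a i) ∧
      ∀ u, (G.Reachable w u ∧ u ≠ w ∧ top u = a i) → G.dist w u ≤ G.dist w b := by
    intro i
    obtain ⟨b, hb, hmax⟩ := Set.exists_max_image {u | G.Reachable w u ∧ u ≠ w ∧ top u = a i}
      (fun u => G.dist w u) (Set.toFinite _)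
      ⟨a i, (hadj i).reachable, (hadj i).ne', by
        have : G.dist w (a i) = 1 := SimpleGraph.dist_eq_one_iff_adj.2 (hadj i)
        simp [top, this]⟩
    exact ⟨b, hb, hmax⟩
  choose b hb hmax using hex
  have hleaf : ∀ i u, G.Reachable w u → u ≠ w → f u ≠ b i := by
    intro i u hu huw e
    obtain ⟨h1, h2, h3⟩ := hf u hu huw
    have hd : G.dist w (b i) ≠ 0 := fun h0 => (hb i).2.1
      (((hb i).1.dist_eq_zero_iff).1 h0).symm
    have htop : top u = a i := by
      rw [← (hb i).2.2]
      simp only [top]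
      rw [h3, e, Nat.add_sub_cancel]
      obtain ⟨k, hk⟩ := Nat.exists_eq_succ_of_ne_zero hd
      rw [hk, Function.iterate_succ_apply, e]
      rfl
    have := hmax i u ⟨hu, huw, htop⟩
    rw [h3, e] at this
    omega
  refine ⟨b, fun i j hij => ha ?_, fun i => (hb i).2.1, fun i => (hb i).1, ?_⟩
  · rw [← (hb i).2.2, ← (hb j).2.2, hij]
  · intro X hX T hw hT v
    induction hd : G.dist w v using Nat.strong_induction_on generalizing v with
    | _ d ih =>
      intro hv hvX
      by_cases hvw : v = w
      · exact hvw ▸ hw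
      obtain ⟨h1, h2, h3⟩ := hf v hv hvw
      -- The path of ancestors from `v` to `w` avoids `X`, because no chosen vertex is a parent.
      refine hT _ _ (ih _ (by omega) (f v) rfl h2 fun hfX => ?_) h1 hvX
      obtain ⟨i, hi⟩ := hX hfX
      exact hleaf i v hv hvw hi.symm

end Leaves

/-! ### Finding removable rows or columns -/

section Reduction

variable {R : Type*} [CommRing R] [Nontrivial R] {m n : Type*} {A : Matrix m n R}

/-- The hypothesis `H` says that the columns of `C` are still reachable from `w` when paths may not
pass through `x` or `y`. An uncrossed `S` therefore has all of `C`, and with it the support of `x`,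
on the side of `w`. -/
theorem removable_of_closure (w : m ⊕ n) {x y : m} (hwx : w ≠ Sum.inl x) (hwy : w ≠ Sum.inl y)
    (C : Set (m ⊕ n)) (hC : ∀ j, A x j ≠ 0 → Sum.inr j ∈ C)
    (H : ∀ T : Set (m ⊕ n), w ∈ T → (∀ i j, A i j ≠ 0 → Sum.inl i ∈ T → Sum.inr j ∈ T) →
      (∀ i j, A i j ≠ 0 → i ≠ x → i ≠ y → Sum.inr j ∈ T → Sum.inl i ∈ T) →
      ∀ j, Sum.inr j ∈ C → Sum.inr j ∈ T) : Removable A x y := by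
  left
  rintro S hS ⟨⟨j, hj, hxj⟩, ⟨k, hk, hxk⟩⟩ -
  -- The columns of `P` together with the rows supported in `P`.
  let T : Set n → Set (m ⊕ n) := fun P =>
    {v | Sum.elim (fun i => ∀ j, A i j ≠ 0 → j ∈ P) (fun j => j ∈ P) v}
  have hS' : ∀ i, i ≠ x → i ≠ y → ∀ j j', A i j ≠ 0 → A i j' ≠ 0 → j ∈ S → j' ∈ S := by
    intro i hx hy j j' hj hj' hjS
    by_contra hj'S
    exact hS i hx hy ⟨⟨j, hjS, hj⟩, ⟨j', hj'S, hj'⟩⟩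
  have closed : ∀ P : Set n, (∀ i, i ≠ x → i ≠ y → ∀ j j', A i j ≠ 0 → A i j' ≠ 0 → j ∈ P → j' ∈ P) →
      w ∈ T P → ∀ j, Sum.inr j ∈ C → j ∈ P := fun P hP hw =>
    H (T P) hw (fun i j hij hi => hi j hij) (fun i j hij hix hiy hj j' hj' => hP i hix hiy j j' hij hj' hj)
  by_cases hw : w ∈ T S
  · exact hk (closed S hS' hw k (hC k hxk))
  · refine closed Sᶜ (fun i hx hy j j' hj hj' hjS hj'S => hjS (hS' i hx hy j' j hj' hj hj'S)) ?_ j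
      (hC j hxj) hj
    rcases w with i | j'
    · have hix : i ≠ x := fun e => hwx (e ▸ rfl)
      have hiy : i ≠ y := fun e => hwy (e ▸ rfl)
      intro j' hj' hj'S
      exact hw fun j'' hj'' => hS' i hix hiy j' j'' hj' hj'' hj'S
    · exact hw

/-- Two rows or two columns satisfy the condition for gluing lifts. -/
def HasRemovable (A : Matrix m n R) : Prop :=
  (∃ x y, x ≠ y ∧ Removable A x y) ∨ ∃ x y, x ≠ y ∧ Removable A.transpose x y

theorem HasRemovable.of_transpose (h : HasRemovable A.transpose) : HasRemovable A :=
  Or.symm h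

/-- Of the three leaves that `exists_leaves` finds in the bipartite graph, two are of the same kind:
two rows or two columns. Deleting both keeps the rest of the component connected. -/
theorem hasRemovable_of_three [Finite m] [Finite n] (i : m) (a : Fin 3 → n)
    (ha : Function.Injective a) (h : ∀ t, A i (a t) ≠ 0) : HasRemovable A := by
  let adj : m ⊕ n → m ⊕ n → Prop := fun u v =>
    Sum.elim (fun i => Sum.elim (fun _ => False) (fun j => A i j ≠ 0) v)
      (fun j => Sum.elim (fun i => A i j ≠ 0) (fun _ => False) v) u
  let G : SimpleGraph (m ⊕ n) :=
    { Adj := adj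
      symm := ⟨by rintro (i | j) (i' | j') h <;> exact h⟩
      loopless := ⟨by rintro (i | j) h <;> exact h⟩ }
  obtain ⟨b, hb, hbw, hbr, H⟩ := exists_leaves G (Sum.inl i) (fun t => Sum.inr (a t))
    (fun s t hst => ha (Sum.inr_injective hst)) h
  have rows : ∀ s t x y, s ≠ t → b s = Sum.inl x → b t = Sum.inl y → HasRemovable A := by
    intro s t x y hst hs ht
    refine Or.inl ⟨x, y, fun e => hst (hb (by rw [hs, ht, e])), ?_⟩
    refine removable_of_closure (Sum.inl i) (hs ▸ (hbw s).symm) (ht ▸ (hbw t).symm)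
      {v | G.Reachable (Sum.inl i) v} ?_ ?_
    · intro j hj
      have : G.Adj (Sum.inl x) (Sum.inr j) := hj
      exact (hs ▸ hbr s).trans this.reachable
    · intro T hw h1 h2 j hj
      refine H {Sum.inl x, Sum.inl y} ?_ T hw ?_ _ hj (by simp)
      · rintro v (rfl | rfl)
        · exact ⟨s, hs⟩
        · exact ⟨t, ht⟩
      · rintro (i' | j') (i'' | j'') hu hadj hX
        · exact absurd hadj id
        · exact h1 _ _ hadj hu
        · exact h2 _ _ hadj (fun e => hX (by simp [e])) (fun e => hX (by simp [e])) hu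
        · exact absurd hadj id
  have cols : ∀ s t x y, s ≠ t → b s = Sum.inr x → b t = Sum.inr y → HasRemovable A := by
    intro s t x y hst hs ht
    refine Or.inr ⟨x, y, fun e => hst (hb (by rw [hs, ht, e])), ?_⟩
    refine removable_of_closure (Sum.inr i) (by simp) (by simp)
      {v | G.Reachable (Sum.inl i) v.swap} ?_ ?_
    · intro j hj
      have : G.Adj (Sum.inr x) (Sum.inl j) := hj
      exact SimpleGraph.Reachable.trans (hs ▸ hbr s) this.reachable
    · intro T hw h1 h2 j hj
      have := H {Sum.inr x, Sum.inr y} ?_ {v | v.swap ∈ T} hw ?_ _ hj (by simp)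
      · exact this
      · rintro v (rfl | rfl)
        · exact ⟨s, hs⟩
        · exact ⟨t, ht⟩
      · rintro (i' | j') (i'' | j'') hu hadj hX
        · exact absurd hadj id
        · exact h2 _ _ hadj (fun e => hX (by simp [e])) (fun e => hX (by simp [e])) hu
        · exact h1 _ _ hadj hu
        · exact absurd hadj id
  rcases h0 : b 0 with x | x <;> rcases h1 : b 1 with y | y <;> rcases h2 : b 2 with z | z
  · exact rows 0 1 _ _ (by decide) h0 h1
  · exact rows 0 1 _ _ (by decide) h0 h1
  · exact rows 0 2 _ _ (by decide) h0 h2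
  · exact cols 1 2 _ _ (by decide) h1 h2
  · exact rows 1 2 _ _ (by decide) h1 h2
  · exact cols 0 2 _ _ (by decide) h0 h2
  · exact cols 0 1 _ _ (by decide) h0 h1
  · exact cols 0 1 _ _ (by decide) h0 h1

theorem hasRemovable_of_three' [Finite m] [Finite n] {i : m} {j₁ j₂ j₃ : n} (h₁₂ : j₁ ≠ j₂)
    (h₁₃ : j₁ ≠ j₃) (h₂₃ : j₂ ≠ j₃) (h₁ : A i j₁ ≠ 0) (h₂ : A i j₂ ≠ 0) (h₃ : A i j₃ ≠ 0) :
    HasRemovable A := by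
  refine hasRemovable_of_three i ![j₁, j₂, j₃] ?_ ?_
  · intro s t hst
    fin_cases s <;> fin_cases t <;> simp_all
  · intro t
    fin_cases t <;> simp_all

/-- A row with at most one nonzero entry crosses nothing and forms a removable pair with any other
row. -/
theorem exists_two_of_not_hasRemovable (hA : ¬HasRemovable A) {x y : m} (hxy : x ≠ y) :
    ∃ j j', j ≠ j' ∧ A x j ≠ 0 ∧ A x j' ≠ 0 := by
  by_contra hne
  push Not at hne
  refine hA (Or.inl ⟨x, y, hxy, Or.inl ?_⟩)
  rintro S - ⟨⟨j, hj, hxj⟩, ⟨k, hk, hxk⟩⟩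
  exact absurd (hne j k (fun e => hk (e ▸ hj)) hxj) hxk

/-- Up to a pivot, every matrix that is not very small has two rows or two columns at which lifts can
be glued. -/
theorem hasRemovable_cases [Finite m] [Finite n] [DecidableEq m] [DecidableEq n]
    (hA : ∀ i j, ZeroOrUnit (A i j)) :
    HasRemovable A ∨ (∃ r c, IsUnit (A r c) ∧ HasRemovable (pivot A r c)) ∨
      (Subsingleton m ∧ Subsingleton n) ∨
      ∃ (b d : m) (a c : n), b ≠ d ∧ a ≠ c ∧ (∀ i, i = b ∨ i = d) ∧ (∀ j, j = a ∨ j = c) ∧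
        ∀ i j, A i j ≠ 0 := by
  by_cases h : HasRemovable A
  · exact Or.inl h
  refine Or.inr ?_
  have hT : ¬HasRemovable A.transpose := fun h' => h h'.of_transpose
  by_cases hm : Subsingleton m
  · refine Or.inr (Or.inl ⟨hm, ⟨fun j j' => ?_⟩⟩)
    by_contra hj
    obtain ⟨i, i', hi, -⟩ := exists_two_of_not_hasRemovable hT hj
    exact hi (Subsingleton.elim _ _)
  rw [not_subsingleton_iff_nontrivial] at hm
  have hrow : ∀ i, ∃ j j', j ≠ j' ∧ A i j ≠ 0 ∧ A i j' ≠ 0 := fun i => by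
    obtain ⟨i', hi'⟩ := exists_ne i
    exact exists_two_of_not_hasRemovable h hi'.symm
  have hn : Nontrivial n := by
    obtain ⟨b⟩ : Nonempty m := inferInstance
    obtain ⟨j, j', hj, -⟩ := hrow b
    exact ⟨j, j', hj⟩
  have hcol : ∀ j, ∃ i i', i ≠ i' ∧ A i j ≠ 0 ∧ A i' j ≠ 0 := fun j => by
    obtain ⟨j', hj'⟩ := exists_ne j
    exact exists_two_of_not_hasRemovable hT hj'.symm
  -- From here on every row and every column has exactly two nonzero entries, so the bipartite graph
  -- is a union of cycles.
  have row_only : ∀ i j j' k, j ≠ j' → A i j ≠ 0 → A i j' ≠ 0 → A i k ≠ 0 → k = j ∨ k = j' := by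
    intro i j j' k hjj hj hj' hk
    by_contra! hne
    exact h (hasRemovable_of_three' hjj hne.1.symm hne.2.symm hj hj' hk)
  have col_only : ∀ j i i' k, i ≠ i' → A i j ≠ 0 → A i' j ≠ 0 → A k j ≠ 0 → k = i ∨ k = i' := by
    intro j i i' k hii hi hi' hk
    by_contra! hne
    exact hT (hasRemovable_of_three' (A := A.transpose) hii hne.1.symm hne.2.symm hi hi' hk)
  obtain ⟨b⟩ : Nonempty m := inferInstance
  obtain ⟨a, c, hac, hba, hbc⟩ := hrow b
  obtain ⟨d, hdb, hdc⟩ : ∃ d, d ≠ b ∧ A d c ≠ 0 := by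
    obtain ⟨i, i', hii, hi, hi'⟩ := hcol c
    by_cases hib : i = b
    · exact ⟨i', fun e => hii (by rw [hib, e]), hi'⟩
    · exact ⟨i, hib, hi⟩
  -- If the cycle through `a, b, c, d` does not close up, the pivot on `(b, c)` adds the chord `(d,
  -- a)`, and column `a` then has three nonzero entries.
  by_cases hda : A d a = 0
  · obtain ⟨z, hzb, hza⟩ : ∃ z, z ≠ b ∧ A z a ≠ 0 := by
      obtain ⟨i, i', hii, hi, hi'⟩ := hcol a
      by_cases hib : i = b
      · exact ⟨i', fun e => hii (by rw [hib, e]), hi'⟩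
      · exact ⟨i, hib, hi⟩
    have hzd : z ≠ d := fun e => hza (e ▸ hda)
    have hzc : A z c = 0 := by
      by_contra hne
      rcases col_only c b d z hdb.symm hbc hdc hne with e | e
      · exact hzb e
      · exact hzd e
    have hu := (hA b c).isUnit hbc
    refine Or.inl ⟨b, c, hu, HasRemovable.of_transpose
      (hasRemovable_of_three' (i := a) hdb.symm hzb.symm hzd.symm ?_ ?_ ?_)⟩
    · rw [Matrix.transpose_apply, pivot_row _ hac, Ne, hu.ringInverse.mul_right_eq_zero]
      exact hba
    · rw [Matrix.transpose_apply, pivot_of_ne _ hdb hac, hda, zero_sub, neg_ne_zero, mul_assoc, Ne,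
        hu.ringInverse.mul_right_eq_zero, ((hA d c).isUnit hdc).mul_right_eq_zero]
      exact hba
    · rw [Matrix.transpose_apply, pivot_of_ne _ hzb hac, hzc]
      simpa using hza
  -- The cycle has length four and is a component of the graph. A further row would lie in another
  -- direct summand and be removable together with `b`.
  · refine Or.inr (Or.inr ?_)
    have hm2 : ∀ i, i = b ∨ i = d := by
      intro y
      by_contra! hy
      refine h (Or.inl ⟨b, y, hy.1.symm, Or.inr ⟨{a, c}, ?_, ?_, ?_⟩⟩)
      · rintro i ⟨⟨j, hj, hij⟩, ⟨k, hk, hik⟩⟩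
        have hi : i = b ∨ i = d := by
          rcases hj with rfl | rfl
          · exact col_only _ b d i hdb.symm hba hda hij
          · exact col_only _ b d i hdb.symm hbc hdc hij
        rcases hi with rfl | rfl
        · exact hk (row_only _ a c k hac hba hbc hik)
        · exact hk (row_only _ a c k hac hda hdc hik)
      · intro j hj
        by_contra hne
        exact hj (row_only _ a c j hac hba hbc hne)
      · intro j hj
        by_contra hne
        rcases hj with rfl | rfl
        · rcases col_only _ b d y hdb.symm hba hda hne with e | e
          · exact hy.1 e
          · exact hy.2 e
        · rcases col_only _ b d y hdb.symm hbc hdc hne with e | e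
          · exact hy.1 e
          · exact hy.2 e
    have hn2 : ∀ j, j = a ∨ j = c := by
      intro j
      obtain ⟨i, -, -, hi, -⟩ := hcol j
      rcases hm2 i with rfl | rfl
      · exact row_only _ a c j hac hba hbc hi
      · exact row_only _ a c j hac hda hdc hi
    refine ⟨b, d, a, c, hdb.symm, hac, hm2, hn2, fun i j => ?_⟩
    rcases hm2 i with rfl | rfl <;> rcases hn2 j with rfl | rfl <;> assumption

end Reduction

/-! ### The lift theorem -/

section LiftTheorem

variable {R K : Type*} [CommRing R] [CommRing K] [Nontrivial R] [Nontrivial K] {φ : R →+* K}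

theorem IsLifting.exists_entry (hφ : IsLifting φ) {a : K} (ha : ZeroOrUnit a) :
    ∃ b, ZeroOrUnit b ∧ φ b = a := by
  rcases ha with rfl | ⟨a, rfl⟩
  · exact ⟨0, ZeroOrUnit.zero, map_zero φ⟩
  · obtain ⟨b, rfl⟩ := hφ.exists_unit a
    exact ⟨b, Or.inr b.isUnit, rfl⟩

theorem hasUnitMinors_of_subsingleton {m n : Type*} [Subsingleton m] {A : Matrix m n R}
    (hA : ∀ i j, ZeroOrUnit (A i j)) : HasUnitMinors A := by
  intro k f g
  match k with
  | 0 => simp [ZeroOrUnit]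
  | 1 => simpa using hA (f 0) (g 0)
  | k + 2 =>
    refine Or.inl (Matrix.det_zero_of_row_eq (i := 0) (j := 1) (by simp) ?_)
    ext j
    simp [Subsingleton.elim (f 0) (f 1)]

theorem hasUnitMinors_of_two {m n : Type*} {A : Matrix m n R} {b d : m} {a c : n}
    (hm : ∀ i, i = b ∨ i = d) (hn : ∀ j, j = a ∨ j = c) (hA : ∀ i j, ZeroOrUnit (A i j))
    (hdet : ZeroOrUnit (A b a * A d c - A b c * A d a)) : HasUnitMinors A := by
  intro k f g
  match k with
  | 0 => simp [ZeroOrUnit]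
  | 1 => simpa using hA (f 0) (g 0)
  | 2 =>
    have hdet' : ZeroOrUnit (A b c * A d a - A b a * A d c) := by
      rw [← zeroOrUnit_neg, neg_sub]; exact hdet
    rw [Matrix.det_fin_two]
    simp only [Matrix.submatrix_apply]
    rcases hm (f 0) with h0 | h0 <;> rcases hm (f 1) with h1 | h1 <;>
      rcases hn (g 0) with k0 | k0 <;> rcases hn (g 1) with k1 | k1 <;> rw [h0, h1, k0, k1] <;>
      first
        | exact Or.inl (by ring)
        | exact hdet
        | exact hdet'
        | (rw [mul_comm (A d a), mul_comm (A d c)]; first | exact hdet | exact hdet')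
  | k + 3 =>
    have : ∃ i j : Fin (k + 3), i ≠ j ∧ f i = f j := by
      rcases hm (f ⟨0, by omega⟩) with h0 | h0 <;> rcases hm (f ⟨1, by omega⟩) with h1 | h1 <;>
        rcases hm (f ⟨2, by omega⟩) with h2 | h2 <;>
        first
          | exact ⟨_, _, by simp, h0.trans h1.symm⟩
          | exact ⟨_, _, by simp, h0.trans h2.symm⟩
          | exact ⟨_, _, by simp, h1.trans h2.symm⟩
    obtain ⟨i, j, hij, hf⟩ := this
    exact Or.inl (Matrix.det_zero_of_row_eq hij (by ext; simp [hf]))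

/-- Three entries are lifted arbitrarily; the fourth is then chosen so that the cross ratio becomes
a fundamental lift of the given one. -/
theorem exists_lift_of_two (hφ : IsLifting φ) {m n : Type*} {A : Matrix m n K}
    (hA : HasUnitMinors A) {b d : m} {a c : n} (hbd : b ≠ d) (hac : a ≠ c)
    (hm : ∀ i, i = b ∨ i = d) (hn : ∀ j, j = a ∨ j = c) (hne : ∀ i j, A i j ≠ 0) :
    ∃ L : Matrix m n R, HasUnitMinors L ∧ L.map φ = A := by
  classical
  obtain ⟨p, hp⟩ := (hA.entry b a).isUnit (hne _ _)
  obtain ⟨q, hq⟩ := (hA.entry b c).isUnit (hne _ _)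
  obtain ⟨r, hr⟩ := (hA.entry d a).isUnit (hne _ _)
  obtain ⟨s, hs⟩ := (hA.entry d c).isUnit (hne _ _)
  have hf : Fundamental (q * r * p⁻¹ * s⁻¹) := fundamental_iff.2 (by
    rw [hp, hq, hr, hs]; exact hA.two b d a c)
  obtain ⟨t, ht, et⟩ := hφ.exists_fundamental _ hf
  obtain ⟨p', ep⟩ := hφ.exists_unit p
  obtain ⟨q', eq⟩ := hφ.exists_unit q
  obtain ⟨r', er⟩ := hφ.exists_unit r
  let s' : Rˣ := q' * r' * p'⁻¹ * t⁻¹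
  have es : Units.map (φ : R →* K) s' = s := by
    simp only [s', map_mul, map_inv, ep, eq, er, et]
    exact Additive.ofMul.injective (by simp only [ofMul_mul, ofMul_inv]; abel)
  have ht' : t = q' * r' * p'⁻¹ * s'⁻¹ :=
    Additive.ofMul.injective (by simp only [s', ofMul_mul, ofMul_inv]; abel)
  let L : Matrix m n R := Matrix.of fun i j =>
    if i = b then (if j = a then (p' : R) else q') else (if j = a then (r' : R) else s')
  have hL : ∀ i j, ZeroOrUnit (L i j) := fun i j => by
    simp only [L, Matrix.of_apply]
    split_ifs <;> exact Or.inr (Units.isUnit _)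
  refine ⟨L, hasUnitMinors_of_two hm hn hL ?_, ?_⟩
  · simp only [L, Matrix.of_apply, if_true, hbd.symm, hac.symm, if_false]
    rw [← fundamental_iff, ← ht']
    exact ht
  · have val : ∀ {u : Rˣ} {v : Kˣ}, Units.map (φ : R →* K) u = v → φ (u : R) = v := fun h => by
      rw [← h]; rfl
    ext i j
    rcases hm i with rfl | rfl <;> rcases hn j with rfl | rfl <;>
      simp [L, hbd.symm, hac.symm, val ep, val eq, val er, val es, hp, hq, hr, hs]

/-- Induction on the number of rows plus columns, which is invariant under transposition and
pivoting. The index types vary because rows and columns are deleted. -/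
theorem exists_lift_aux (hφ : IsLifting φ) (N : ℕ) : ∀ (m n : Type) [Fintype m] [Fintype n]
    (A : Matrix m n K), Fintype.card m + Fintype.card n = N → HasUnitMinors A →
    ∃ L : Matrix m n R, HasUnitMinors L ∧ L.map φ = A := by
  classical
  induction N using Nat.strong_induction_on with
  | _ N ih =>
    intro m n _ _ A hN hA
    have off : ∀ (m n : Type) [Fintype m] [Fintype n] (A : Matrix m n K),
        Fintype.card m + Fintype.card n = N → HasUnitMinors A → ∀ x,
        ∃ L, HasUnitMinors L ∧ L.map φ = rowsOff A x := by
      intro m n _ _ A hN hA x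
      refine ih _ ?_ {i // i ≠ x} n _ rfl (hA.submatrix _ _)
      have : Fintype.card {i // i ≠ x} < Fintype.card m := Fintype.card_subtype_lt (x := x) (by simp)
      omega
    have main : ∀ A : Matrix m n K, HasUnitMinors A → HasRemovable A →
        ∃ L : Matrix m n R, HasUnitMinors L ∧ L.map φ = A := by
      intro A hA h
      rcases h with ⟨x, y, hxy, hQ⟩ | ⟨x, y, hxy, hQ⟩
      · exact exists_lift_of_removable hφ hA hxy hQ (off _ _ _ hN hA x) (off _ _ _ hN hA y)
      · obtain ⟨L, hL, e⟩ := exists_lift_of_removable hφ hA.transpose hxy hQ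
          (off n m _ (by omega) hA.transpose x) (off n m _ (by omega) hA.transpose y)
        exact ⟨L.transpose, hL.transpose, by rw [Matrix.transpose_map, e, Matrix.transpose_transpose]⟩
    rcases hasRemovable_cases hA.entry with h | ⟨r, c, hu, h⟩ | ⟨hm, hn⟩ |
      ⟨b, d, a, c, hbd, hac, hm, hn, hne⟩
    · exact main A hA h
    · obtain ⟨L, hL, e⟩ := main _ (hA.pivot hu) h
      -- The lift of the pivoted matrix is pivoted back.
      have hLu : IsUnit (L r c) := by
        refine (hL.entry r c).isUnit fun h0 => (isUnit_pivot_self hu).ne_zero ?_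
        rw [← e, Matrix.map_apply, h0, map_zero]
      exact ⟨pivot L r c, hL.pivot hLu, by rw [pivot_map φ hLu, e, pivot_pivot hu]⟩
    · choose L hL e using fun i j => hφ.exists_entry (hA.entry i j)
      exact ⟨Matrix.of L, hasUnitMinors_of_subsingleton hL, by ext i j; exact e i j⟩
    · exact exists_lift_of_two hφ hA hbd hac hm hn hne

/-- The lift theorem: matrices with unit minors can be lifted. -/
theorem exists_lift (hφ : IsLifting φ) {m n : Type*} [Finite m] [Finite n] {A : Matrix m n K}
    (hA : HasUnitMinors A) : ∃ L : Matrix m n R, HasUnitMinors L ∧ L.map φ = A := by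
  obtain ⟨a, ⟨e⟩⟩ := Finite.exists_equiv_fin m
  obtain ⟨b, ⟨f⟩⟩ := Finite.exists_equiv_fin n
  obtain ⟨L, hL, h⟩ := exists_lift_aux hφ _ (Fin a) (Fin b) (A.submatrix e.symm f.symm) rfl
    (hA.submatrix _ _)
  refine ⟨L.submatrix e f, hL.submatrix _ _, ?_⟩
  rw [← Matrix.submatrix_map, h]
  ext i j
  simp

end LiftTheorem

/-! ### The ring ℤ[1/2, ζ], its units and its fundamental elements -/

section Eisenstein

/-- The conjugate root is `1 - z`, so the right side is the norm form of ℤ[ζ]. -/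
theorem eisenstein_norm {F : Type*} [CommRing F] {z : F} (hz : z ^ 2 = z - 1) (a b : ℤ) :
    ((a : F) + b * z) * (a + b - b * z) = ((a ^ 2 + a * b + b ^ 2 : ℤ) : F) := by
  push_cast
  linear_combination (-(b : F) ^ 2) * hz

theorem eisenstein_norm_eq_zero {a b : ℤ} (h : a ^ 2 + a * b + b ^ 2 = 0) : a = 0 ∧ b = 0 := by
  have hb : b = 0 := by
    by_contra hb
    have : 0 < b ^ 2 := by positivity
    nlinarith [sq_nonneg (2 * a + b)]
  subst hb
  exact ⟨by simpa using h, rfl⟩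

theorem eq_zero_of_add_mul_eq_zero {ζ : ℂ} (hζ : ζ ^ 2 = ζ - 1) {a b : ℤ}
    (h : (a : ℂ) + b * ζ = 0) : a = 0 ∧ b = 0 := by
  have := eisenstein_norm hζ a b
  rw [h, zero_mul] at this
  exact eisenstein_norm_eq_zero (by exact_mod_cast this.symm)

variable {F : Type*} [CommRing F] {ζ : ℂ} {z : F}

/-- The graph of the homomorphism from `ℤ[1/2, ζ]` to `F` that maps `ζ` to `z`. -/
def liftRing (hζ : ζ ^ 2 = ζ - 1) (hz : z ^ 2 = z - 1) : Subring (ℂ × F) where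
  carrier := {x | ∃ (n : ℕ) (a b : ℤ), 2 ^ n * x.1 = a + b * ζ ∧ 2 ^ n * x.2 = a + b * z}
  zero_mem' := ⟨0, 0, 0, by simp, by simp⟩
  one_mem' := ⟨0, 1, 0, by simp, by simp⟩
  add_mem' := by
    rintro x y ⟨n, a, b, h1, h2⟩ ⟨m, c, d, h3, h4⟩
    refine ⟨n + m, 2 ^ m * a + 2 ^ n * c, 2 ^ m * b + 2 ^ n * d, ?_, ?_⟩
    · push_cast [Prod.fst_add]
      linear_combination 2 ^ m * h1 + 2 ^ n * h3
    · push_cast [Prod.snd_add]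
      linear_combination 2 ^ m * h2 + 2 ^ n * h4
  mul_mem' := by
    rintro x y ⟨n, a, b, h1, h2⟩ ⟨m, c, d, h3, h4⟩
    refine ⟨n + m, a * c - b * d, a * d + b * c + b * d, ?_, ?_⟩
    · push_cast [Prod.fst_mul]
      linear_combination (2 ^ m * y.1) * h1 + (a + b * ζ) * h3 + (b * d : ℂ) * hζ
    · push_cast [Prod.snd_mul]
      linear_combination (2 ^ m * y.2) * h2 + (a + b * z) * h4 + (b * d : F) * hz
  neg_mem' := by
    rintro x ⟨n, a, b, h1, h2⟩
    refine ⟨n, -a, -b, ?_, ?_⟩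
    · push_cast [Prod.fst_neg]
      linear_combination -h1
    · push_cast [Prod.snd_neg]
      linear_combination -h2

variable (hζ : ζ ^ 2 = ζ - 1) (hz : z ^ 2 = z - 1)

theorem gen_mem : (ζ, z) ∈ liftRing hζ hz := ⟨0, 0, 1, by simp, by simp⟩

theorem half_mem {h : F} (hh : 2 * h = 1) : ((2⁻¹ : ℂ), h) ∈ liftRing hζ hz :=
  ⟨1, 1, 0, by simp, by simpa using hh⟩

variable {hζ hz}

/-- 1 and ζ are independent over ℤ, so a vanishing first coordinate has zero numerator; with 2
invertible in `F` the second coordinate vanishes too. -/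
theorem liftRing_snd_unique (h2 : IsUnit (2 : F)) {x : ℂ} {y y' : F}
    (h : (x, y) ∈ liftRing hζ hz) (h' : (x, y') ∈ liftRing hζ hz) : y = y' := by
  have := (liftRing hζ hz).sub_mem h h'
  obtain ⟨n, a, b, e1, e2⟩ := this
  simp only [Prod.mk_sub_mk, sub_self, mul_zero] at e1 e2
  obtain ⟨rfl, rfl⟩ := eq_zero_of_add_mul_eq_zero hζ e1.symm
  have : 2 ^ n * (y - y') = 0 := by simpa using e2
  exact sub_eq_zero.1 ((h2.pow n).mul_right_eq_zero.1 this)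

theorem pow_six_eq_one {z : F} (hz : z ^ 2 = z - 1) : z ^ 6 = 1 := by
  linear_combination (z ^ 4 + z ^ 3 - z - 1) * hz

theorem eisenstein_ne_zero (hζ : ζ ^ 2 = ζ - 1) : ζ ≠ 0 := by
  rintro rfl
  norm_num at hζ

/-- 2 is inert in ℤ[ζ]: the norm form has no nontrivial zero modulo 2. -/
theorem even_of_even_norm {a b : ℤ} (h : Even (a ^ 2 + a * b + b ^ 2)) : Even a ∧ Even b := by
  simp only [Int.even_add, Int.even_mul, Int.even_pow] at h
  tauto

/-- An element of `ℤ[ζ]` whose norm is a power of two is a power of two times a power of `ζ`. -/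
theorem exists_eq_two_pow_mul (hζ : ζ ^ 2 = ζ - 1) (s : ℕ) : ∀ a b : ℤ,
    a ^ 2 + a * b + b ^ 2 = 2 ^ s → ∃ k j : ℕ, j < 6 ∧ (a : ℂ) + b * ζ = 2 ^ k * ζ ^ j := by
  induction s using Nat.strong_induction_on with
  | _ s ih =>
    intro a b h
    rcases Nat.eq_zero_or_pos s with rfl | hs
    · rw [pow_zero] at h
      have ha : a ^ 2 ≤ 1 := by nlinarith [sq_nonneg (a + 2 * b)]
      have hb : b ^ 2 ≤ 1 := by nlinarith [sq_nonneg (2 * a + b)]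
      have ha' : -1 ≤ a ∧ a ≤ 1 := abs_le.1 (by rw [← sq_le_one_iff_abs_le_one]; exact ha)
      have hb' : -1 ≤ b ∧ b ≤ 1 := abs_le.1 (by rw [← sq_le_one_iff_abs_le_one]; exact hb)
      have h3 : ζ ^ 3 = -1 := by linear_combination (ζ + 1) * hζ
      obtain ⟨ha1, ha2⟩ := ha'
      obtain ⟨hb1, hb2⟩ := hb'
      interval_cases a <;> interval_cases b <;> norm_num at h
      · exact ⟨0, 3, by norm_num, by push_cast; linear_combination -h3⟩
      · exact ⟨0, 2, by norm_num, by push_cast; linear_combination -hζ⟩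
      · exact ⟨0, 4, by norm_num, by push_cast; linear_combination -ζ * h3⟩
      · exact ⟨0, 1, by norm_num, by push_cast; ring⟩
      · exact ⟨0, 5, by norm_num, by push_cast; linear_combination -ζ ^ 2 * h3 + hζ⟩
      · exact ⟨0, 0, by norm_num, by push_cast; ring⟩
    -- Both coordinates are even; halving them divides the norm by 4, and in particular norm 2 does
    -- not occur.
    · have hev : Even (a ^ 2 + a * b + b ^ 2) := by
        rw [h]
        exact (even_two).pow_of_ne_zero hs.ne'
      obtain ⟨⟨a', rfl⟩, ⟨b', rfl⟩⟩ := even_of_even_norm hev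
      obtain ⟨t, rfl⟩ : ∃ t, s = t + 2 := by
        refine ⟨s - 2, ?_⟩
        have : s ≠ 1 := by
          rintro rfl
          have : 4 * (a' ^ 2 + a' * b' + b' ^ 2) = 2 := by linear_combination h
          omega
        omega
      obtain ⟨k, j, hj, e⟩ := ih t (by omega) a' b' (by
        have : 4 * (a' ^ 2 + a' * b' + b' ^ 2) = 4 * 2 ^ t := by rw [pow_add] at h; linear_combination h
        linarith)
      refine ⟨k + 1, j, hj, ?_⟩
      push_cast
      linear_combination 2 * e

/-- The units of `ℤ[1/2, ζ]`. -/
theorem exists_eq_of_isUnit {x : liftRing hζ hz} (h : IsUnit x) :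
    ∃ (k : ℤ) (j : ℕ), j < 6 ∧ x.1.1 = 2 ^ k * ζ ^ j := by
  obtain ⟨y, hxy⟩ := h.exists_right_inv
  obtain ⟨n, a, b, e1, -⟩ := x.2
  obtain ⟨m, c, d, e2, -⟩ := y.2
  have e3 : x.1.1 * y.1.1 = 1 := congrArg (fun x => x.1.1) hxy
  have e4 : ((a : ℂ) + b * ζ) * (c + d * ζ) = 2 ^ (n + m) := by
    rw [← e1, ← e2]
    linear_combination 2 ^ (n + m) * e3
  have e5 : ((a * c - b * d - 2 ^ (n + m) : ℤ) : ℂ) + ((a * d + b * c + b * d : ℤ) : ℂ) * ζ = 0 := by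
    push_cast
    linear_combination e4 - (b * d : ℂ) * hζ
  obtain ⟨h1, h2⟩ := eq_zero_of_add_mul_eq_zero hζ e5
  -- By multiplicativity, the norm of the numerator of a unit divides a power of 2.
  have hN : (a ^ 2 + a * b + b ^ 2) * (c ^ 2 + c * d + d ^ 2) = 2 ^ (2 * (n + m)) := by
    have h1' : a * c - b * d = 2 ^ (n + m) := by linarith
    rw [pow_mul', ← h1']
    linear_combination (a * d + b * c + b * d + a * c - b * d) * h2
  have hpos : 0 ≤ a ^ 2 + a * b + b ^ 2 := by nlinarith [sq_nonneg (2 * a + b), sq_nonneg b]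
  obtain ⟨s, -, hs⟩ : ∃ s ≤ 2 * (n + m), (a ^ 2 + a * b + b ^ 2).natAbs = 2 ^ s := by
    refine (Nat.dvd_prime_pow Nat.prime_two).1 ?_
    have := Int.natAbs_dvd_natAbs.2 (Dvd.intro _ hN)
    simpa [Int.natAbs_pow] using this
  obtain ⟨k, j, hj, e⟩ := exists_eq_two_pow_mul hζ s a b (by
    rw [← Int.natAbs_of_nonneg hpos, hs]; push_cast; rfl)
  refine ⟨(k : ℤ) - n, j, hj, ?_⟩
  rw [zpow_sub₀ two_ne_zero, zpow_natCast, zpow_natCast]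
  rw [e] at e1
  field_simp
  linear_combination e1

/-- The complex numbers that occur as fundamental elements of `ℤ[1/2, ζ]`. -/
theorem fst_of_fundamental {p : (liftRing hζ hz)ˣ} (hp : Fundamental p) :
    let x := p.1.1.1; x = 1 ∨ x = -1 ∨ x = 2 ∨ x = 2⁻¹ ∨ x = ζ ∨ x = 1 - ζ := by
  have h3 : ζ ^ 3 = -1 := by linear_combination (ζ + 1) * hζ
  -- Coordinates of the six roots of unity, with norm 1 and trace `2 * a + b`.
  have pow_form : ∀ j < 6, ∃ a b : ℤ, ζ ^ j = a + b * ζ ∧ a ^ 2 + a * b + b ^ 2 = 1 ∧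
      (j = 0 ∧ 2 * a + b = 2 ∨ j = 1 ∧ 2 * a + b = 1 ∨ j = 2 ∧ 2 * a + b = -1 ∨
        j = 3 ∧ 2 * a + b = -2 ∨ j = 4 ∧ 2 * a + b = -1 ∨ j = 5 ∧ 2 * a + b = 1) := by
    intro j hj
    interval_cases j
    · exact ⟨1, 0, by push_cast; ring, by norm_num, by norm_num⟩
    · exact ⟨0, 1, by push_cast; ring, by norm_num, by norm_num⟩
    · exact ⟨-1, 1, by push_cast; linear_combination hζ, by norm_num, by norm_num⟩
    · exact ⟨-1, 0, by push_cast; linear_combination h3, by norm_num, by norm_num⟩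
    · exact ⟨0, -1, by push_cast; linear_combination ζ * h3, by norm_num, by norm_num⟩
    · exact ⟨1, -1, by push_cast; linear_combination ζ ^ 2 * h3 - hζ, by norm_num, by norm_num⟩
  -- With t the trace of ζ^j, the norm of 1 - 2^k ζ^j is 1 - 2^k t + 4^k, which must be zero or a
  -- power of 2. For k = 0 this is 2 - t, and t = -1 is excluded since 3 is no power of 2. For k > 0
  -- the norm is odd, hence 1, so 2^k = t, which forces k = 1 and j = 0.
  have key : ∀ q : (liftRing hζ hz)ˣ, Fundamental q → ∀ (k j : ℕ), j < 6 →
      q.1.1.1 = 2 ^ k * ζ ^ j → k = 0 ∧ (j = 0 ∨ j = 1 ∨ j = 3 ∨ j = 5) ∨ k = 1 ∧ j = 0 := by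
    intro q hq k j hj e
    obtain ⟨a, b, e1, hab, ht⟩ := pow_form j hj
    have hN : (1 - 2 ^ k * a) ^ 2 + (1 - 2 ^ k * a) * (-(2 ^ k * b)) + (-(2 ^ k * b)) ^ 2 =
        1 - 2 ^ k * (2 * a + b) + (2 ^ k) ^ 2 := by
      linear_combination ((2 : ℤ) ^ k) ^ 2 * hab
    have e0 : (1 - q.1).1.1 = ((1 - 2 ^ k * a : ℤ) : ℂ) + ((-(2 ^ k * b) : ℤ) : ℂ) * ζ := by
      have : (1 - q.1).1.1 = 1 - q.1.1.1 := rfl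
      rw [this, e, e1]
      push_cast
      ring
    have hpow : 1 - 2 ^ k * (2 * a + b) + (2 ^ k) ^ 2 = (0 : ℤ) ∨
        ∃ s : ℕ, 1 - 2 ^ k * (2 * a + b) + (2 ^ k) ^ 2 = (2 : ℤ) ^ s := by
      rw [← hN]
      rcases hq with h0 | h0
      · left
        rw [h0] at e0
        obtain ⟨h1, h2⟩ := eq_zero_of_add_mul_eq_zero hζ e0.symm
        rw [h1, h2]
        norm_num
      · right
        obtain ⟨l, i, hi, e2⟩ := exists_eq_of_isUnit h0
        obtain ⟨c, d, e3, hcd, -⟩ := pow_form i hi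
        rw [e0, e3] at e2
        have hl : ∃ l₁ l₂ : ℕ, l = l₁ - l₂ := ⟨l.toNat, (-l).toNat, by omega⟩
        obtain ⟨l₁, l₂, rfl⟩ := hl
        rw [zpow_sub₀ two_ne_zero, zpow_natCast, zpow_natCast] at e2
        have e4 : ((2 ^ l₂ * (1 - 2 ^ k * a) - 2 ^ l₁ * c : ℤ) : ℂ) +
            ((2 ^ l₂ * (-(2 ^ k * b)) - 2 ^ l₁ * d : ℤ) : ℂ) * ζ = 0 := by
          field_simp at e2
          push_cast at e2 ⊢
          linear_combination e2
        obtain ⟨h1, h2⟩ := eq_zero_of_add_mul_eq_zero hζ e4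
        have hM : (2 : ℤ) ^ (2 * l₂) * ((1 - 2 ^ k * a) ^ 2 + (1 - 2 ^ k * a) * (-(2 ^ k * b)) +
            (-(2 ^ k * b)) ^ 2) = 2 ^ (2 * l₁) := by
          rw [pow_mul', pow_mul']
          have h1' : 2 ^ l₂ * (1 - 2 ^ k * a) = 2 ^ l₁ * c := by linarith
          have h2' : 2 ^ l₂ * (-(2 ^ k * b)) = 2 ^ l₁ * d := by linarith
          calc _ = (2 ^ l₂ * (1 - 2 ^ k * a)) ^ 2 + (2 ^ l₂ * (1 - 2 ^ k * a)) *
                (2 ^ l₂ * (-(2 ^ k * b))) + (2 ^ l₂ * (-(2 ^ k * b))) ^ 2 := by ring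
            _ = (2 ^ l₁) ^ 2 * (c ^ 2 + c * d + d ^ 2) := by rw [h1', h2']; ring
            _ = _ := by rw [hcd, mul_one]
        rw [hN] at hM ⊢
        have hpos : 0 ≤ 1 - 2 ^ k * (2 * a + b) + ((2 : ℤ) ^ k) ^ 2 := by
          rw [← hN]
          nlinarith [sq_nonneg (2 * (1 - 2 ^ k * a) + (-(2 ^ k * b))), sq_nonneg (2 ^ k * b)]
        obtain ⟨s, -, hs⟩ : ∃ s ≤ 2 * l₁,
            (1 - 2 ^ k * (2 * a + b) + ((2 : ℤ) ^ k) ^ 2).natAbs = 2 ^ s := by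
          refine (Nat.dvd_prime_pow Nat.prime_two).1 ?_
          have := Int.natAbs_dvd_natAbs.2 (Dvd.intro_left _ hM)
          simpa [Int.natAbs_pow] using this
        exact ⟨s, by rw [← Int.natAbs_of_nonneg hpos, hs]; push_cast; rfl⟩
    rcases Nat.eq_zero_or_pos k with rfl | hk
    · left
      refine ⟨rfl, ?_⟩
      rcases ht with ⟨rfl, ht⟩ | ⟨rfl, ht⟩ | ⟨rfl, ht⟩ | ⟨rfl, ht⟩ | ⟨rfl, ht⟩ | ⟨rfl, ht⟩ <;>
        simp [ht] at hpow ⊢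
      all_goals
        obtain ⟨s, hs⟩ := hpow
        rcases Nat.eq_zero_or_pos s with rfl | hs0
        · norm_num at hs
        · have : Even ((2 : ℤ) ^ s) := even_two.pow_of_ne_zero hs0.ne'
          rw [← hs] at this
          revert this
          decide
    · right
      obtain ⟨k, rfl⟩ : ∃ k', k = k' + 1 := ⟨k - 1, by omega⟩
      have hone : 1 - 2 ^ (k + 1) * (2 * a + b) + ((2 : ℤ) ^ (k + 1)) ^ 2 = 1 := by
        have hodd : ¬Even (1 - 2 ^ (k + 1) * (2 * a + b) + ((2 : ℤ) ^ (k + 1)) ^ 2) := by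
          have : 1 - 2 ^ (k + 1) * (2 * a + b) + ((2 : ℤ) ^ (k + 1)) ^ 2 =
              1 + 2 * (- 2 ^ k * (2 * a + b) + 2 ^ k * 2 ^ (k + 1)) := by ring
          rw [this, Int.not_even_iff_odd]
          exact odd_one.add_even (even_two_mul _)
        rcases hpow with h0 | ⟨s, hs⟩
        · exact absurd (h0 ▸ Even.zero) hodd
        · rcases Nat.eq_zero_or_pos s with rfl | hs0
          · simpa using hs
          · exact absurd (hs ▸ even_two.pow_of_ne_zero hs0.ne') hodd
      have hpos : (0 : ℤ) < 2 ^ k := by positivity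
      have h2 : (2 : ℤ) ^ (k + 1) = 2 * a + b := by
        have : (2 : ℤ) ^ (k + 1) * (2 ^ (k + 1) - (2 * a + b)) = 0 := by linear_combination hone
        rcases mul_eq_zero.1 this with h | h
        · exact absurd h (by positivity)
        · linarith
      rw [pow_succ] at h2
      rcases ht with ⟨rfl, ht⟩ | ⟨rfl, ht⟩ | ⟨rfl, ht⟩ | ⟨rfl, ht⟩ | ⟨rfl, ht⟩ | ⟨rfl, ht⟩ <;>
        rw [ht] at h2
      · have : (2 : ℤ) ^ k = 1 := by linarith
        have hk0 : k = 0 := by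
          by_contra hk0
          exact absurd this (one_lt_pow₀ (by norm_num) hk0).ne'
        exact ⟨by omega, rfl⟩
      all_goals omega
  obtain ⟨k, j, hj, e⟩ := exists_eq_of_isUnit p.isUnit
  have h0 := eisenstein_ne_zero hζ
  rcases le_or_gt 0 k with hk | hk
  · obtain ⟨k, rfl⟩ := Int.eq_ofNat_of_zero_le hk
    rw [zpow_natCast] at e
    rcases key p hp k j hj e with ⟨rfl, rfl | rfl | rfl | rfl⟩ | ⟨rfl, rfl⟩
    · left; simpa using e
    · iterate 4 right
      left; simpa using e
    · right; left; rw [e, h3]; norm_num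
    · iterate 5 right
      rw [e]; linear_combination ζ ^ 2 * h3 - hζ
    · right; right; left; simpa using e
  -- For a negative exponent of 2 the inverse is examined, which is fundamental as well.
  · obtain ⟨k', rfl⟩ : ∃ k' : ℕ, k = -k' := ⟨(-k).toNat, by omega⟩
    have hinv : p.1.1.1 * (p⁻¹).1.1.1 = 1 := congrArg (fun x : liftRing hζ hz => x.1.1) p.mul_inv
    have e' : (p⁻¹).1.1.1 = 2 ^ k' * ζ ^ ((6 - j) % 6) := by
      have hz6 : ζ ^ j * ζ ^ ((6 - j) % 6) = 1 := by
        rcases Nat.eq_zero_or_pos j with rfl | hj0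
        · simp
        · rw [Nat.mod_eq_of_lt (by omega), ← pow_add, Nat.add_sub_cancel' hj.le, pow_six_eq_one hζ]
      have : p.1.1.1 * (2 ^ k' * ζ ^ ((6 - j) % 6)) = 1 := by
        rw [e, zpow_neg, zpow_natCast]
        calc _ = ((2 : ℂ) ^ k')⁻¹ * 2 ^ k' * (ζ ^ j * ζ ^ ((6 - j) % 6)) := by ring
          _ = 1 := by rw [hz6, inv_mul_cancel₀ (pow_ne_zero k' two_ne_zero), one_mul]
      have hne : p.1.1.1 ≠ 0 := fun h => by rw [h, zero_mul] at hinv; exact zero_ne_one hinv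
      exact mul_left_cancel₀ hne (hinv.trans this.symm)
    rcases key p⁻¹ hp.inv k' _ (Nat.mod_lt _ (by norm_num)) e' with ⟨h, -⟩ | ⟨h, hj0⟩
    · omega
    · right; right; right; left
      subst h
      rw [hj0] at e'
      rw [e'] at hinv
      simp at hinv
      exact eq_inv_of_mul_eq_one_left hinv

/-- The homomorphism from `ℤ[1/2, ζ]` to `F` that maps `ζ` to `z`. -/
def liftHom (hζ : ζ ^ 2 = ζ - 1) (hz : z ^ 2 = z - 1) : liftRing hζ hz →+* F :=
  (RingHom.snd ℂ F).comp (liftRing hζ hz).subtype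

theorem isUnit_two (h2 : IsUnit (2 : F)) : IsUnit (2 : liftRing hζ hz) := by
  obtain ⟨h, hh⟩ := h2.exists_right_inv
  refine IsUnit.of_mul_eq_one ⟨_, half_mem hζ hz hh⟩ (Subtype.ext (Prod.ext ?_ ?_))
  · exact mul_inv_cancel₀ two_ne_zero
  · exact hh

theorem isUnit_gen : IsUnit (⟨_, gen_mem hζ hz⟩ : liftRing hζ hz) := by
  refine IsUnit.of_mul_eq_one (1 - ⟨_, gen_mem hζ hz⟩) (Subtype.ext (Prod.ext ?_ ?_))
  · change ζ * (1 - ζ) = 1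
    linear_combination -hζ
  · change z * (1 - z) = 1
    linear_combination -hz

end Eisenstein

/-! ### The homomorphism to `ZMod 3 × ZMod 7` -/

section Seven

theorem seven_root : ((2, 3) : ZMod 3 × ZMod 7) ^ 2 = (2, 3) - 1 := by decide

theorem isUnit_prod_iff {x : ZMod 3 × ZMod 7} : IsUnit x ↔ x.1 ≠ 0 ∧ x.2 ≠ 0 := by
  rw [Prod.isUnit_iff, isUnit_iff_ne_zero, isUnit_iff_ne_zero]

theorem zeroOrUnit_prod_iff {x : ZMod 3 × ZMod 7} :
    ZeroOrUnit x ↔ x = 0 ∨ x.1 ≠ 0 ∧ x.2 ≠ 0 := by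
  rw [ZeroOrUnit, isUnit_prod_iff]

theorem isUnit_two_prod : IsUnit (2 : ZMod 3 × ZMod 7) := isUnit_prod_iff.2 (by decide)

/-- The values match 1, -1, 2, 1/2, ζ, 1 - ζ, with `(2, 4)` the inverse of 2 and `(2, 3)` the image
of ζ. -/
theorem fundamental_prod_cases : ∀ x : ZMod 3 × ZMod 7, (x.1 ≠ 0 ∧ x.2 ≠ 0) →
    (1 - x = 0 ∨ (1 - x).1 ≠ 0 ∧ (1 - x).2 ≠ 0) →
    x = 1 ∨ x = -1 ∨ x = 2 ∨ x = (2, 4) ∨ x = (2, 3) ∨ x = 1 - (2, 3) := by decide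

/-- 2 has order 6 and -1 is not one of its powers, so all 12 units are obtained. Hence every unit
lifts. -/
theorem unit_prod_cases : ∀ x : ZMod 3 × ZMod 7, (x.1 ≠ 0 ∧ x.2 ≠ 0) →
    ∃ k : Fin 6, x = 2 ^ (k : ℕ) ∨ x = -2 ^ (k : ℕ) := by decide

theorem fundamental_prod {p : (ZMod 3 × ZMod 7)ˣ} (hp : Fundamental p) :
    (p : ZMod 3 × ZMod 7) = 1 ∨ (p : ZMod 3 × ZMod 7) = -1 ∨ (p : ZMod 3 × ZMod 7) = 2 ∨
      (p : ZMod 3 × ZMod 7) = (2, 4) ∨ (p : ZMod 3 × ZMod 7) = (2, 3) ∨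
      (p : ZMod 3 × ZMod 7) = 1 - (2, 3) :=
  fundamental_prod_cases _ (isUnit_prod_iff.1 p.isUnit) (zeroOrUnit_prod_iff.1 hp)

variable {ζ : ℂ} (hζ : ζ ^ 2 = ζ - 1)

theorem fundamental_lift_cases {p : (liftRing hζ seven_root)ˣ} (hp : Fundamental p) :
    p.1.1 = 1 ∨ p.1.1 = -1 ∨ p.1.1 = 2 ∨ p.1.1 = (2⁻¹, (2, 4)) ∨ p.1.1 = (ζ, (2, 3)) ∨
      p.1.1 = 1 - (ζ, (2, 3)) := by
  have key : ∀ y ∈ liftRing hζ seven_root, p.1.1.1 = y.1 → p.1.1 = y := fun y hy h =>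
    Prod.ext h (liftRing_snd_unique isUnit_two_prod (x := y.1) (by rw [← h]; exact p.1.2) hy)
  rcases fst_of_fundamental hp with h | h | h | h | h | h
  · exact Or.inl (key 1 (one_mem _) h)
  · exact Or.inr (Or.inl (key (-1) (neg_mem (one_mem _)) h))
  · exact Or.inr (Or.inr (Or.inl (key 2 (2 : liftRing hζ seven_root).2 h)))
  · exact Or.inr (Or.inr (Or.inr (Or.inl (key _ (half_mem hζ seven_root (by decide)) h))))
  · exact Or.inr (Or.inr (Or.inr (Or.inr (Or.inl (key _ (gen_mem hζ seven_root) h)))))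
  · exact Or.inr (Or.inr (Or.inr (Or.inr (Or.inr
      (key _ (sub_mem (one_mem _) (gen_mem hζ seven_root)) h)))))

/-- The six fundamental elements upstairs have six distinct images, which are all the fundamental
elements downstairs; the conditions on products and negatives are finite checks. -/
theorem isLifting_seven : IsLifting (liftHom hζ seven_root) where
  inj p q hp hq h := by
    have h' : p.1.1.2 = q.1.1.2 := congrArg Units.val h
    refine Units.ext (Subtype.ext ?_)
    rcases fundamental_lift_cases hζ hp with e | e | e | e | e | e <;>
      rcases fundamental_lift_cases hζ hq with e' | e' | e' | e' | e' | e' <;>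
      first
        | exact e.trans e'.symm
        | (exfalso; rw [e, e'] at h'; try simp only [Prod.snd_sub, Prod.snd_one] at h'
           revert h'; decide)
  exists_unit a := by
    have h2 : IsUnit (2 : liftRing hζ seven_root) := isUnit_two isUnit_two_prod
    obtain ⟨t, ht⟩ := h2
    have ht2 : t.1.1.2 = 2 := by rw [ht]; rfl
    obtain ⟨k, hk | hk⟩ := unit_prod_cases _ (isUnit_prod_iff.1 a.isUnit)
    · refine ⟨t ^ (k : ℕ), Units.ext ?_⟩
      rw [hk, ← ht2]
      rfl
    · refine ⟨-t ^ (k : ℕ), Units.ext ?_⟩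
      rw [hk, ← ht2]
      rfl
  exists_fundamental p hp := by
    have aux : ∀ x : liftRing hζ seven_root, IsUnit x → ZeroOrUnit (1 - x) → p.1 = x.1.2 →
        ∃ q : (liftRing hζ seven_root)ˣ, Fundamental q ∧
          Units.map (liftHom hζ seven_root : _ →* ZMod 3 × ZMod 7) q = p := by
      rintro _ ⟨q, rfl⟩ hx h
      exact ⟨q, hx, Units.ext h.symm⟩
    have h2 : IsUnit (2 : liftRing hζ seven_root) := isUnit_two isUnit_two_prod
    have hg : IsUnit (⟨_, gen_mem hζ seven_root⟩ : liftRing hζ seven_root) := isUnit_gen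
    have hh : 2 * (⟨_, half_mem hζ seven_root (h := (2, 4)) (by decide)⟩ : liftRing hζ seven_root) = 1 :=
      Subtype.ext (Prod.ext (mul_inv_cancel₀ two_ne_zero)
        (by change (2 : ZMod 3 × ZMod 7) * (2, 4) = 1; decide))
    have hg' : IsUnit (1 - ⟨_, gen_mem hζ seven_root⟩ : liftRing hζ seven_root) := by
      refine IsUnit.of_mul_eq_one ⟨_, gen_mem hζ seven_root⟩ (Subtype.ext (Prod.ext ?_ ?_))
      · change (1 - ζ) * ζ = 1
        linear_combination -hζ
      · change (1 - (2, 3)) * (2, 3) = (1 : ZMod 3 × ZMod 7)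
        decide
    rcases fundamental_prod hp with h | h | h | h | h | h
    · exact aux 1 isUnit_one (Or.inl (sub_self _)) h
    · exact aux (-1) isUnit_one.neg (Or.inr ((show (2 : liftRing hζ seven_root) = 1 - -1 by ring) ▸ h2)) h
    · exact aux 2 h2 (Or.inr ((show (-1 : liftRing hζ seven_root) = 1 - 2 by ring) ▸ isUnit_one.neg)) h
    · refine aux _ (IsUnit.of_mul_eq_one _ ((mul_comm _ _).trans hh)) (Or.inr ?_) h
      refine IsUnit.of_mul_eq_one 2 ?_
      linear_combination -hh
    · exact aux _ hg (Or.inr hg') h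
    · exact aux _ hg' (Or.inr (by rw [sub_sub_cancel]; exact hg)) h
  mul p q hp hq h := by
    have key : ∀ p q : ZMod 3 × ZMod 7, p.1 ≠ 0 → q.1 ≠ 0 →
      (p = 1 ∨ p = -1 ∨ p = 2 ∨ p = (2, 4) ∨ p = (2, 3) ∨ p = 1 - (2, 3)) →
      (q = 1 ∨ q = -1 ∨ q = 2 ∨ q = (2, 4) ∨ q = (2, 3) ∨ q = 1 - (2, 3)) →
      (p * q = 1 ∨ p * q = -1 ∨ p * q = 2 ∨ p * q = (2, 4) ∨ p * q = (2, 3) ∨ p * q = 1 - (2, 3)) →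
      p = 1 ∨ q = 1 ∨ p * q = 1 := by
      intro p q _ _ h1 h2 h3
      rcases h1 with rfl | rfl | rfl | rfl | rfl | rfl <;>
        rcases h2 with rfl | rfl | rfl | rfl | rfl | rfl <;> revert h3 <;> decide
    simp only [Units.ext_iff]
    exact key p q (isUnit_prod_iff.1 p.isUnit).1 (isUnit_prod_iff.1 q.isUnit).1 (fundamental_prod hp)
      (fundamental_prod hq) (fundamental_prod h)
  neg p hp h := by
    have h1 := fundamental_prod hp
    have h2 := fundamental_prod h
    simp only [Units.ext_iff, Units.val_neg, Units.val_one] at h2 ⊢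
    generalize (p : ZMod 3 × ZMod 7) = x at *
    rcases h1 with rfl | rfl | rfl | rfl | rfl | rfl <;> revert h2 <;> decide
  two := Or.inr (isUnit_two isUnit_two_prod)

end Seven

end UnitLift

namespace PartialField

/-! ### Sums in a partial field -/

section General

variable {P : Type u} [PartialField P]

theorem pneg_eq_mul (p : P) : pneg p = p * pneg 1 := by
  refine (eq_pneg _ _ ?_).symm
  simpa using mul_padd p 1 (pneg 1) 0 (padd_pneg 1)

theorem pneg_pneg (p : P) : pneg (pneg p) = p :=
  (eq_pneg _ _ (padd_comm _ _ _ (padd_pneg p))).symm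

theorem hasAssociation_pneg {S : Multiset P} {r : P} (h : HasAssociation padd S r) :
    HasAssociation padd (S.map pneg) (pneg r) := by
  refine HasAssociation_map pneg (fun p q r hr => ?_) h
  rw [pneg_eq_mul p, pneg_eq_mul q, pneg_eq_mul r, mul_comm p, mul_comm q, mul_comm r]
  exact mul_padd _ _ _ _ hr

/-- The sum of `S` is defined and zero. -/
abbrev IsNull (S : Multiset P) : Prop := IsSum S 0

theorem IsNull.add {S T : Multiset P} (hS : IsNull S) (hT : IsNull T) : IsNull (S + T) := by
  obtain ⟨Z, hZ⟩ := hS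
  obtain ⟨Z', hZ'⟩ := hT
  refine ⟨Z + Z', ?_⟩
  have := HasAssociation.node _ _ _ _ _ hZ hZ' (padd_zero 0)
  convert this using 1
  rw [Multiset.map_add]
  abel

theorem isNull_pair (p : P) : IsNull {p, pneg p} :=
  by
  refine ⟨0, ?_⟩
  convert HasAssociation.node _ _ _ _ _ (HasAssociation.leaf p)
    (HasAssociation.leaf (pneg p)) (padd_pneg p) using 1
  simp [← Multiset.singleton_add]

theorem isNull_zero : IsNull (0 : Multiset P) :=
  by
  refine ⟨{0}, ?_⟩
  convert HasAssociation.node _ _ _ _ _ (HasAssociation.leaf (0 : P))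
    (HasAssociation.leaf (pneg 0)) (padd_pneg 0) using 1
  simp

theorem isNull_pairs (Z : Multiset P) : IsNull (Z + Z.map pneg) := by
  induction Z using Multiset.induction_on with
  | empty => simpa using isNull_zero
  | cons a Z ih =>
    convert (isNull_pair a).add ih using 1
    rw [Multiset.map_cons, Multiset.insert_eq_cons, ← Multiset.singleton_add, ← Multiset.singleton_add,
      ← Multiset.singleton_add]
    abel

theorem IsNull.of_pairs {S Z : Multiset P} (h : IsNull (S + (Z + Z.map pneg))) : IsNull S := by
  obtain ⟨Z', hZ'⟩ := h
  refine ⟨Z + Z', ?_⟩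
  convert hZ' using 1
  rw [Multiset.map_add]
  abel

theorem IsNull.pneg {S : Multiset P} (h : IsNull S) : IsNull (S.map pneg) := by
  obtain ⟨Z, hZ⟩ := h
  refine ⟨Z.map PartialField.pneg, ?_⟩
  have := hasAssociation_pneg hZ
  rw [pneg_eq_mul 0, zero_mul] at this
  simpa using this

theorem isNull_of_padd {a b c : P} (h : c ∈ padd a b) : IsNull {a, b, PartialField.pneg c} := by
  refine ⟨0, ?_⟩
  have := HasAssociation.node _ _ _ _ _ (HasAssociation.node _ _ _ _ _ (HasAssociation.leaf a)
    (HasAssociation.leaf b) h) (HasAssociation.leaf (PartialField.pneg c)) (padd_pneg c)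
  convert this using 1
  simp [← Multiset.singleton_add, add_assoc]

/-- Adding `r` at the root turns 0 into `r`, and the pair `r`, `pneg r` is absorbed into the
cancelling pairs. -/
theorem IsNull.isSum {S : Multiset P} {r : P} (h : IsNull (S + {PartialField.pneg r})) :
    IsSum S r := by
  obtain ⟨Z, hZ⟩ := h
  refine ⟨{r} + Z, ?_⟩
  have := HasAssociation.node _ _ _ _ _ hZ (HasAssociation.leaf r) (padd_comm _ _ _ (padd_zero r))
  convert this using 1
  simp only [Multiset.map_add, Multiset.map_singleton]
  abel

theorem hasAssociation_pairs {Z : Multiset P} (hZ : Z ≠ 0) :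
    HasAssociation padd (Z + Z.map PartialField.pneg) 0 := by
  induction Z using Multiset.induction_on with
  | empty => exact absurd rfl hZ
  | cons a Z ih =>
    have h1 := HasAssociation.node _ _ _ _ _ (HasAssociation.leaf a)
      (HasAssociation.leaf (PartialField.pneg a)) (padd_pneg a)
    by_cases h0 : Z = 0
    · subst h0
      convert h1 using 1
      simp [← Multiset.singleton_add]
    · convert HasAssociation.node _ _ _ _ _ h1 (ih h0) (padd_zero 0) using 1
      rw [Multiset.map_cons, ← Multiset.singleton_add, ← Multiset.singleton_add]
      abel

/-- The empty multiset has no association, so a nonempty set of pairs is arranged by adding 0 and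
its negative. -/
theorem IsSum.exists_ne_zero {S : Multiset P} {r : P} (h : IsSum S r) :
    ∃ Z ≠ 0, HasAssociation padd (S + (Z + Z.map PartialField.pneg)) r := by
  obtain ⟨Z, hZ⟩ := h
  refine ⟨Z + {0}, by simp, ?_⟩
  convert HasAssociation.node _ _ _ _ _ hZ
    (hasAssociation_pairs (Multiset.singleton_ne_zero (0 : P))) (padd_zero r) using 1
  rw [Multiset.map_add]
  abel

/-- Extending each association by the cancelling pairs of the other gives the same leaves, and the
associative law compares the roots. -/
theorem IsSum.unique {S : Multiset P} {r r' : P} (h : IsSum S r) (h' : IsSum S r') : r = r' := by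
  obtain ⟨Z, hZ, hr⟩ := h.exists_ne_zero
  obtain ⟨Z', hZ', hr'⟩ := h'.exists_ne_zero
  have := assoc_law _ _ (HasAssociation.node _ _ _ _ _ hr (hasAssociation_pairs hZ') (padd_zero r))
    _ _ _ _ (add_right_comm _ _ _) hr' (hasAssociation_pairs hZ)
  exact Part.mem_unique this (padd_zero r')

variable (P) in
/-- Two multisets are congruent if their formal difference has sum zero. -/
def sumCon : AddCon (Multiset P) where
  r S T := IsNull (S + T.map PartialField.pneg)
  iseqv :=
    { refl := isNull_pairs
      symm := by
        intro S T h
        have := h.pneg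
        rw [Multiset.map_add, Multiset.map_map] at this
        simpa [Function.comp_def, pneg_pneg, add_comm] using this
      trans := by
        intro S T U h1 h2
        refine IsNull.of_pairs (Z := T) ?_
        convert h1.add h2 using 1
        abel }
  add' := by
    intro S T U V h1 h2
    convert h1.add h2 using 1
    rw [Multiset.map_add]
    abel

/-- An abelian group that detects which sums are defined. -/
theorem exists_addCommGroup : ∃ (Γ : Type u) (_ : AddCommGroup Γ) (c : P → Γ),
    (∀ p q r, r ∈ padd p q → c r = c p + c q) ∧
      ∀ (S : Multiset P) (r : P), (S.map c).sum = c r → IsSum S r := by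
  -- The quotient is a commutative monoid in which the class of `p` is invertible with inverse the
  -- class of `pneg p`; its additive units form the group.
  let C := (sumCon P).Quotient
  have hC : ∀ p : P, ((({p} : Multiset P) : C) + (({pneg p} : Multiset P) : C)) = 0 := by
    intro p
    rw [← AddCon.coe_add, ← AddCon.coe_zero, AddCon.eq]
    simpa [sumCon] using isNull_pair p
  let c : P → AddUnits C := fun p => ⟨(({p} : Multiset P) : C), (({pneg p} : Multiset P) : C), hC p,
    (add_comm _ _).trans (hC p)⟩
  refine ⟨AddUnits C, inferInstance, c, ?_, ?_⟩
  · intro p q r h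
    refine AddUnits.ext ((AddCon.eq (sumCon P)).2 ?_ : (({r} : Multiset P) : C) = ({p} + {q} : Multiset P))
    refine (sumCon P).symm ?_
    exact isNull_of_padd h
  · intro S r h
    have key : ∀ S : Multiset P, ((S.map c).sum : AddUnits C) = ((S : Multiset P) : C) := by
      intro S
      induction S using Multiset.induction_on with
      | empty => rfl
      | cons a S ih =>
        rw [Multiset.map_cons, Multiset.sum_cons, AddUnits.val_add, ih, ← Multiset.singleton_add]
        rfl
    have h' : ((S : Multiset P) : C) = (({r} : Multiset P) : C) := by
      rw [← key, h]
    exact IsNull.isSum ((AddCon.eq (sumCon P)).1 h')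

end General

/-! ### Representability under homomorphisms and products -/

section Transfer

variable {P : Type u} {Q : Type v} [PartialField P] [PartialField Q]

theorem map_pneg_of_hom (φ : P →*₀ Q) (h : ∀ p q r, r ∈ padd p q → φ r ∈ padd (φ p) (φ q)) (p : P) :
    φ (pneg p) = pneg (φ p) := by
  refine eq_pneg _ _ ?_
  rw [← map_zero φ]
  exact h _ _ _ (padd_pneg p)

theorem IsSum.map_hom (φ : P →*₀ Q) (h : ∀ p q r, r ∈ padd p q → φ r ∈ padd (φ p) (φ q))
    {S : Multiset P} {r : P} (hS : IsSum S r) : IsSum (S.map φ) (φ r) := by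
  obtain ⟨Z, hZ⟩ := hS
  refine ⟨Z.map φ, ?_⟩
  convert HasAssociation_map φ h hZ using 1
  simp [Multiset.map_add, Multiset.map_map, map_pneg_of_hom φ h]

theorem detTerms_map (φ : P →*₀ Q) (h : ∀ p q r, r ∈ padd p q → φ r ∈ padd (φ p) (φ q))
    {n : Type*} [Fintype n] [DecidableEq n] (A : Matrix n n P) :
    detTerms (A.map φ) = (detTerms A).map φ := by
  rw [detTerms, detTerms, Multiset.map_map]
  refine Multiset.map_congr rfl fun σ _ => ?_
  simp only [Function.comp_apply, Matrix.map_apply]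
  split_ifs
  · rw [map_prod]
  · rw [map_pneg_of_hom φ h, map_prod]

/-- Homomorphisms of partial fields preserve representability. -/
theorem Representable.map_hom (φ : P →*₀ Q)
    (h : ∀ p q r, r ∈ padd p q → φ r ∈ padd (φ p) (φ q)) {α : Type w} {M : Matroid α}
    (hM : Representable P M) : Representable Q M := by
  obtain ⟨r, A, hA, hB⟩ := hM
  have hdet : ∀ {k : ℕ} (f : Fin k → Fin r) (g : Fin k → M.E) {d : P}, HasDet (A.submatrix f g) d →
      HasDet ((A.map φ).submatrix f g) (φ d) := by
    intro k f g d hd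
    rw [HasDet, Matrix.submatrix_map, detTerms_map φ h]
    exact IsSum.map_hom φ h hd
  refine ⟨r, A.map φ, ?_, ?_⟩
  · intro k f g
    obtain ⟨d, hd⟩ := hA k f g
    exact ⟨φ d, hdet f g hd⟩
  · intro B
    rw [hB]
    refine exists_congr fun g => and_congr_right fun _ => ?_
    constructor
    · rintro ⟨d, hd, hne⟩
      exact ⟨φ d, hdet id g hd, (map_ne_zero φ).2 hne⟩
    · rintro ⟨d', hd', hne⟩
      obtain ⟨d, hd⟩ := hA r (Function.Embedding.refl _) g
      refine ⟨d, hd, fun h0 => hne ?_⟩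
      rw [IsSum.unique hd' (hdet id g hd), h0, map_zero]

/-- The homomorphism into a direct product with given components. -/
def prodHom {P₁ P₂ : Type*} [PartialField P₁] [PartialField P₂] (φ₁ : P →*₀ P₁) (φ₂ : P →*₀ P₂) :
    P →*₀ DirectProduct P₁ P₂ where
  toFun p := ⟨(φ₁ p, φ₂ p), by simp only [map_ne_zero]⟩
  map_zero' := DirectProduct.ext' (map_zero φ₁) (map_zero φ₂)
  map_one' := DirectProduct.ext' (map_one φ₁) (map_one φ₂)
  map_mul' p q := DirectProduct.ext' (map_mul φ₁ p q) (map_mul φ₂ p q)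

theorem Representable.directProduct {P₁ : Type*} {P₂ : Type*} [PartialField P₁] [PartialField P₂]
    {φ₁ : P →*₀ P₁} {φ₂ : P →*₀ P₂} (h₁ : ∀ p q r, r ∈ padd p q → φ₁ r ∈ padd (φ₁ p) (φ₁ q))
    (h₂ : ∀ p q r, r ∈ padd p q → φ₂ r ∈ padd (φ₂ p) (φ₂ q)) {α : Type w} {M : Matroid α}
    (hM : Representable P M) : Representable (DirectProduct P₁ P₂) M :=
  hM.map_hom (prodHom φ₁ φ₂) fun p q r h => DirectProduct.mem_add.2 ⟨h₁ p q r h, h₂ p q r h⟩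

variable {P₁ : Type u} {P₂ : Type v} [PartialField P₁] [PartialField P₂]

theorem Representable.fst {α : Type w} {M : Matroid α}
    (hM : Representable (DirectProduct P₁ P₂) M) : Representable P₁ M :=
  hM.map_hom
    { toFun := fun p => p.1.1
      map_zero' := rfl
      map_one' := rfl
      map_mul' := fun _ _ => rfl } fun _ _ _ h => (DirectProduct.mem_add.1 h).1

theorem Representable.snd {α : Type w} {M : Matroid α}
    (hM : Representable (DirectProduct P₁ P₂) M) : Representable P₂ M :=
  hM.map_hom
    { toFun := fun p => p.1.2
      map_zero' := rfl
      map_one' := rfl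
      map_mul' := fun _ _ => rfl } fun _ _ _ h => (DirectProduct.mem_add.1 h).2

end Transfer

/-! ### Determinants over partial fields and over fields -/

section Determinants

variable {P : Type u} [PartialField P] {R : Type v} [CommRing R]

theorem isSum_sum (i : P → R) (hadd : ∀ p q r, r ∈ padd p q → i r = i p + i q)
    (hneg : ∀ p, i (pneg p) = -i p) {S : Multiset P} {r : P} (h : IsSum S r) :
    i r = (S.map i).sum := by
  obtain ⟨Z, hZ⟩ := h
  rw [HasAssociation_sum i hadd hZ]
  simp [Multiset.map_map, hneg]

theorem sum_detTerms (i : P →* R) (hneg : ∀ p, i (pneg p) = -i p) {n : Type*} [Fintype n]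
    [DecidableEq n] (A : Matrix n n P) : ((detTerms A).map i).sum = (A.map i).det := by
  -- In `detTerms` the permutation acts on columns, in `Matrix.det_apply` on rows.
  rw [detTerms, Multiset.map_map, ← Matrix.det_transpose, Matrix.det_apply]
  refine congrArg Multiset.sum (Multiset.map_congr rfl fun σ _ => ?_)
  simp only [Function.comp_apply, Matrix.transpose_apply, Matrix.map_apply]
  rcases Int.units_eq_one_or (Equiv.Perm.sign σ) with h | h
  · simp [h]
  · rw [if_neg (by rw [h]; decide), hneg, h, map_prod]
    simp

variable {F : Type u} [Field F]

theorem hasAssociation_field {S : Multiset F} (hS : S ≠ 0) :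
    HasAssociation (padd (P := F)) S S.sum := by
  induction S using Multiset.induction_on with
  | empty => exact absurd rfl hS
  | cons a S ih =>
    by_cases h0 : S = 0
    · subst h0
      simpa using HasAssociation.leaf (padd := padd (P := F)) a
    · rw [Multiset.sum_cons, ← Multiset.singleton_add]
      exact HasAssociation.node _ _ _ _ _ (HasAssociation.leaf a) (ih h0) (Part.mem_some _)

theorem hasDet_field {n : Type*} [Fintype n] [DecidableEq n] {A : Matrix n n F} {d : F} :
    HasDet A d ↔ d = A.det := by
  have hsum : (detTerms A).sum = A.det := by
    have := sum_detTerms (MonoidHom.id F) (fun _ => rfl) A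
    simpa using this
  have h0 : HasDet A A.det := by
    refine ⟨0, ?_⟩
    rw [← hsum]
    simpa using hasAssociation_field (S := detTerms A) (by simp [detTerms, Finset.univ_eq_empty_iff])
  exact ⟨fun h => IsSum.unique h h0, fun h => h ▸ h0⟩

theorem Represents.isBase_iff {α : Type v} {r : ℕ} {M : Matroid α} {A : Matrix (Fin r) M.E F}
    (h : Represents A) (B : Set α) : M.IsBase B ↔
      ∃ g : Fin r ↪ M.E, Set.range (fun i => (g i : α)) = B ∧ (A.submatrix id g).det ≠ 0 := by
  rw [h.2]
  simp [hasDet_field]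

/-- A representation over a field can be brought into standard form with respect to a base. -/
theorem Represents.exists_standard {α : Type v} {r : ℕ} {M : Matroid α} {A : Matrix (Fin r) M.E F}
    (h : Represents A) {g : Fin r ↪ M.E} (hg : M.IsBase (Set.range fun i => (g i : α))) :
    ∃ N : Matrix (Fin r) M.E F, N.submatrix id g = 1 ∧
      ∀ f : Fin r ↪ M.E, (N.submatrix id f).det ≠ 0 ↔ M.IsBase (Set.range fun i => (f i : α)) := by
  have key : ∀ f : Fin r ↪ M.E,
      (A.submatrix id f).det ≠ 0 ↔ M.IsBase (Set.range fun i => (f i : α)) := by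
    intro f
    rw [h.isBase_iff]
    refine ⟨fun hf => ⟨f, rfl, hf⟩, ?_⟩
    rintro ⟨f', hf', hne⟩ h0
    have hr : Set.range f' = Set.range f := by
      apply Set.image_injective.2 Subtype.val_injective
      rw [← Set.range_comp, ← Set.range_comp]
      exact hf'
    -- Two enumerations of the same column set differ by a permutation, so the determinants agree up
    -- to sign.
    let σ : Equiv.Perm (Fin r) := (Equiv.ofInjective f' f'.injective).trans
      ((Equiv.setCongr hr).trans (Equiv.ofInjective f f.injective).symm)
    have hσ : ∀ i, f (σ i) = f' i := fun i => by
      simp only [σ, Equiv.trans_apply, Equiv.apply_ofInjective_symm]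
      rfl
    refine hne ?_
    have : A.submatrix id f' = (A.submatrix id f).submatrix id σ := by
      ext i j
      simp [hσ]
    rw [this, Matrix.det_permute', h0, mul_zero]
  have hu : IsUnit (A.submatrix id g).det := ((key g).2 hg).isUnit
  refine ⟨(A.submatrix id g)⁻¹ * A, ?_, fun f => ?_⟩
  · rw [← Matrix.nonsing_inv_mul _ hu]
    rfl
  · have : ((A.submatrix id g)⁻¹ * A).submatrix id f = (A.submatrix id g)⁻¹ * A.submatrix id f := rfl
    rw [this, Matrix.det_mul, ← key, mul_ne_zero_iff]
    have hi : (A.submatrix id g)⁻¹.det ≠ 0 := by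
      have := Matrix.det_nonsing_inv_mul_det _ hu
      exact left_ne_zero_of_mul_eq_one this
    exact and_iff_right hi

end Determinants

open UnitLift

/-! ### The partial field P(ℂ, {2, ζ}) -/

section Sixth

variable {ζ : ℂ}

theorem sq_eq_sub_one (h : IsPrimitiveRoot ζ 6) : ζ ^ 2 = ζ - 1 := by
  have h3 : ζ ^ 3 ≠ 1 := h.pow_ne_one_of_pos_of_lt (by norm_num) (by norm_num)
  have h2 : ζ ^ 2 ≠ 1 := h.pow_ne_one_of_pos_of_lt (by norm_num) (by norm_num)
  have h6 : (ζ ^ 3 - 1) * ((ζ + 1) * (ζ ^ 2 - ζ + 1)) = 0 := by linear_combination h.pow_eq_one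
  rcases mul_eq_zero.1 h6 with h' | h'
  · exact absurd (sub_eq_zero.1 h') h3
  rcases mul_eq_zero.1 h' with h' | h'
  · exact absurd (by linear_combination (ζ - 1) * h') h2
  · linear_combination h'

/-- The partial field `P(ℂ, {2, ζ})`. -/
abbrev SixthTwo (ζ : ℂ) : Type := OfRing ℂ {g : ℂˣ | (g : ℂ) = 2 ∨ (g : ℂ) = ζ}

namespace SixthTwo

variable {F : Type u} [CommRing F] {z : F}

/-- The generators 2, ζ, -1 are first coordinates of units of `liftRing`; this yields both the
normal form of elements and the homomorphisms to fields. -/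
theorem exists_unit_of_mem_closure (hζ : ζ ^ 2 = ζ - 1) (hz : z ^ 2 = z - 1) (h2 : IsUnit (2 : F)) {g : ℂˣ}
    (hg : g ∈ Subgroup.closure ({g : ℂˣ | (g : ℂ) = 2 ∨ (g : ℂ) = ζ} ∪ {-1})) :
    ∃ p : (liftRing hζ hz)ˣ, p.1.1.1 = g := by
  induction hg using Subgroup.closure_induction with
  | mem x hx =>
    rcases hx with (hx | hx) | hx
    · obtain ⟨p, hp⟩ := isUnit_two (hζ := hζ) (hz := hz) h2
      exact ⟨p, by rw [hp, hx]; rfl⟩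
    · obtain ⟨p, hp⟩ := isUnit_gen (hζ := hζ) (hz := hz)
      exact ⟨p, by rw [hp, hx]⟩
    · rw [Set.mem_singleton_iff] at hx
      exact ⟨-1, by rw [hx]; rfl⟩
  | one => exact ⟨1, rfl⟩
  | mul x y _ _ hx hy =>
    obtain ⟨p, hp⟩ := hx
    obtain ⟨q, hq⟩ := hy
    exact ⟨p * q, by rw [Units.val_mul x, ← hp, ← hq]; rfl⟩
  | inv x _ hx =>
    obtain ⟨p, hp⟩ := hx
    refine ⟨p⁻¹, ?_⟩
    have hinv : p.1.1.1 * (p⁻¹).1.1.1 = 1 := congrArg (fun x : liftRing hζ hz => x.1.1) p.mul_inv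
    rw [hp] at hinv
    rw [Units.val_inv_eq_inv_val]
    exact eq_inv_of_mul_eq_one_right hinv

theorem exists_eq_of_mem_closure (hζ : ζ ^ 2 = ζ - 1) {g : ℂˣ}
    (hg : g ∈ Subgroup.closure ({g : ℂˣ | (g : ℂ) = 2 ∨ (g : ℂ) = ζ} ∪ {-1})) :
    ∃ (k : ℤ) (j : ℕ), (g : ℂ) = 2 ^ k * ζ ^ j := by
  -- Only the first coordinate matters here; `ZMod 3 × ZMod 7` serves as an auxiliary ring in which
  -- 2 is invertible.
  obtain ⟨p, hp⟩ := exists_unit_of_mem_closure hζ seven_root isUnit_two_prod hg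
  obtain ⟨k, j, -, h⟩ := exists_eq_of_isUnit p.isUnit
  exact ⟨k, j, hp ▸ h⟩

theorem mem (hζ : ζ ^ 2 = ζ - 1) (k : ℤ) (j : ℕ) : (2 ^ k * ζ ^ j : ℂ) = 0 ∨
    ∃ g ∈ Subgroup.closure ({g : ℂˣ | (g : ℂ) = 2 ∨ (g : ℂ) = ζ} ∪ {-1}),
      (g : ℂ) = 2 ^ k * ζ ^ j := by
  have h0 := eisenstein_ne_zero hζ
  refine Or.inr ⟨Units.mk0 2 two_ne_zero ^ k * Units.mk0 ζ h0 ^ j, ?_, by simp⟩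
  refine mul_mem (zpow_mem (Subgroup.subset_closure ?_) _) (pow_mem (Subgroup.subset_closure ?_) _)
  · exact Or.inl (Or.inl rfl)
  · exact Or.inl (Or.inr rfl)

/-- The element `2 ^ k * ζ ^ j`. -/
noncomputable def elem (hζ : ζ ^ 2 = ζ - 1) (k : ℤ) (j : ℕ) : SixthTwo ζ := ⟨2 ^ k * ζ ^ j, mem hζ k j⟩

theorem eq_zero_or_elem (hζ : ζ ^ 2 = ζ - 1) (x : SixthTwo ζ) : x = 0 ∨ ∃ k j, x = elem hζ k j := by
  rcases x.2 with h | ⟨g, hg, h⟩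
  · exact Or.inl (Subtype.ext (h : x.1 = (0 : SixthTwo ζ).1))
  · obtain ⟨k, j, e⟩ := exists_eq_of_mem_closure hζ hg
    exact Or.inr ⟨k, j, Subtype.ext (h.symm.trans e)⟩

/-- The inclusion into the complex numbers. -/
def val : SixthTwo ζ →* ℂ where
  toFun := Subtype.val
  map_one' := rfl
  map_mul' _ _ := rfl

theorem mem_padd {p q r : SixthTwo ζ} (h : r.1 = p.1 + q.1) : r ∈ padd p q :=
  ⟨by change p.1 + q.1 = 0 ∨ _; have := r.2; rw [h] at this; exact this, Subtype.ext h.symm⟩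

theorem val_add {p q r : SixthTwo ζ} (h : r ∈ padd p q) : r.1 = p.1 + q.1 := by
  obtain ⟨_, rfl⟩ := h
  rfl

/-- A multiset whose sum in `ℂ` is an element `r` has sum `r` in the partial field. -/
theorem isSum_of_sum_eq (hζ : ζ ^ 2 = ζ - 1) {S : Multiset (SixthTwo ζ)} {r : SixthTwo ζ}
    (h : (S.map val).sum = r.1) : IsSum S r := by
  -- The relations x + x = 2x and ζ^(j+2) + ζ^j = ζ^(j+1) are defined sums, so they hold in `Γ`.
  -- They suffice to write each `c x` over a common denominator with the same integer coordinates as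
  -- in ℂ.
  obtain ⟨Γ, _, c, hadd, hc⟩ := exists_addCommGroup (P := SixthTwo ζ)
  have h0 : c 0 = 0 := by simpa using hadd 0 0 0 (padd_zero 0)
  have hdouble : ∀ k j, c (elem hζ (k + 1) j) = 2 • c (elem hζ k j) := by
    intro k j
    rw [two_nsmul]
    refine hadd _ _ _ (mem_padd ?_)
    change (2 : ℂ) ^ (k + 1) * ζ ^ j = 2 ^ k * ζ ^ j + 2 ^ k * ζ ^ j
    rw [zpow_add_one₀ two_ne_zero]
    ring
  have hpow : ∀ (k : ℤ) (t j : ℕ), c (elem hζ (k + t) j) = 2 ^ t • c (elem hζ k j) := by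
    intro k t j
    induction t with
    | zero => simp
    | succ t ih => rw [Nat.cast_succ, ← add_assoc, hdouble, ih, pow_succ', mul_nsmul']
  have hζj : ∀ j : ℕ, ∃ a b : ℤ, ζ ^ j = a + b * ζ ∧
      ∀ k, c (elem hζ k j) = a • c (elem hζ k 0) + b • c (elem hζ k 1) := by
    intro j
    induction j using Nat.strong_induction_on with
    | _ j ih =>
      match j, ih with
      | 0, _ => exact ⟨1, 0, by simp, by simp⟩
      | 1, _ => exact ⟨0, 1, by simp, by simp⟩
      | j + 2, ih =>
        obtain ⟨a, b, e, hab⟩ := ih j (by omega)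
        obtain ⟨a', b', e', hab'⟩ := ih (j + 1) (by omega)
        refine ⟨a' - a, b' - b, ?_, fun k => ?_⟩
        · push_cast
          linear_combination ζ ^ j * hζ + e' - e
        · have : c (elem hζ k (j + 1)) = c (elem hζ k (j + 2)) + c (elem hζ k j) := by
            refine hadd _ _ _ (mem_padd ?_)
            change (2 : ℂ) ^ k * ζ ^ (j + 1) = 2 ^ k * ζ ^ (j + 2) + 2 ^ k * ζ ^ j
            linear_combination (-(2 : ℂ) ^ k * ζ ^ j) * hζ
          rw [eq_sub_of_add_eq this.symm, hab, hab', sub_smul, sub_smul]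
          abel
  -- The coordinates are taken with respect to 2^(-N) and 2^(-N) ζ. All large `N` are allowed so
  -- that finitely many elements share a denominator.
  have key : ∀ x : SixthTwo ζ, ∃ N₀ : ℕ, ∀ N ≥ N₀, ∃ a b : ℤ, 2 ^ N * x.1 = a + b * ζ ∧
      c x = a • c (elem hζ (-N) 0) + b • c (elem hζ (-N) 1) := by
    intro x
    rcases eq_zero_or_elem hζ x with rfl | ⟨k, j, rfl⟩
    · exact ⟨0, fun N _ => ⟨0, 0, by change 2 ^ N * (0 : ℂ) = _; simp, by simpa using h0⟩⟩
    · refine ⟨(-k).toNat, fun N hN => ?_⟩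
      obtain ⟨a, b, e, hab⟩ := hζj j
      obtain ⟨t, ht⟩ : ∃ t : ℕ, k = -N + t := ⟨(k + N).toNat, by omega⟩
      refine ⟨2 ^ t * a, 2 ^ t * b, ?_, ?_⟩
      · change (2 : ℂ) ^ N * (2 ^ k * ζ ^ j) = _
        rw [ht, zpow_add₀ two_ne_zero, zpow_neg, zpow_natCast, zpow_natCast, e]
        push_cast
        field_simp
      · rw [ht, hpow, hab, smul_add, ← natCast_zsmul, ← natCast_zsmul, smul_smul, smul_smul]
        push_cast
        rfl
  have keyS : ∀ S : Multiset (SixthTwo ζ), ∃ N₀ : ℕ, ∀ N ≥ N₀, ∃ a b : ℤ,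
      2 ^ N * (S.map val).sum = a + b * ζ ∧
        (S.map c).sum = a • c (elem hζ (-N) 0) + b • c (elem hζ (-N) 1) := by
    intro S
    induction S using Multiset.induction_on with
    | empty => exact ⟨0, fun N _ => ⟨0, 0, by simp, by simp⟩⟩
    | cons x S ih =>
      obtain ⟨N₁, h₁⟩ := key x
      obtain ⟨N₂, h₂⟩ := ih
      refine ⟨max N₁ N₂, fun N hN => ?_⟩
      obtain ⟨a, b, e, hab⟩ := h₁ N ((le_max_left _ _).trans hN)
      obtain ⟨a', b', e', hab'⟩ := h₂ N ((le_max_right _ _).trans hN)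
      refine ⟨a + a', b + b', ?_, ?_⟩
      · have hv : val x = x.1 := rfl
        rw [Multiset.map_cons, Multiset.sum_cons, hv]
        push_cast
        linear_combination e + e'
      · rw [Multiset.map_cons, Multiset.sum_cons, hab, hab', add_smul, add_smul]
        abel
  refine hc S r ?_
  obtain ⟨N₁, h₁⟩ := key r
  obtain ⟨N₂, h₂⟩ := keyS S
  obtain ⟨a, b, e, hab⟩ := h₁ (max N₁ N₂) (le_max_left _ _)
  obtain ⟨a', b', e', hab'⟩ := h₂ (max N₁ N₂) (le_max_right _ _)
  rw [h, e] at e'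
  have h0 : ((a - a' : ℤ) : ℂ) + ((b - b' : ℤ) : ℂ) * ζ = 0 := by
    push_cast
    linear_combination e'
  obtain ⟨ha, hb⟩ := eq_zero_of_add_mul_eq_zero hζ h0
  rw [hab, hab', sub_eq_zero.1 ha, sub_eq_zero.1 hb]

theorem val_pneg (p : SixthTwo ζ) : (pneg p).1 = -p.1 := rfl

theorem hasDet_iff (hζ : ζ ^ 2 = ζ - 1) {n : Type*} [Fintype n] [DecidableEq n] {A : Matrix n n (SixthTwo ζ)}
    {d : SixthTwo ζ} : HasDet A d ↔ d.1 = (A.map val).det := by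
  have h : ((detTerms A).map val).sum = (A.map val).det :=
    sum_detTerms val val_pneg A
  rw [← h]
  exact ⟨fun hd => isSum_sum val (fun _ _ _ => val_add) val_pneg hd,
    fun hd => isSum_of_sum_eq hζ hd.symm⟩

/-- The homomorphism to a field that maps `ζ` to a root `z` of the same equation. -/
theorem exists_hom (hζ : ζ ^ 2 = ζ - 1) {F : Type u} [Field F] {z : F} (hz : z ^ 2 = z - 1) (h2 : (2 : F) ≠ 0) :
    ∃ φ : SixthTwo ζ →*₀ F, ∀ p q r, r ∈ padd p q → φ r ∈ padd (φ p) (φ q) := by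
  have hex : ∀ x : SixthTwo ζ, ∃ y : F, (x.1, y) ∈ liftRing hζ hz := by
    intro x
    rcases x.2 with h | ⟨g, hg, h⟩
    · exact ⟨0, by rw [h]; exact zero_mem _⟩
    · obtain ⟨p, hp⟩ := exists_unit_of_mem_closure hζ hz h2.isUnit hg
      exact ⟨p.1.1.2, by rw [← h, ← hp]; exact p.1.2⟩
  choose f hf using hex
  have huniq : ∀ (x : SixthTwo ζ) (y : F), (x.1, y) ∈ liftRing hζ hz → f x = y := fun x y h =>
    liftRing_snd_unique h2.isUnit (hf x) h
  refine ⟨{ toFun := f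
            map_zero' := huniq _ _ (zero_mem _)
            map_one' := huniq _ _ (one_mem _)
            map_mul' := fun x y => huniq _ _ (mul_mem (hf x) (hf y)) }, ?_⟩
  intro p q r hr
  refine Part.mem_some_iff.2 (huniq _ _ ?_)
  rw [val_add hr]
  exact add_mem (hf p) (hf q)

theorem representable_field (hζ : ζ ^ 2 = ζ - 1) {F : Type u} [Field F] {z : F} (hz : z ^ 2 = z - 1) (h2 : (2 : F) ≠ 0)
    {α : Type v} {M : Matroid α} (hM : Representable (SixthTwo ζ) M) : Representable F M := by
  obtain ⟨φ, hφ⟩ := exists_hom hζ hz h2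
  exact hM.map_hom φ hφ

end SixthTwo

end Sixth

/-! ### From GF(3) and GF(7) to P(ℂ, {2, ζ}) -/

section Lift

/-- Two standard representations with respect to the same base have maximal minors that vanish
simultaneously, as both detect the bases of `M`. Paired, these are zero or units of the product
ring, and `of_maximal` extends this to all minors. -/
theorem exists_standard_pair {α : Type v} {M : Matroid α} (h₃ : Representable (ZMod 3) M)
    (h₇ : Representable (ZMod 7) M) : ∃ (r : ℕ) (N : Matrix (Fin r) M.E (ZMod 3 × ZMod 7)),
      HasUnitMinors N ∧
      (∀ B, M.IsBase B → ∃ g : Fin r ↪ M.E, Set.range (fun i => (g i : α)) = B) ∧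
      ∀ g : Fin r ↪ M.E, (N.submatrix id g).det ≠ 0 ↔ M.IsBase (Set.range fun i => (g i : α)) := by
  obtain ⟨r, A, hA⟩ := h₃
  obtain ⟨r', A', hA'⟩ := h₇
  obtain ⟨B, hB⟩ := M.exists_isBase
  obtain ⟨g, hg, -⟩ := (hA.isBase_iff B).1 hB
  obtain ⟨g', hg', -⟩ := (hA'.isBase_iff B).1 hB
  obtain rfl : r = r' := by
    have h1 := Set.ncard_range_of_injective (Subtype.val_injective.comp g.injective)
    have h2 := Set.ncard_range_of_injective (Subtype.val_injective.comp g'.injective)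
    have h3 : Set.range (Subtype.val ∘ g) = Set.range (Subtype.val ∘ g') := hg.trans hg'.symm
    rw [h3, h2] at h1
    simpa using h1.symm
  obtain ⟨N₃, h3, k3⟩ := hA.exists_standard (g := g) (hg ▸ hB)
  obtain ⟨N₇, h7, k7⟩ := hA'.exists_standard (g := g) (hg ▸ hB)
  let N : Matrix (Fin r) M.E (ZMod 3 × ZMod 7) := Matrix.of fun i e => (N₃ i e, N₇ i e)
  have hdet : ∀ f : Fin r → M.E,
      (N.submatrix id f).det = ((N₃.submatrix id f).det, (N₇.submatrix id f).det) := by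
    intro f
    refine Prod.ext ?_ ?_
    · have := RingHom.map_det (RingHom.fst (ZMod 3) (ZMod 7)) (N.submatrix id f)
      exact this
    · have := RingHom.map_det (RingHom.snd (ZMod 3) (ZMod 7)) (N.submatrix id f)
      exact this
  refine ⟨r, N, ?_, fun B hB => ?_, fun f => ?_⟩
  · refine HasUnitMinors.of_maximal g ?_ fun f => ?_
    · refine Matrix.ext fun i j => ?_
      have e3 := congrFun (congrFun h3 i) j
      have e7 := congrFun (congrFun h7 i) j
      simp only [Matrix.submatrix_apply, id] at e3 e7
      simp only [N, Matrix.submatrix_apply, id, Matrix.of_apply, e3, e7, Matrix.one_apply]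
      split_ifs <;> rfl
    · by_cases hf : Function.Injective f
      · rw [hdet, zeroOrUnit_prod_iff, Prod.mk_eq_zero]
        have e3 := k3 ⟨f, hf⟩
        have e7 := k7 ⟨f, hf⟩
        simp only [Function.Embedding.coeFn_mk] at e3 e7
        by_cases hb : M.IsBase (Set.range fun i => (f i : α))
        · exact Or.inr ⟨e3.2 hb, e7.2 hb⟩
        · exact Or.inl ⟨not_not.1 (e3.not.2 hb), not_not.1 (e7.not.2 hb)⟩
      · obtain ⟨i, j, hij, hne⟩ := Function.not_injective_iff.1 hf
        exact Or.inl (Matrix.det_zero_of_column_eq hne (by simp [hij]))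
  · obtain ⟨f, hf, -⟩ := (hA.isBase_iff B).1 hB
    exact ⟨f, hf⟩
  · rw [hdet, Ne, Prod.mk_eq_zero, not_and_or]
    exact ⟨fun h => h.elim (k3 f).1 (k7 f).1, fun h => Or.inl ((k3 f).2 h)⟩

/-- A matroid that is representable over `GF(3)` and over `GF(7)` is representable over
`P(ℂ, {2, ζ})`. -/
theorem representable_sixthTwo {ζ : ℂ} (hζ : ζ ^ 2 = ζ - 1) {α : Type v} {M : Matroid α} [M.Finite]
    (h₃ : Representable (ZMod 3) M) (h₇ : Representable (ZMod 7) M) :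
    Representable (SixthTwo ζ) M := by
  obtain ⟨r, N, hN, hsurj, hbase⟩ := exists_standard_pair h₃ h₇
  have : Finite M.E := M.ground_finite.to_subtype
  obtain ⟨L, hL, rfl⟩ := exists_lift (isLifting_seven hζ) hN
  have hmem : ∀ x : liftRing hζ seven_root, ZeroOrUnit x → x.1.1 = 0 ∨
      ∃ g ∈ Subgroup.closure ({g : ℂˣ | (g : ℂ) = 2 ∨ (g : ℂ) = ζ} ∪ {-1}), (g : ℂ) = x.1.1 := by
    rintro x (rfl | hx)
    · exact Or.inl rfl
    · obtain ⟨k, j, -, h⟩ := exists_eq_of_isUnit hx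
      rw [h]
      exact SixthTwo.mem hζ k j
  let A : Matrix (Fin r) M.E (SixthTwo ζ) := Matrix.of fun i e => ⟨(L i e).1.1, hmem _ (hL.entry i e)⟩
  have hdet : ∀ {k : ℕ} (f : Fin k → Fin r) (g : Fin k → M.E) (d : SixthTwo ζ),
      HasDet (A.submatrix f g) d ↔ d.1 = (L.submatrix f g).det.1.1 := by
    intro k f g d
    rw [SixthTwo.hasDet_iff hζ]
    have := RingHom.map_det ((RingHom.fst ℂ (ZMod 3 × ZMod 7)).comp (liftRing hζ seven_root).subtype)
      (L.submatrix f g)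
    exact Eq.congr_right this.symm
  -- Zero-or-unit elements vanish in ℂ exactly when their image vanishes, so the lift has the same
  -- bases.
  have hne : ∀ x : liftRing hζ seven_root, ZeroOrUnit x → (x.1.1 ≠ 0 ↔ liftHom hζ seven_root x ≠ 0) := by
    intro x hx
    rw [Ne, Ne, hx.map_eq_zero]
    exact (hx.map_eq_zero ((RingHom.fst ℂ (ZMod 3 × ZMod 7)).comp (liftRing hζ seven_root).subtype)).not
  have hNdet : ∀ g : Fin r → M.E, ((L.map (liftHom hζ seven_root)).submatrix id g).det =
      liftHom hζ seven_root (L.submatrix id g).det := by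
    intro g
    rw [RingHom.map_det]
    rfl
  refine ⟨r, A, fun k f g => ⟨⟨_, hmem _ (hL k f g)⟩, (hdet _ _ _).2 rfl⟩, fun B => ?_⟩
  constructor
  · intro hB
    obtain ⟨g, rfl⟩ := hsurj B hB
    refine ⟨g, rfl, ⟨_, hmem _ (hL.det id g)⟩, (hdet _ _ _).2 rfl, fun h0 => ?_⟩
    have h1 := (hbase g).2 hB
    rw [hNdet, ← hne _ (hL.det id g)] at h1
    exact h1 (congrArg Subtype.val h0)
  · rintro ⟨g, rfl, d, hd, hd0⟩
    rw [← hbase, hNdet, ← hne _ (hL.det id g), ← (hdet _ _ _).1 hd]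
    exact fun h0 => hd0 (Subtype.ext h0)

end Lift

/-! ### Roots of z² = z - 1 in finite fields -/

section Roots

/-- The negative of an element of order three is a root. -/
theorem exists_root_of_three_dvd {F : Type*} [Field F] [Finite F] (h : 3 ∣ Nat.card Fˣ) :
    ∃ z : F, z ^ 2 = z - 1 := by
  have : Fact (Nat.Prime 3) := ⟨Nat.prime_three⟩
  obtain ⟨g, hg⟩ := exists_prime_orderOf_dvd_card' 3 h
  have h3 : (g : F) ^ 3 = 1 := by
    rw [← Units.val_pow_eq_pow_val, ← hg, pow_orderOf_eq_one, Units.val_one]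
  have h1 : (g : F) ≠ 1 := by
    intro h
    rw [Units.val_eq_one] at h
    rw [h, orderOf_one] at hg
    norm_num at hg
  have : ((g : F) - 1) * (g ^ 2 + g + 1) = 0 := by linear_combination h3
  refine ⟨-g, ?_⟩
  linear_combination (mul_eq_zero.1 this).resolve_left (sub_ne_zero.2 h1)

theorem exists_root_zmod (p : ℕ) [hp : Fact p.Prime] (h : p ≡ 1 [MOD 3]) :
    ∃ z : ZMod p, z ^ 2 = z - 1 := by
  refine exists_root_of_three_dvd ?_
  rw [Nat.card_eq_fintype_card, ZMod.card_units]
  exact (Nat.modEq_iff_dvd' hp.out.one_le).1 h.symm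

theorem two_ne_zero_of_charP {F : Type*} [Field F] (p : ℕ) [Fact p.Prime] [CharP F p] (h : 2 < p) :
    (2 : F) ≠ 0 := by
  have := (CharP.cast_eq_zero_iff F p 2).not.2 (Nat.not_dvd_of_pos_of_lt two_pos h)
  simpa using this

theorem exists_root_galoisField (p : ℕ) [hp : Fact p.Prime] :
    ∃ z : GaloisField p 2, z ^ 2 = z - 1 := by
  by_cases h3 : p = 3
  · subst h3
    -- In characteristic 3 the polynomial z² - z + 1 is the square (z + 1)².
    refine ⟨-1, ?_⟩
    have : ((3 : ℕ) : GaloisField 3 2) = 0 := CharP.cast_eq_zero _ 3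
    push_cast at this
    linear_combination this
  · refine exists_root_of_three_dvd ?_
    rw [Nat.card_units, GaloisField.card p 2 two_ne_zero]
    have h0 : p % 3 ≠ 0 := fun h =>
      h3 ((Nat.prime_dvd_prime_iff_eq Nat.prime_three hp.out).1 (Nat.dvd_of_mod_eq_zero h)).symm
    have h1 : p ^ 2 ≡ 1 [MOD 3] := by
      have : p % 3 = 1 ∨ p % 3 = 2 := by omega
      rcases this with h | h <;> simp [Nat.ModEq, Nat.pow_mod, h]
    exact (Nat.modEq_iff_dvd' (Nat.one_le_pow _ _ hp.out.pos)).1 h1.symm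

end Roots

end PartialField

/-! ### The equivalence -/

theorem mainTheorem10 {α : Type*} (M : Matroid α) [M.Finite] (ζ : ℂ) (hζ : IsPrimitiveRoot ζ 6) :
    List.TFAE
      [PartialField.Representable (PartialField.DirectProduct (ZMod 3) (ZMod 7)) M,
       PartialField.Representable
        (PartialField.OfRing ℂ {g : ℂˣ | (g : ℂ) = 2 ∨ (g : ℂ) = ζ}) M,
       PartialField.Representable (ZMod 3) M ∧
        (∀ (p : ℕ) [Fact p.Prime], 2 < p → PartialField.Representable (GaloisField p 2) M) ∧
        (∀ (p : ℕ) [Fact p.Prime], p ≡ 1 [MOD 3] → PartialField.Representable (ZMod p) M)] := by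
  have hζ' := PartialField.sq_eq_sub_one hζ
  have z3 : (2 : ZMod 3) ^ 2 = 2 - 1 := by decide
  have z7 : (3 : ZMod 7) ^ 2 = 3 - 1 := by decide
  tfae_have 1 → 2 := fun h => PartialField.representable_sixthTwo hζ' h.fst h.snd
  tfae_have 2 → 1 := fun h => by
    obtain ⟨φ, hφ⟩ := PartialField.SixthTwo.exists_hom hζ' z3 (by decide)
    obtain ⟨ψ, hψ⟩ := PartialField.SixthTwo.exists_hom hζ' z7 (by decide)
    exact h.directProduct hφ hψ
  tfae_have 2 → 3 := fun h => by
    refine ⟨PartialField.SixthTwo.representable_field hζ' z3 (by decide) h, ?_, ?_⟩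
    · intro p hp h2
      obtain ⟨z, hz⟩ := PartialField.exists_root_galoisField p
      exact PartialField.SixthTwo.representable_field hζ' hz
        (PartialField.two_ne_zero_of_charP p h2) h
    · intro p hp h1
      obtain ⟨z, hz⟩ := PartialField.exists_root_zmod p h1
      have h2 : 2 < p := by
        refine lt_of_le_of_ne hp.out.two_le ?_
        rintro rfl
        revert h1
        decide
      exact PartialField.SixthTwo.representable_field hζ' hz
        (PartialField.two_ne_zero_of_charP p h2) h
  -- Of all the fields in the third condition, GF(3) and GF(7) suffice.
  tfae_have 3 → 2 := fun h => PartialField.representable_sixthTwo hζ' h.1 (h.2.2 7 rfl)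
  tfae_finish
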